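/- **Notation.** Let $d\ge 1$. For $\mathbf n\in\mathbb Z^d$ put $|\mathbf n|=\max_i|n_i|$ and $\langle \mathbf n\rangle=\max\{1,|\mathbf n|\}$; for $a\in\mathbb R$ put $\|a\|_{\mathbb T}=\inf_{k\in\mathbb Z}|a-k|$. For $R>0$ let $D_R=\{z\in\mathbb C:|\operatorname{Im}z|<R\}$. For $\gamma>0$, $\tau>d$, $\mathrm{DC}_{\tau,\gamma}$ is the set of $\boldsymbol\omega\in[0,1]^d$ with $\|\mathbf n\cdot\boldsymbol\omega\|_{\mathbb T}\ge\gamma\langle\mathbf n\rangle^{-\tau}$ for all $\mathbf n\in\mathbb Z^d\setminus\{0\}$. $\mathscr P_R$ is the set of $1$-periodic meromorphic functions $V$ on $D_R$ for which there is $c>0$ with $|V(z)-V(z-a)|\ge c\|a\|_{\mathbb T}$ for all $a\in\mathbb R$ and all $z\in D_R$ such that neither $z$ nor $z-a$ is a pole of $V$; $|V|_R$ is the largest such $c$. $V$ is self-adjoint if $\overline{V(\bar z)}=V(z)$. For $s\ge0$, $\mathscr U_{R,s}$ is the set of kernels $\mathcal M=(\mathcal M(z,\mathbf n))_{z\in D_R,\mathbf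 n\in\mathbb Z^d}$ such that each $\mathcal M(\cdot,\mathbf n)$ is bounded, holomorphic and $1$-periodic on $D_R$ and $\|\mathcal M\|_{R,s}=\sup_{z\in D_R}\sum_{\mathbf n}|\mathcal M(z,\mathbf n)|\langle\mathbf n\rangle^s<\infty$. Given $\boldsymbol\omega$, $\mathcal M$ is self-adjoint if $\overline{\mathcal M(\bar z-\mathbf n\cdot\boldsymbol\omega,-\mathbf n)}=\mathcal M(z,\mathbf n)$ for all $z\in D_R$, $\mathbf n\in\mathbb Z^d$. Let $\mathcal Z_0$ be the set of $x\in\mathbb R$ such that $x-\mathbf n\cdot\boldsymbol\omega$ is not a pole of $V$ for any $\mathbf n\in\mathbb Z^d$. For $x\in\mathcal Z_0$ let $H_x=T_{\mathcal M}(x)+T_V(x)$ on $\ell^2(\mathbb Z^d)$, where $$(T_{\mathcal M}(x)\psi)(\mathbf n)=\sum_{\mathbf l\in\mathbb Z^d}\mathcal M(x-\mathbf n\cdot\boldsymbol\omega,\mathbf l-\mathbf n)\psi(\mathbf l),\qquad (T_V(x)\psi)(\mathbf n)=V(x-\mathbf n\cdot\boldsymbol\omega)\psi(\mathbf n),$$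 with their maximal domains. For $q\ge0$ put $\|\psi\|_q^2=\sum_{\mathbf n}|\psi(\mathbf n)|^2\langle\mathbf n\rangle^{2q}$ and $\ell^2_q(\mathbb Z^d)=\{\psi:\|\psi\|_q<\infty\}$. **Theorem (uniform dynamical localization).** Let $d\ge1$, $\gamma>0$, $\tau>d$, $\delta>0$, $\alpha_0>0$, $R>0$, $q\ge0$ and $$s>\alpha_0+\tau+q+\frac d2+7\delta,$$ and let $v>0$. Then there is $\varepsilon_0>0$, depending only on $R,\alpha_0,\gamma,\tau,v,\delta,s,d,q$, such that the following holds for every $\boldsymbol\omega\in\mathrm{DC}_{\tau,\gamma}$, every self-adjoint $V\in\mathscr P_R$ with $|V|_R=v$ and every self-adjoint $\mathcal M\in\mathscr U_{R,s}$ with $\|\mathcal M\|_{R,s}<\varepsilon_0$. For every $x\in\mathcal Z_0$ the operator $H_x$ is self-adjoint, so that it generates the strongly continuous unitary group $(e^{-\mathrm i tH_x})_{t\in\mathbb R}$, and for every $\psi\in\ell^2_q(\mathbb Z^d)$, $$\sup_{x\in\mathcal Z_0}\ \sup_{t\in\mathbb R}\ \|e^{-\mathrm i tH_x}\psi\|_q<\infty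 .$$ -/

import Mathlib

open scoped ENNReal ComplexConjugate InnerProductSpace

noncomputable section

namespace QPLocalization

/-! ### Frequencies and the lattice `ℤ^d` -/

/-- The pairing `n · ω = ∑ n_i ω_i`. -/
def dot {d : ℕ} (n : Fin d → ℤ) (ω : Fin d → ℝ) : ℝ := ∑ i, (n i : ℝ) * ω i

/-- `⟨n⟩ = max (1, |n|)`, where `|n| = max |n_i|` (this is Mathlib's norm on `Fin d → ℤ`). -/
def jap {d : ℕ} (n : Fin d → ℤ) : ℝ := max 1 ‖n‖

/-- `‖a‖_𝕋`, the distance from `a` to the integers. -/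
def torusNorm (a : ℝ) : ℝ := ⨅ k : ℤ, |a - k|

/-- `ω ∈ DC_{τ,γ}`: the frequency `ω ∈ [0,1]^d` is `(τ,γ)`-Diophantine. -/
def IsDiophantine {d : ℕ} (τ γ : ℝ) (ω : Fin d → ℝ) : Prop :=
  (∀ i, ω i ∈ Set.Icc (0 : ℝ) 1) ∧
    ∀ n : Fin d → ℤ, n ≠ 0 → γ / jap n ^ τ ≤ torusNorm (dot n ω)

/-! ### Functions on the strip -/

/-- The strip `D_R = {z : |Im z| < R}`. -/
def strip (R : ℝ) : Set ℂ := {z | |z.im| < R}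

/-- `f ∈ ℋ_R`: bounded, holomorphic and `1`-periodic on `D_R`. -/
structure MemH (R : ℝ) (f : ℂ → ℂ) : Prop where
  holomorphic : DifferentiableOn ℂ f (strip R)
  periodic : ∀ z ∈ strip R, f (z + 1) = f z
  bounded : ∃ C : ℝ, ∀ z ∈ strip R, ‖f z‖ ≤ C

/-- `z` is a pole of the meromorphic function `g`. -/
def IsPole (g : ℂ → ℂ) (z : ℂ) : Prop := meromorphicOrderAt g z < 0

/-- The monotonicity condition `|g(z) - g(z-a)| ≥ c ‖a‖_𝕋` for all real `a` and all `z ∈ D_R`,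
read at those points where both values of the meromorphic function are finite. -/
def SepBound (R : ℝ) (g : ℂ → ℂ) (c : ℝ) : Prop :=
  ∀ (a : ℝ) (z : ℂ), z ∈ strip R → ¬ IsPole g z → ¬ IsPole g (z - a) →
    c * torusNorm a ≤ ‖g z - g (z - a)‖

/-- `g ∈ 𝒫_R`: `g` is a `1`-periodic meromorphic function on `D_R` (in normal form: the function
`ℂ → ℂ` is analytic at every point of `D_R` that is not a pole) that satisfies the monotonicity
condition with some `c > 0`. -/
structure MemP (R : ℝ) (g : ℂ → ℂ) : Prop where
  meromorphic : MeromorphicNFOn g (strip R)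
  periodic : ∀ z ∈ strip R, g (z + 1) = g z
  separated : ∃ c : ℝ, 0 < c ∧ SepBound R g c

/-- `|g|_R`: the biggest constant `c` in the monotonicity condition. -/
def sepConst (R : ℝ) (g : ℂ → ℂ) : ℝ := sSup {c : ℝ | SepBound R g c}

theorem torusNorm_nonneg (a : ℝ) : 0 ≤ torusNorm a := Real.iInf_nonneg fun _ => abs_nonneg _

/-- For `g ∈ 𝒫_R` the biggest constant exists, and it is positive. -/
theorem MemP.isGreatest {R : ℝ} (hR : 0 < R) {g : ℂ → ℂ} (hg : MemP R g) :
    IsGreatest {c : ℝ | SepBound R g c} (sepConst R g) ∧ 0 < sepConst R g := by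
  obtain ⟨c₀, hc₀, hs₀⟩ := hg.separated
  have hm : MeromorphicOn g (strip R) := hg.meromorphic.meromorphicOn
  have hcount := hm.countable_compl_analyticAt_inter
  have hpole : ∀ w, AnalyticAt ℂ g w → ¬ IsPole g w := fun w hw =>
    not_lt.2 hw.meromorphicOrderAt_nonneg
  have hreal : ∀ t : ℝ, (t : ℂ) ∈ strip R := fun t => by simpa [strip] using hR
  have hc1 : {t : ℝ | ¬ AnalyticAt ℂ g (t : ℂ)}.Countable := by
    refine (hcount.preimage (f := fun t : ℝ => (t : ℂ)) Complex.ofReal_injective).mono ?_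
    intro t ht
    exact ⟨ht, hreal t⟩
  have hc2 : {t : ℝ | ¬ AnalyticAt ℂ g ((t - 1 / 2 : ℝ) : ℂ)}.Countable :=
    hc1.preimage (f := fun t : ℝ => t - 1 / 2) (sub_left_injective)
  obtain ⟨t, ht⟩ : (({t : ℝ | ¬ AnalyticAt ℂ g (t : ℂ)} ∪
      {t : ℝ | ¬ AnalyticAt ℂ g ((t - 1 / 2 : ℝ) : ℂ)})ᶜ).Nonempty :=
    ((hc1.union hc2).dense_compl ℝ).nonempty
  simp only [Set.mem_compl_iff, Set.mem_union, Set.mem_ofPred_eq, not_or, not_not] at ht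
  have hhalf : (1 / 2 : ℝ) ≤ torusNorm (1 / 2) := by
    refine le_ciInf fun k => ?_
    rcases le_or_gt k 0 with hk | hk
    · have : (k : ℝ) ≤ 0 := by exact_mod_cast hk
      rw [le_abs]; left; linarith
    · have : (1 : ℝ) ≤ k := by exact_mod_cast hk
      rw [le_abs]; right; linarith
  have hbdd : BddAbove {c : ℝ | SepBound R g c} := by
    refine ⟨2 * ‖g t - g (t - (1 / 2 : ℝ))‖, fun c hc => ?_⟩
    have h := hc (1 / 2) t (hreal t) (hpole _ ht.1) (hpole _ (by simpa using ht.2))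
    rcases le_or_gt c 0 with hc' | hc'
    · exact hc'.trans (by positivity)
    · nlinarith
  refine ⟨⟨?_, fun c hc => le_csSup hbdd hc⟩, hc₀.trans_le (le_csSup hbdd hs₀)⟩
  intro a z hz h1 h2
  rcases (torusNorm_nonneg a).eq_or_lt with h0 | h0
  · rw [← h0]; simp
  · rw [← le_div_iff₀ h0]
    exact csSup_le ⟨c₀, hs₀⟩ fun c hc => (le_div_iff₀ h0).2 (hc a z hz h1 h2)

/-- `g* = g`, where `g*(z) = conj (g (conj z))`. -/
def IsSelfAdjointPotential (R : ℝ) (g : ℂ → ℂ) : Prop :=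
  ∀ z ∈ strip R, conj (g (conj z)) = g z

/-! ### Kernels -/

/-- A kernel `ℳ = (ℳ(z,n))`; only its values for `z ∈ D_R` matter. -/
abbrev Kernel (d : ℕ) := ℂ → (Fin d → ℤ) → ℂ

/-- `‖ℳ‖_{R,s} = sup_{z ∈ D_R} ∑_n |ℳ(z,n)| ⟨n⟩^s`, with values in `[0,∞]`. -/
def kernelNorm {d : ℕ} (R s : ℝ) (M : Kernel d) : ℝ≥0∞ :=
  ⨆ z ∈ strip R, ∑' n : Fin d → ℤ, ‖M z n‖ₑ * ENNReal.ofReal (jap n ^ s)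

/-- `ℳ ∈ 𝒰_{R,s}`. -/
structure MemU {d : ℕ} (R s : ℝ) (M : Kernel d) : Prop where
  memH : ∀ n, MemH R (fun z => M z n)
  norm_lt_top : kernelNorm R s M < ⊤

/-- `ℳ* = ℳ` with respect to `ω`, where `ℳ*(z,n) = conj (ℳ(conj z - n·ω, -n))`. -/
def IsSelfAdjointKernel {d : ℕ} (R : ℝ) (ω : Fin d → ℝ) (M : Kernel d) : Prop :=
  ∀ z ∈ strip R, ∀ n : Fin d → ℤ, conj (M (conj z - (dot n ω : ℂ)) (-n)) = M z n

/-! ### Operators on `ℓ²(ℤ^d)` -/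

/-- The Hilbert space `ℓ²(ℤ^d)`. -/
abbrev L2Z (d : ℕ) := lp (fun _ : Fin d → ℤ => ℂ) 2

/-- `T_ℳ(z)`, `(T_ℳ(z)ψ)(n) = ∑_l ℳ(z - n·ω, l - n) ψ(l)`, on its maximal domain: the `ψ ∈ ℓ²`
for which all these sums converge absolutely and define an element of `ℓ²`. -/
def kernelOp {d : ℕ} (ω : Fin d → ℝ) (M : Kernel d) (z : ℂ) : L2Z d →ₗ.[ℂ] L2Z d where
  domain :=
    { carrier := {ψ | (∀ n, Summable fun l => M (z - (dot n ω : ℂ)) (l - n) * ψ l) ∧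
        Memℓp (fun n => ∑' l, M (z - (dot n ω : ℂ)) (l - n) * ψ l) 2}
      zero_mem' := by
        refine ⟨fun n => by simp, ?_⟩
        have h : (fun n => ∑' l, M (z - (dot n ω : ℂ)) (l - n) * (0 : L2Z d) l) =
            fun _ => (0 : ℂ) := by
          funext n
          simp
        rw [h]
        exact zero_memℓp
      add_mem' := by
        rintro a b ⟨ha, ha'⟩ ⟨hb, hb'⟩
        refine ⟨fun n => by simpa [mul_add] using (ha n).add (hb n), ?_⟩
        have h : (fun n => ∑' l, M (z - (dot n ω : ℂ)) (l - n) * (a + b : L2Z d) l) =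
            (fun n => ∑' l, M (z - (dot n ω : ℂ)) (l - n) * a l) +
              fun n => ∑' l, M (z - (dot n ω : ℂ)) (l - n) * b l := by
          funext n
          rw [Pi.add_apply, ← (ha n).tsum_add (hb n)]
          simp [mul_add]
        rw [h]
        exact ha'.add hb'
      smul_mem' := by
        rintro c a ⟨ha, ha'⟩
        refine ⟨fun n => by simpa [mul_left_comm] using (ha n).mul_left c, ?_⟩
        have h : (fun n => ∑' l, M (z - (dot n ω : ℂ)) (l - n) * (c • a : L2Z d) l) =
            fun n => c * ∑' l, M (z - (dot n ω : ℂ)) (l - n) * a l := by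
          funext n
          simp [mul_left_comm, tsum_mul_left]
        rw [h]
        exact ha'.const_mul c }
  toFun :=
    { toFun := fun ψ => ⟨fun n => ∑' l, M (z - (dot n ω : ℂ)) (l - n) * ψ.1 l, ψ.2.2⟩
      map_add' := by
        rintro ⟨a, ha, ha'⟩ ⟨b, hb, hb'⟩
        ext n
        refine Eq.trans ?_ ((ha n).tsum_add (hb n))
        simp [mul_add]
      map_smul' := by
        rintro c ⟨a, ha, ha'⟩
        ext n
        simp [mul_left_comm, tsum_mul_left] }

/-- `T_V(z)`, the operator of multiplication by `V(z - n·ω)`, on its maximal domain. -/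
def potentialOp {d : ℕ} (ω : Fin d → ℝ) (V : ℂ → ℂ) (z : ℂ) : L2Z d →ₗ.[ℂ] L2Z d where
  domain :=
    { carrier := {ψ | Memℓp (fun n => V (z - (dot n ω : ℂ)) * ψ n) 2}
      zero_mem' := by
        have h : (fun n => V (z - (dot n ω : ℂ)) * (0 : L2Z d) n) = fun _ => (0 : ℂ) := by
          funext n
          simp
        change Memℓp _ 2
        rw [h]
        exact zero_memℓp
      add_mem' := by
        intro a b ha hb
        have h : (fun n => V (z - (dot n ω : ℂ)) * (a + b : L2Z d) n) =
            (fun n => V (z - (dot n ω : ℂ)) * a n) + fun n => V (z - (dot n ω : ℂ)) * b n := by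
          funext n
          simp [mul_add]
        change Memℓp _ 2
        rw [h]
        exact Memℓp.add ha hb
      smul_mem' := by
        intro c a ha
        have h : (fun n => V (z - (dot n ω : ℂ)) * (c • a : L2Z d) n) =
            fun n => c * (V (z - (dot n ω : ℂ)) * a n) := by
          funext n
          simp [mul_left_comm]
        change Memℓp _ 2
        rw [h]
        exact Memℓp.const_mul ha c }
  toFun :=
    { toFun := fun ψ => ⟨fun n => V (z - (dot n ω : ℂ)) * ψ.1 n, ψ.2⟩
      map_add' := by
        intro a b
        ext n
        exact mul_add _ _ _
      map_smul' := by
        intro c a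
        ext n
        simp [mul_left_comm] }

/-- `H_x = T_ℳ(x) + T_V(x)`; the domain of the sum is the intersection of the two domains. -/
def hamiltonian {d : ℕ} (ω : Fin d → ℝ) (V : ℂ → ℂ) (M : Kernel d) (x : ℝ) :
    L2Z d →ₗ.[ℂ] L2Z d :=
  kernelOp ω M (x : ℂ) + potentialOp ω V (x : ℂ)

/-- `𝒵₀`: the real `x` such that no `x - n·ω` is a pole of `V`. -/
def regularPhases {d : ℕ} (ω : Fin d → ℝ) (V : ℂ → ℂ) : Set ℝ :=
  {x | ∀ n : Fin d → ℤ, ¬ IsPole V ((x : ℂ) - (dot n ω : ℂ))}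

/-- `‖ψ‖_q = (∑_n |ψ(n)|² ⟨n⟩^{2q})^{1/2}`, with values in `[0,∞]`. -/
def weightedNorm {d : ℕ} (q : ℝ) (ψ : (Fin d → ℤ) → ℂ) : ℝ≥0∞ :=
  (∑' n, ‖ψ n‖ₑ ^ 2 * ENNReal.ofReal (jap n ^ (2 * q))) ^ (1 / 2 : ℝ)

/-! ### The unitary group `e^{-itH}` of an unbounded self-adjoint operator -/

variable {E : Type*} [NormedAddCommGroup E] [InnerProductSpace ℂ E] [CompleteSpace E]

/-- `U` is the strongly continuous one-parameter unitary group `t ↦ e^{-itH}`: its infinitesimal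
generator, with its exact domain, is `-iH`. -/
structure IsUnitaryGroupOf (H : E →ₗ.[ℂ] E) (U : ℝ → E →L[ℂ] E) : Prop where
  map_unitary : ∀ t, U t ∈ unitary (E →L[ℂ] E)
  map_zero : U 0 = 1
  map_add : ∀ s t, U (s + t) = U s * U t
  continuous : ∀ ψ, Continuous fun t => U t ψ
  generator : ∀ ψ φ : E, (ψ, φ) ∈ H.graph ↔
    HasDerivAt (fun t : ℝ => U t ψ) (-(Complex.I • φ)) 0

open Classical in
/-- `e^{-itH}`: the unitary group generated by `-iH` (it is unique by
`IsUnitaryGroupOf.unique`), and `0` if there is none. -/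
def expNegI (H : E →ₗ.[ℂ] E) (t : ℝ) : E →L[ℂ] E :=
  if h : ∃ U, IsUnitaryGroupOf H U then h.choose t else 0

theorem IsUnitaryGroupOf.hasDerivAt {H : E →ₗ.[ℂ] E} {U : ℝ → E →L[ℂ] E}
    (hU : IsUnitaryGroupOf H U) {ψ φ : E} (h : (ψ, φ) ∈ H.graph) (t : ℝ) :
    HasDerivAt (fun t : ℝ => U t ψ) (-(Complex.I • U t φ)) t := by
  have h0 := (hU.generator ψ φ).1 h
  have h1 := ((U t).restrictScalars ℝ).hasFDerivAt.comp_hasDerivAt (0 : ℝ) h0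
  have h2 : HasDerivAt (fun s : ℝ => s - t) 1 t := (hasDerivAt_id t).sub_const t
  have h3 := HasDerivAt.scomp_of_eq t h1 h2 (by simp)
  have h4 : (fun s : ℝ => U s ψ) =
      ((⇑((U t).restrictScalars ℝ) ∘ fun t : ℝ => U t ψ) ∘ fun s : ℝ => s - t) := by
    funext s
    have := hU.map_add t (s - t)
    simp only [add_sub_cancel] at this
    simp [this]
  rw [h4]
  simpa using h3

theorem IsUnitaryGroupOf.inner_map {H : E →ₗ.[ℂ] E} {U : ℝ → E →L[ℂ] E}
    (hU : IsUnitaryGroupOf H U) (t : ℝ) (x y : E) : ⟪U t x, U t y⟫_ℂ = ⟪x, y⟫_ℂ := by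
  have h := (Unitary.mem_iff.1 (hU.map_unitary t)).1
  rw [← ContinuousLinearMap.adjoint_inner_right, ← mul_apply_eq_comp,
    ← ContinuousLinearMap.star_eq_adjoint, h, one_apply_eq_self]

theorem IsUnitaryGroupOf.graph_map {H : E →ₗ.[ℂ] E} {U : ℝ → E →L[ℂ] E}
    (hU : IsUnitaryGroupOf H U) {ψ φ : E} (h : (ψ, φ) ∈ H.graph) (t : ℝ) :
    (U t ψ, U t φ) ∈ H.graph := by
  rw [hU.generator]
  have h1 := ((U t).restrictScalars ℝ).hasFDerivAt.comp_hasDerivAt (0 : ℝ)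
    ((hU.generator ψ φ).1 h)
  have h4 : (fun s : ℝ => U s (U t ψ)) =
      (⇑((U t).restrictScalars ℝ) ∘ fun t : ℝ => U t ψ) := by
    funext s
    have := congrArg (fun A : E →L[ℂ] E => A ψ) ((hU.map_add s t).symm.trans
      ((congrArg U (add_comm s t)).trans (hU.map_add t s)))
    simpa using this
  rw [h4]
  simpa using h1

/-- A densely defined operator generates at most one unitary group. -/
theorem IsUnitaryGroupOf.unique {H : E →ₗ.[ℂ] E} (hH : Dense (H.domain : Set E))
    {U W : ℝ → E →L[ℂ] E} (hU : IsUnitaryGroupOf H U) (hW : IsUnitaryGroupOf H W) : U = W := by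
  have symm : ∀ {x x' y y' : E}, (x, x') ∈ H.graph → (y, y') ∈ H.graph →
      ⟪x', y⟫_ℂ = ⟪x, y'⟫_ℂ := by
    intro x x' y y' hx hy
    have h1 := (hU.hasDerivAt hx 0).inner ℂ (hU.hasDerivAt hy 0)
    simp only [hU.inner_map] at h1
    have h2 := h1.unique (hasDerivAt_const (0 : ℝ) ⟪x, y⟫_ℂ)
    simp only [hU.map_zero, one_apply_eq_self, inner_neg_left, inner_neg_right,
      inner_smul_left, inner_smul_right, Complex.conj_I] at h2
    have h3 : Complex.I * (⟪x', y⟫_ℂ - ⟪x, y'⟫_ℂ) = 0 := by linear_combination h2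
    simpa [sub_eq_zero] using h3
  funext t
  have key : ∀ x ∈ H.domain, ∀ y ∈ H.domain, ⟪U t x, W t y⟫_ℂ = ⟪U t x, U t y⟫_ℂ := by
    intro x hx y hy
    have gx : (x, H ⟨x, hx⟩) ∈ H.graph := H.mem_graph ⟨x, hx⟩
    have gy : (y, H ⟨y, hy⟩) ∈ H.graph := H.mem_graph ⟨y, hy⟩
    have hd : ∀ s : ℝ, HasDerivAt (fun s : ℝ => ⟪U s x, W s y⟫_ℂ) 0 s := by
      intro s
      have h1 := (hU.hasDerivAt gx s).inner ℂ (hW.hasDerivAt gy s)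
      have h2 := symm (hU.graph_map gx s) (hW.graph_map gy s)
      have h3 : ⟪U s x, -(Complex.I • W s (H ⟨y, hy⟩))⟫_ℂ +
          ⟪-(Complex.I • U s (H ⟨x, hx⟩)), W s y⟫_ℂ = 0 := by
        simp only [inner_neg_left, inner_neg_right, inner_smul_left, inner_smul_right,
          Complex.conj_I]
        linear_combination Complex.I * h2
      rwa [h3] at h1
    have h3 := is_const_of_deriv_eq_zero (fun s => (hd s).differentiableAt)
      (fun s => (hd s).deriv) t 0
    rw [hU.inner_map]
    simpa [hU.map_zero, hW.map_zero] using h3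
  have surj : ∀ z, U t ((star (U t)) z) = z := fun z => by
    have h := (Unitary.mem_iff.1 (hU.map_unitary t)).2
    rw [← mul_apply_eq_comp, h, one_apply_eq_self]
  have hy : ∀ y ∈ H.domain, U t y = W t y := by
    intro y hy
    have h1 : ∀ x, ⟪U t x, W t y - U t y⟫_ℂ = 0 := by
      have hc : IsClosed {x : E | ⟪U t x, W t y - U t y⟫_ℂ = 0} :=
        isClosed_eq (by fun_prop) continuous_const
      intro x
      exact hc.closure_subset_iff.2 (fun x hx => by
        simp [key x hx y hy]) (hH x)
    have h2 := h1 (star (U t) (W t y - U t y))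
    rw [surj, inner_self_eq_zero, sub_eq_zero] at h2
    exact h2.symm
  have h5 : (⇑(U t) : E → E) = W t :=
    Continuous.ext_on hH (U t).continuous (W t).continuous hy
  exact DFunLike.coe_injective h5

end QPLocalization

end

open QPLocalization

/-! The operators H_x are conjugated to diagonal ones by bounded invertible kernels, uniformly in x.
Kernels A(z,n) with the twisted convolution form a Banach algebra `KernelAlg ω`, represented on
ℓ²(ℤ^d) by `KernelAlg.rep x`, so one identity in the algebra serves every phase. The unbounded V
never enters the algebra; it acts only through the derivation [V,A](z,n) = (V(z) − V(z − n·ω))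
A(z,n). The goal is an invertible U and a bounded w with (M + V)U = U(V + w), where U and U⁻¹ have
finite norm for the weight (1+|n|)^q (`exists_diagonalization`).

U comes from a KAM iteration. The linear equation [V + w, X] = diag F − F is solved by division,
coefficient by coefficient. Monotonicity of V and the Diophantine condition bound the divisor V(z) −
V(z − n·ω) below by vγ⟨n⟩^{−τ}, and half of this survives as long as w has Lipschitz constant at
most v/2. No frequencies or phases have to be excluded; the price is a factor ⟨n⟩^τ, paid by
lowering the rate of an exponential weight in n. Since M decays only polynomially, it is fed in by
dyadic pieces P_k, supported on |n| ∼ 2^k and of size ε2^{−sk} for the weight exp(2^{−k}|n|)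
(`exists_kernelAlg_of_memU`; `exists_tsum_iSup_le` trades sup Σ for Σ sup on a smaller strip).

Step k (`IsApproxDiag.step`) absorbs P_k and the previous error through a factor 1 + X with X of
size ε2^{(τ−s)k}. The error left is a product of the old error and X, so small ε keeps it below
ε2^{−s(k+1)}. The weight (1+|n|)^q costs 2^{qk} at this scale, so the increments of U and U⁻¹ are
summable because s > τ + q. Cauchy's estimate on strips shrinking by 2^{−k} bounds the Lipschitz
constants of the increments of w by multiples of 2^{(1−s)k}, summable since s > 1.

For a regular phase put T = `U.rep x`. It need not be unitary, but T δ_n is an eigenvector of the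
symmetric H_x. The eigenvalues W n = (V + w)(x − n·ω) are therefore real, and they are distinct by
the separation of V. Hence the T δ_n are orthogonal, T*T is diagonal, and T e^{−itW} T⁻¹ is unitary
with generator −iH_x (`isUnitaryGroupOf_conj`). The factor e^{−itW} preserves every ‖·‖_q, and U,
U⁻¹ act on ℓ²_q with bounds free of x (`KernelAlg.weightedNorm_act_le`). -/

noncomputable section

namespace QPLocalization

/-! ### The twisted convolution algebra `ℓ¹(ℤ^d; ℓ^∞(ℂ))` -/

/-- Bounded functions on `ℂ`. -/
abbrev BddFun := lp (fun _ : ℂ => ℂ) ∞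

theorem BddFun.norm_apply_le (f : BddFun) (z : ℂ) : ‖f z‖ ≤ ‖f‖ :=
  lp.norm_apply_le_norm ENNReal.top_ne_zero f z

/-- A bounded function, as an element of `BddFun`. -/
def BddFun.mk (f : ℂ → ℂ) (C : ℝ) (h : ∀ z, ‖f z‖ ≤ C) : BddFun :=
  ⟨f, memℓp_infty ⟨C, by rintro _ ⟨z, rfl⟩; exact h z⟩⟩

@[simp] theorem BddFun.mk_apply (f : ℂ → ℂ) (C : ℝ) (h : ∀ z, ‖f z‖ ≤ C) (z : ℂ) :
    BddFun.mk f C h z = f z := rfl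

theorem BddFun.norm_mk_le (f : ℂ → ℂ) (C : ℝ) (h : ∀ z, ‖f z‖ ≤ C) : ‖BddFun.mk f C h‖ ≤ C :=
  lp.norm_le_of_forall_le ((norm_nonneg _).trans (h 0)) h

@[simp] theorem BddFun.mul_apply (f g : BddFun) (z : ℂ) : (f * g) z = f z * g z := rfl

@[simp] theorem BddFun.add_apply (f g : BddFun) (z : ℂ) : (f + g) z = f z + g z := rfl

@[simp] theorem BddFun.sub_apply (f g : BddFun) (z : ℂ) : (f - g) z = f z - g z := rfl

@[simp] theorem BddFun.neg_apply (f : BddFun) (z : ℂ) : (-f) z = -f z := rfl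

@[simp] theorem BddFun.zero_apply (z : ℂ) : (0 : BddFun) z = 0 := rfl

/-- Evaluation at a point. -/
def BddFun.eval (z : ℂ) : BddFun →L[ℂ] ℂ := lp.evalCLM ℂ (fun _ : ℂ => ℂ) ∞ z

@[simp] theorem BddFun.eval_apply (z : ℂ) (f : BddFun) : BddFun.eval z f = f z := rfl

/-- Translation of bounded functions. -/
def BddFun.shift (a : ℝ) : BddFun →+* BddFun where
  toFun f := BddFun.mk (fun z => f (z - a)) ‖f‖ fun _ => BddFun.norm_apply_le f _
  map_one' := rfl
  map_mul' _ _ := rfl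
  map_zero' := rfl
  map_add' _ _ := rfl

@[simp] theorem BddFun.shift_apply (a : ℝ) (f : BddFun) (z : ℂ) : BddFun.shift a f z = f (z - a) := rfl

theorem BddFun.norm_shift_le (a : ℝ) (f : BddFun) : ‖BddFun.shift a f‖ ≤ ‖f‖ :=
  BddFun.norm_mk_le _ _ fun _ => BddFun.norm_apply_le f _

theorem BddFun.shift_zero (f : BddFun) : BddFun.shift 0 f = f := by
  ext z; simp

theorem BddFun.shift_shift (a b : ℝ) (f : BddFun) :
    BddFun.shift a (BddFun.shift b f) = BddFun.shift (a + b) f := by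
  ext z; simp [sub_sub]

theorem BddFun.continuous_shift (a : ℝ) : Continuous (BddFun.shift a) :=
  AddMonoidHomClass.continuous_of_bound (BddFun.shift a) 1 fun f => by
    simpa using BddFun.norm_shift_le a f

theorem dot_zero {d : ℕ} (ω : Fin d → ℝ) : dot (0 : Fin d → ℤ) ω = 0 := by simp [dot]

theorem dot_add {d : ℕ} (m n : Fin d → ℤ) (ω : Fin d → ℝ) :
    dot (m + n) ω = dot m ω + dot n ω := by
  simp [dot, add_mul, Finset.sum_add_distrib]

theorem dot_sub {d : ℕ} (m n : Fin d → ℤ) (ω : Fin d → ℝ) :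
    dot (m - n) ω = dot m ω - dot n ω := by
  simp [dot, sub_mul, Finset.sum_sub_distrib]

theorem summable_mul_sub {G : Type*} [AddCommGroup G] {a b : G → ℝ} (ha : Summable a)
    (hb : Summable b) (ha0 : 0 ≤ a) (hb0 : 0 ≤ b) :
    Summable fun p : G × G => a p.1 * b (p.2 - p.1) := by
  have h := ha.mul_of_nonneg hb ha0 hb0
  let e : G × G ≃ G × G :=
    { toFun := fun p => (p.1, p.2 - p.1)
      invFun := fun p => (p.1, p.2 + p.1)
      left_inv := fun p => by simp
      right_inv := fun p => by simp }
  exact (e.summable_iff (f := fun p : G × G => a p.1 * b p.2)).2 h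

theorem tsum_tsum_mul_sub {G : Type*} [AddCommGroup G] {a b : G → ℝ} (ha : Summable a)
    (hb : Summable b) (ha0 : 0 ≤ a) (hb0 : 0 ≤ b) :
    ∑' n, ∑' l, a l * b (n - l) = (∑' n, a n) * ∑' n, b n := by
  have h := summable_mul_sub ha hb ha0 hb0
  rw [Summable.tsum_comm (f := fun l n => a l * b (n - l)) h, ← tsum_mul_right]
  refine tsum_congr fun l => ?_
  rw [tsum_mul_left]
  congr 1
  exact (Equiv.subRight l).tsum_eq b

/-- The algebra of kernels `A(z,n)` with `∑_n sup_z |A(z,n)| < ∞`, under the twisted convolution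
`(A * B)(z,n) = ∑_l A(z,l) B(z - l·ω, n - l)`. -/
def KernelAlg {d : ℕ} (_ω : Fin d → ℝ) : Type := lp (fun _ : Fin d → ℤ => BddFun) 1

namespace KernelAlg

variable {d : ℕ} {ω : Fin d → ℝ}

instance : NormedAddCommGroup (KernelAlg ω) :=
  inferInstanceAs (NormedAddCommGroup (lp (fun _ : Fin d → ℤ => BddFun) 1))

instance : CompleteSpace (KernelAlg ω) :=
  inferInstanceAs (CompleteSpace (lp (fun _ : Fin d → ℤ => BddFun) 1))

/-- The `n`-th coefficient of a kernel. -/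
def coef (A : KernelAlg ω) (n : Fin d → ℤ) : BddFun :=
  (show lp (fun _ : Fin d → ℤ => BddFun) 1 from A) n

@[ext] theorem ext {A B : KernelAlg ω} (h : ∀ n, A.coef n = B.coef n) : A = B :=
  lp.ext (funext h)

theorem norm_eq_tsum (A : KernelAlg ω) : ‖A‖ = ∑' n, ‖A.coef n‖ := by
  have h := lp.norm_eq_tsum_rpow (p := 1) (by simp)
    (show lp (fun _ : Fin d → ℤ => BddFun) 1 from A)
  simp only [ENNReal.toReal_one, Real.rpow_one, div_one] at h
  exact h

theorem summable_norm (A : KernelAlg ω) : Summable fun n => ‖A.coef n‖ := by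
  have h := (lp.memℓp (show lp (fun _ : Fin d → ℤ => BddFun) 1 from A)).summable (by simp)
  simp only [ENNReal.toReal_one, Real.rpow_one] at h
  exact h

theorem norm_coef_le (A : KernelAlg ω) (n : Fin d → ℤ) : ‖A.coef n‖ ≤ ‖A‖ :=
  lp.norm_apply_le_norm one_ne_zero (show lp (fun _ : Fin d → ℤ => BddFun) 1 from A) n

/-- A kernel from a summable family of coefficients. -/
def mk (f : (Fin d → ℤ) → BddFun) (h : Summable fun n => ‖f n‖) : KernelAlg ω :=
  (⟨f, memℓp_gen (by simpa using h)⟩ : lp (fun _ : Fin d → ℤ => BddFun) 1)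

@[simp] theorem coef_mk (f : (Fin d → ℤ) → BddFun) (h : Summable fun n => ‖f n‖) (n) :
    (mk f h : KernelAlg ω).coef n = f n := rfl

@[simp] theorem coef_add (A B : KernelAlg ω) (n) : (A + B).coef n = A.coef n + B.coef n := rfl

@[simp] theorem coef_sub (A B : KernelAlg ω) (n) : (A - B).coef n = A.coef n - B.coef n := rfl

@[simp] theorem coef_neg (A : KernelAlg ω) (n) : (-A).coef n = -A.coef n := rfl

@[simp] theorem coef_zero (n) : (0 : KernelAlg ω).coef n = 0 := rfl

theorem summable_conv (A B : KernelAlg ω) :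
    Summable fun p : (Fin d → ℤ) × (Fin d → ℤ) => ‖A.coef p.1‖ * ‖B.coef (p.2 - p.1)‖ :=
  summable_mul_sub (a := fun n => ‖A.coef n‖) (b := fun n => ‖B.coef n‖) A.summable_norm
    B.summable_norm (fun n => norm_nonneg (A.coef n)) fun n => norm_nonneg (B.coef n)

theorem norm_mul_shift_le (f g : BddFun) (a : ℝ) : ‖f * BddFun.shift a g‖ ≤ ‖f‖ * ‖g‖ :=
  (norm_mul_le _ _).trans (mul_le_mul_of_nonneg_left (BddFun.norm_shift_le _ _) (norm_nonneg _))

theorem summable_norm_mul_shift (A B : KernelAlg ω) (n : Fin d → ℤ) :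
    Summable fun l => ‖A.coef l * BddFun.shift (dot l ω) (B.coef (n - l))‖ :=
  Summable.of_nonneg_of_le (fun _ => norm_nonneg _) (fun _ => norm_mul_shift_le _ _ _)
    ((A.summable_conv B).prod_symm.prod_factor n)

theorem norm_tsum_mul_shift_le (A B : KernelAlg ω) (n : Fin d → ℤ) :
    ‖∑' l, A.coef l * BddFun.shift (dot l ω) (B.coef (n - l))‖ ≤
      ∑' l, ‖A.coef l‖ * ‖B.coef (n - l)‖ :=
  (norm_tsum_le_tsum_norm (A.summable_norm_mul_shift B n)).trans
    ((A.summable_norm_mul_shift B n).tsum_le_tsum (fun _ => norm_mul_shift_le _ _ _)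
      ((A.summable_conv B).prod_symm.prod_factor n))

instance : Mul (KernelAlg ω) where
  mul A B := mk (fun n => ∑' l, A.coef l * BddFun.shift (dot l ω) (B.coef (n - l)))
    (Summable.of_nonneg_of_le (fun _ => norm_nonneg _) (fun n => A.norm_tsum_mul_shift_le B n)
      (A.summable_conv B).prod_symm.prod)

theorem coef_mul (A B : KernelAlg ω) (n : Fin d → ℤ) :
    (A * B).coef n = ∑' l, A.coef l * BddFun.shift (dot l ω) (B.coef (n - l)) := rfl

/-- The diagonal kernel `f(z) δ_{n,0}`. -/
def diag (f : BddFun) : KernelAlg ω :=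
  mk (Pi.single 0 f) (summable_of_ne_finset_zero (s := {0}) fun n hn => by
    simp [Pi.single_eq_of_ne (Finset.notMem_singleton.1 hn)])

theorem coef_diag (f : BddFun) (n : Fin d → ℤ) :
    (diag f : KernelAlg ω).coef n = if n = 0 then f else 0 := by
  simp [diag, Pi.single_apply]

theorem norm_diag (f : BddFun) : ‖(diag f : KernelAlg ω)‖ = ‖f‖ := by
  rw [norm_eq_tsum, tsum_eq_single 0]
  · simp [coef_diag]
  · intro n hn; simp [coef_diag, hn]

theorem coef_diag_mul (f : BddFun) (A : KernelAlg ω) (n : Fin d → ℤ) :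
    (diag f * A).coef n = f * A.coef n := by
  rw [coef_mul, tsum_eq_single 0]
  · simp [coef_diag, dot_zero, BddFun.shift_zero]
  · intro l hl; simp [coef_diag, hl]

/-- The translation of f here, absent in `coef_diag_mul`, is what makes commutators with diagonal
kernels multiply the n-th coefficient by f(z) − f(z − n·ω). -/
theorem coef_mul_diag (f : BddFun) (A : KernelAlg ω) (n : Fin d → ℤ) :
    (A * diag f).coef n = A.coef n * BddFun.shift (dot n ω) f := by
  rw [coef_mul, tsum_eq_single n]
  · simp [coef_diag]
  · intro l hl; simp [coef_diag, sub_eq_zero, hl.symm]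

theorem norm_mul_le' (A B : KernelAlg ω) : ‖A * B‖ ≤ ‖A‖ * ‖B‖ := by
  rw [norm_eq_tsum, norm_eq_tsum A, norm_eq_tsum B, ← tsum_tsum_mul_sub A.summable_norm
    B.summable_norm (fun _ => norm_nonneg _) fun _ => norm_nonneg _]
  exact (A * B).summable_norm.tsum_le_tsum (A.norm_tsum_mul_shift_le B)
    (A.summable_conv B).prod_symm.prod

/-- Translations compose and n ↦ n·ω is additive, so both triple products are the same double
series, summed in different orders; absolute summability allows the exchange. -/
theorem mul_assoc' (A B C : KernelAlg ω) : A * B * C = A * (B * C) := by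
  ext1 n
  have e1 : (A * B * C).coef n = ∑' m, ∑' l, A.coef l * BddFun.shift (dot l ω) (B.coef (m - l)) *
      BddFun.shift (dot m ω) (C.coef (n - m)) := by
    rw [coef_mul]
    refine tsum_congr fun m => ?_
    rw [coef_mul, (A.summable_norm_mul_shift B m).of_norm.tsum_mul_right]
  have e2 : (A * (B * C)).coef n = ∑' l, ∑' m, A.coef l * BddFun.shift (dot l ω) (B.coef (m - l)) *
      BddFun.shift (dot m ω) (C.coef (n - m)) := by
    rw [coef_mul]
    refine tsum_congr fun l => ?_
    rw [coef_mul, ← ((B.summable_norm_mul_shift C (n - l)).of_norm.hasSum.map _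
      (BddFun.continuous_shift (dot l ω))).tsum_eq, ← Summable.tsum_mul_left]
    · rw [← (Equiv.subRight l).tsum_eq]
      refine tsum_congr fun m => ?_
      simp only [Equiv.subRight_apply, Function.comp, map_mul, BddFun.shift_shift, ← dot_add,
        add_sub_cancel, sub_sub, mul_assoc]
    · exact ((B.summable_norm_mul_shift C (n - l)).of_norm.hasSum.map _
        (BddFun.continuous_shift (dot l ω))).summable
  rw [e1, e2]
  refine Summable.tsum_comm (Summable.of_norm_bounded
    (g := fun p => ‖A.coef p.1‖ * ‖B.coef (p.2 - p.1)‖ * ‖C‖)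
    ((A.summable_conv B).mul_right ‖C‖) ?_)
  rintro ⟨l, m⟩
  refine (norm_mul_shift_le _ _ _).trans ?_
  exact mul_le_mul (norm_mul_shift_le _ _ _) (C.norm_coef_le _) (norm_nonneg _) (by positivity)

instance : One (KernelAlg ω) := ⟨diag 1⟩

theorem one_def : (1 : KernelAlg ω) = diag 1 := rfl

theorem coef_one (n : Fin d → ℤ) : (1 : KernelAlg ω).coef n = if n = 0 then 1 else 0 :=
  coef_diag 1 n

instance : NormedRing (KernelAlg ω) :=
  { (inferInstance : NormedAddCommGroup (KernelAlg ω)) with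
    mul := (· * ·)
    one := 1
    mul_assoc := mul_assoc'
    one_mul := fun A => by ext1 n; exact (coef_diag_mul 1 A n).trans (one_mul _)
    mul_one := fun A => by
      ext1 n; exact (coef_mul_diag 1 A n).trans (by rw [map_one, mul_one])
    zero_mul := fun A => by ext1 n; simp [coef_mul]
    mul_zero := fun A => by ext1 n; simp [coef_mul]
    left_distrib := fun A B C => by
      ext1 n
      simp only [coef_mul, coef_add, map_add, mul_add]
      exact (A.summable_norm_mul_shift B n).of_norm.tsum_add
        (A.summable_norm_mul_shift C n).of_norm
    right_distrib := fun A B C => by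
      ext1 n
      simp only [coef_mul, coef_add, add_mul]
      exact (A.summable_norm_mul_shift C n).of_norm.tsum_add
        (B.summable_norm_mul_shift C n).of_norm
    norm_mul_le := norm_mul_le' }

/-- Coefficients depend continuously on the kernel. -/
def coefHom (n : Fin d → ℤ) : KernelAlg ω →+ BddFun where
  toFun A := A.coef n
  map_zero' := rfl
  map_add' _ _ := rfl

@[simp] theorem coefHom_apply (n : Fin d → ℤ) (A : KernelAlg ω) : coefHom n A = A.coef n := rfl

theorem continuous_coef (n : Fin d → ℤ) : Continuous fun A : KernelAlg ω => A.coef n :=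
  AddMonoidHomClass.continuous_of_bound (coefHom n : KernelAlg ω →+ BddFun) 1 fun A => by
    simpa using A.norm_coef_le n

theorem coef_tsum {ι : Type*} {f : ι → KernelAlg ω} (h : Summable f) (n : Fin d → ℤ) :
    (∑' i, f i).coef n = ∑' i, (f i).coef n :=
  (h.hasSum.map (coefHom n) (continuous_coef n)).tsum_eq.symm

theorem coef_apply_mul (A B : KernelAlg ω) (n : Fin d → ℤ) (z : ℂ) :
    (A * B).coef n z = ∑' l, A.coef l z * B.coef (n - l) (z - dot l ω) := by
  have h := ((A.summable_norm_mul_shift B n).of_norm.hasSum.map (BddFun.eval z)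
    (BddFun.eval z).continuous).tsum_eq
  rw [coef_mul, ← BddFun.eval_apply, ← h]
  rfl

theorem summable_coef_apply_mul (A B : KernelAlg ω) (n : Fin d → ℤ) (z : ℂ) :
    Summable fun l => A.coef l z * B.coef (n - l) (z - dot l ω) :=
  ((A.summable_norm_mul_shift B n).of_norm.hasSum.map (BddFun.eval z)
    (BddFun.eval z).continuous).summable

/-! ### Weighted norms -/

/-- The weighted norm `∑_n ‖A(·,n)‖ W(n)`. -/
def wnorm (W : (Fin d → ℤ) → ℝ≥0∞) (A : KernelAlg ω) : ℝ≥0∞ := ∑' n, ‖A.coef n‖ₑ * W n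

variable (W : (Fin d → ℤ) → ℝ≥0∞)

theorem wnorm_zero : wnorm W (0 : KernelAlg ω) = 0 := by simp [wnorm]

theorem wnorm_add_le (A B : KernelAlg ω) : wnorm W (A + B) ≤ wnorm W A + wnorm W B := by
  rw [wnorm, wnorm, wnorm, ← ENNReal.tsum_add]
  refine ENNReal.tsum_le_tsum fun n => ?_
  rw [← add_mul]
  gcongr
  exact enorm_add_le _ _

theorem wnorm_neg (A : KernelAlg ω) : wnorm W (-A) = wnorm W A := by simp [wnorm]

theorem wnorm_diag (f : BddFun) : wnorm W (diag f : KernelAlg ω) = ‖f‖ₑ * W 0 := by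
  rw [wnorm, tsum_eq_single 0]
  · simp [coef_diag]
  · intro n hn; simp [coef_diag, hn]

theorem wnorm_tsum_le {f : ℕ → KernelAlg ω} (h : Summable f) :
    wnorm W (∑' i, f i) ≤ ∑' i, wnorm W (f i) := by
  simp only [wnorm]
  rw [ENNReal.tsum_comm]
  refine ENNReal.tsum_le_tsum fun n => ?_
  rw [coef_tsum h, ENNReal.tsum_mul_right]
  gcongr
  exact enorm_tsum_le_tsum_enorm

variable {W}

/-- Young's inequality in ℓ¹: a submultiplicative weight distributes over the two factors, and
translation does not increase sup norms. -/
theorem wnorm_mul_le (hW : ∀ m n, W (m + n) ≤ W m * W n) (A B : KernelAlg ω) :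
    wnorm W (A * B) ≤ wnorm W A * wnorm W B := by
  calc wnorm W (A * B) ≤ ∑' n, ∑' l, (‖A.coef l‖ₑ * W l) * (‖B.coef (n - l)‖ₑ * W (n - l)) := by
        refine ENNReal.tsum_le_tsum fun n => ?_
        rw [coef_mul]
        refine (mul_le_mul_left enorm_tsum_le_tsum_enorm _).trans ?_
        rw [← ENNReal.tsum_mul_right]
        refine ENNReal.tsum_le_tsum fun l => ?_
        have h1 : ‖A.coef l * BddFun.shift (dot l ω) (B.coef (n - l))‖ₑ ≤
            ‖A.coef l‖ₑ * ‖B.coef (n - l)‖ₑ := by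
          simp only [← ofReal_norm, ← ENNReal.ofReal_mul (norm_nonneg _)]
          exact ENNReal.ofReal_le_ofReal (norm_mul_shift_le _ _ _)
        have h2 : W n ≤ W l * W (n - l) := by simpa using hW l (n - l)
        calc _ ≤ (‖A.coef l‖ₑ * ‖B.coef (n - l)‖ₑ) * (W l * W (n - l)) := mul_le_mul' h1 h2
          _ = _ := by ring
    _ = wnorm W A * wnorm W B := by
        rw [ENNReal.tsum_comm, wnorm, wnorm, ← ENNReal.tsum_mul_right]
        refine tsum_congr fun l => ?_
        rw [ENNReal.tsum_mul_left]
        congr 1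
        exact (Equiv.subRight l).tsum_eq fun n => ‖B.coef n‖ₑ * W n

theorem wnorm_pow_le (hW : ∀ m n, W (m + n) ≤ W m * W n) (h0 : W 0 = 1) (A : KernelAlg ω)
    (k : ℕ) : wnorm W (A ^ k) ≤ wnorm W A ^ k := by
  induction k with
  | zero =>
    have h1 : ‖(1 : BddFun)‖ₑ = 1 := by rw [← ofReal_norm, norm_one, ENNReal.ofReal_one]
    rw [pow_zero, pow_zero, one_def, wnorm_diag, h0, h1, one_mul]
  | succ k ih =>
    rw [pow_succ, pow_succ]
    exact (wnorm_mul_le hW _ _).trans (mul_le_mul_left ih _)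

theorem wnorm_mono {W' : (Fin d → ℤ) → ℝ≥0∞} (h : ∀ n, W n ≤ W' n) (A : KernelAlg ω) :
    wnorm W A ≤ wnorm W' A :=
  ENNReal.tsum_le_tsum fun n => mul_le_mul_right (h n) _

theorem wnorm_one_weight (A : KernelAlg ω) : wnorm (fun _ => 1) A = ‖A‖ₑ := by
  simp only [wnorm, mul_one, ← ofReal_norm]
  rw [norm_eq_tsum, ENNReal.ofReal_tsum_of_nonneg (fun _ => norm_nonneg _) A.summable_norm]

theorem enorm_le_wnorm (hW : ∀ n, 1 ≤ W n) (A : KernelAlg ω) : ‖A‖ₑ ≤ wnorm W A := by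
  rw [← wnorm_one_weight]
  exact wnorm_mono hW A

/-- Neumann series in the weighted norm. -/
theorem exists_inverse_one_add (hW : ∀ m n, W (m + n) ≤ W m * W n) (h0 : W 0 = 1)
    (h1 : ∀ n, 1 ≤ W n) {X : KernelAlg ω} {ξ : ℝ} (hξ : ξ ≤ 1 / 2) (hξ0 : 0 ≤ ξ)
    (hX : wnorm W X ≤ ENNReal.ofReal ξ) :
    ∃ Y : KernelAlg ω, (1 + X) * Y = 1 ∧ Y * (1 + X) = 1 ∧
      HasSum (fun k => (-X) ^ k) Y ∧ wnorm W Y ≤ ENNReal.ofReal (1 + 2 * ξ) := by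
  have hn : ‖-X‖ < 1 := by
    have h := (enorm_le_wnorm h1 X).trans hX
    rw [← ofReal_norm, ENNReal.ofReal_le_ofReal_iff hξ0] at h
    rw [norm_neg]; linarith
  have hs := summable_geometric_of_norm_lt_one hn
  refine ⟨∑' k, (-X) ^ k, ?_, ?_, hs.hasSum, ?_⟩
  · simpa using mul_neg_geom_series (-X) hn
  · simpa using geom_series_mul_neg (-X) hn
  · calc wnorm W (∑' k, (-X) ^ k) ≤ ∑' k, wnorm W ((-X) ^ k) := wnorm_tsum_le W hs
      _ ≤ ∑' k, ENNReal.ofReal ξ ^ k := by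
        refine ENNReal.tsum_le_tsum fun k => (wnorm_pow_le hW h0 _ k).trans ?_
        rw [wnorm_neg]
        gcongr
      _ = ENNReal.ofReal (∑' k, ξ ^ k) := by
        rw [ENNReal.ofReal_tsum_of_nonneg (fun k => by positivity)
          (summable_geometric_of_lt_one hξ0 (by linarith))]
        simp [ENNReal.ofReal_pow hξ0]
      _ ≤ ENNReal.ofReal (1 + 2 * ξ) := by
        rw [tsum_geometric_of_lt_one hξ0 (by linarith)]
        refine ENNReal.ofReal_le_ofReal ?_
        -- The inequality 1/(1−ξ) ≤ 1 + 2ξ is where ξ ≤ 1/2 is needed.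
        rw [inv_le_iff_one_le_mul₀ (by linarith)]
        nlinarith

end KernelAlg

end QPLocalization

end

noncomputable section

namespace QPLocalization

open Filter Topology

/-! ### Holomorphic functions on strips -/

theorem isOpen_strip (r : ℝ) : IsOpen (strip r) :=
  isOpen_lt (Complex.continuous_im.abs) continuous_const

theorem strip_mono {r r' : ℝ} (h : r' ≤ r) : strip r' ⊆ strip r := fun _ hz => lt_of_lt_of_le hz h

theorem sub_ofReal_mem_strip {r : ℝ} {z : ℂ} (a : ℝ) (hz : z ∈ strip r) : z - a ∈ strip r := by
  simpa [strip] using hz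

theorem add_one_mem_strip {r : ℝ} {z : ℂ} (hz : z ∈ strip r) : z + 1 ∈ strip r := by
  simpa [strip] using hz

theorem ofReal_mem_strip {r : ℝ} (hr : 0 < r) (x : ℝ) : (x : ℂ) ∈ strip r := by
  simpa [strip] using hr

theorem convex_strip (r : ℝ) : Convex ℝ (strip r) := by
  have h : strip r = Complex.imLm ⁻¹' Set.Ioo (-r) r := by
    ext z; simp [strip, abs_lt]
  rw [h]
  exact (convex_Ioo (-r) r).linear_preimage Complex.imLm

/-- The bounded functions that are holomorphic and `1`-periodic on `D_r`. -/
def BddFun.reg (r : ℝ) : Subring BddFun where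
  carrier := {f | DifferentiableOn ℂ f (strip r) ∧ ∀ z ∈ strip r, f (z + 1) = f z}
  mul_mem' := fun {f g} hf hg => ⟨hf.1.mul hg.1, fun z hz => by simp [hf.2 z hz, hg.2 z hz]⟩
  one_mem' := ⟨differentiableOn_const 1, fun _ _ => rfl⟩
  add_mem' := fun {f g} hf hg => ⟨hf.1.add hg.1, fun z hz => by simp [hf.2 z hz, hg.2 z hz]⟩
  zero_mem' := ⟨differentiableOn_const 0, fun _ _ => rfl⟩
  neg_mem' := fun {f} hf => ⟨hf.1.neg, fun z hz => by simp [hf.2 z hz]⟩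

theorem BddFun.reg_anti {r r' : ℝ} (h : r' ≤ r) : BddFun.reg r ≤ BddFun.reg r' := fun _ hf =>
  ⟨hf.1.mono (strip_mono h), fun z hz => hf.2 z (strip_mono h hz)⟩

/-- Norm convergence is uniform convergence, which preserves holomorphy and periodicity. This keeps
infinite convolutions and Neumann series in the regular class. -/
theorem BddFun.isClosed_reg (r : ℝ) : IsClosed (BddFun.reg r : Set BddFun) := by
  refine IsSeqClosed.isClosed fun f g hf hg => ?_
  have hpt : ∀ z, Tendsto (fun k => f k z) atTop (𝓝 (g z)) := fun z =>
    ((BddFun.eval z).continuous.tendsto g).comp hg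
  have hu : TendstoUniformly (fun k => (f k : ℂ → ℂ)) g atTop := by
    rw [Metric.tendstoUniformly_iff]
    intro ε hε
    filter_upwards [Metric.tendsto_nhds.1 hg ε hε] with k hk z
    rw [dist_comm, dist_eq_norm]
    rw [dist_eq_norm] at hk
    exact (BddFun.norm_apply_le (f k - g) z).trans_lt hk
  refine ⟨(hu.tendstoLocallyUniformly.tendstoLocallyUniformlyOn (s := strip r)).differentiableOn
    (Eventually.of_forall fun k => (hf k).1) (isOpen_strip r), fun z hz => ?_⟩
  refine tendsto_nhds_unique (hpt (z + 1)) ?_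
  simpa only [(hf _).2 z hz] using hpt z

theorem BddFun.shift_mem_reg {r : ℝ} (a : ℝ) {f : BddFun} (hf : f ∈ BddFun.reg r) :
    BddFun.shift a f ∈ BddFun.reg r := by
  refine ⟨hf.1.comp (by fun_prop) fun z hz => sub_ofReal_mem_strip a hz, fun z hz => ?_⟩
  rw [BddFun.shift_apply, BddFun.shift_apply, ← hf.2 _ (sub_ofReal_mem_strip a hz),
    add_sub_right_comm]

/-- The kernels whose coefficients are holomorphic and `1`-periodic on `D_r`. -/
def KernelAlg.reg {d : ℕ} {ω : Fin d → ℝ} (r : ℝ) : Subring (KernelAlg ω) where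
  carrier := {A | ∀ n, A.coef n ∈ BddFun.reg r}
  mul_mem' := fun {A B} hA hB n => by
    rw [KernelAlg.coef_mul]
    exact (BddFun.isClosed_reg r).mem_of_tendsto (A.summable_norm_mul_shift B n).of_norm.hasSum
      (Eventually.of_forall fun s => Subring.sum_mem _ fun l _ =>
        Subring.mul_mem _ (hA l) (BddFun.shift_mem_reg _ (hB _)))
  one_mem' := fun n => by
    rw [KernelAlg.coef_one]
    split_ifs
    exacts [Subring.one_mem _, Subring.zero_mem _]
  add_mem' := fun hA hB n => Subring.add_mem _ (hA n) (hB n)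
  zero_mem' := fun _ => Subring.zero_mem _
  neg_mem' := fun hA n => Subring.neg_mem _ (hA n)

namespace KernelAlg

variable {d : ℕ} {ω : Fin d → ℝ}

theorem isClosed_reg (r : ℝ) : IsClosed ((reg r : Subring (KernelAlg ω)) : Set (KernelAlg ω)) := by
  have h : ((reg r : Subring (KernelAlg ω)) : Set (KernelAlg ω)) = ⋂ n, (fun A => A.coef n) ⁻¹' (BddFun.reg r) := by
    ext A; simp only [Set.mem_iInter]; rfl
  rw [h]
  exact isClosed_iInter fun n => (BddFun.isClosed_reg r).preimage (continuous_coef n)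

theorem reg_anti {r r' : ℝ} (h : r' ≤ r) : (reg r : Subring (KernelAlg ω)) ≤ reg r' :=
  fun _ hA n => BddFun.reg_anti h (hA n)

theorem diag_mem_reg {r : ℝ} {f : BddFun} (hf : f ∈ BddFun.reg r) :
    (diag f : KernelAlg ω) ∈ reg r := fun n => by
  rw [coef_diag]
  split_ifs
  exacts [hf, Subring.zero_mem _]

theorem mem_reg_of_hasSum_pow {r : ℝ} {X Y : KernelAlg ω} (hX : X ∈ reg r)
    (h : HasSum (fun k => (-X) ^ k) Y) : Y ∈ reg r :=
  (isClosed_reg r).mem_of_tendsto h (Eventually.of_forall fun _ => Subring.sum_mem _ fun k _ =>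
    Subring.pow_mem _ (Subring.neg_mem _ hX) k)

end KernelAlg

/-! ### Cauchy estimates and reciprocals of differences -/

/-- Cauchy's estimate: a bounded periodic function on `D_r` is Lipschitz on a smaller strip. -/
theorem norm_sub_shift_le_torusNorm {r r' C : ℝ} (hr : r' < r) {f : ℂ → ℂ}
    (hf : DifferentiableOn ℂ f (strip r)) (hp : ∀ z ∈ strip r, f (z + 1) = f z)
    (hC : ∀ z ∈ strip r, ‖f z‖ ≤ C) (a : ℝ) {z : ℂ} (hz : z ∈ strip r') :
    ‖f z - f (z - a)‖ ≤ C / (r - r') * torusNorm a := by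
  have hz' : z ∈ strip r := strip_mono hr.le hz
  have hC0 : 0 ≤ C := (norm_nonneg _).trans (hC z hz')
  -- Cauchy's estimate on the disc of radius r − r', which stays in the larger strip.
  have hderiv : ∀ w ∈ strip r', ‖deriv f w‖ ≤ C / (r - r') := by
    intro w hw
    have hb : Metric.closedBall w (r - r') ⊆ strip r := by
      intro u hu
      have h1 : |u.im - w.im| ≤ r - r' := by
        have := Complex.abs_im_le_norm (u - w)
        rw [Complex.sub_im] at this
        exact this.trans (by simpa [dist_eq_norm] using hu)
      have h2 : |w.im| < r' := hw
      have h3 : |u.im| ≤ |u.im - w.im| + |w.im| := by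
        simpa using abs_add_le (u.im - w.im) w.im
      change |u.im| < r
      linarith
    refine Complex.norm_deriv_le_of_forall_mem_sphere_norm_le (sub_pos.2 hr) ?_
      fun u hu => hC u (hb (Metric.sphere_subset_closedBall hu))
    exact (hf.mono hb).diffContOnCl_ball subset_rfl
  have hlip : ∀ t : ℝ, ‖f z - f (z - t)‖ ≤ C / (r - r') * |t| := by
    intro t
    have h := (convex_strip r').norm_image_sub_le_of_norm_deriv_le (𝕜 := ℂ)
      (fun w hw => hf.differentiableAt ((isOpen_strip r).mem_nhds (strip_mono hr.le hw))) hderiv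
      (sub_ofReal_mem_strip t hz) hz
    simpa using h
  have hnat : ∀ (k : ℕ) (w : ℂ), w ∈ strip r → f (w + k) = f w := by
    intro k
    induction k with
    | zero => intro w _; simp
    | succ k ih =>
      intro w hw
      rw [Nat.cast_succ, ← ih w hw, ← add_assoc, hp]
      have := sub_ofReal_mem_strip (-(k : ℝ)) hw
      simpa using this
  have hint : ∀ (k : ℤ) (w : ℂ), w ∈ strip r → f (w + k) = f w := by
    intro k w hw
    obtain ⟨n, rfl | rfl⟩ := k.eq_nat_or_neg
    · simpa using hnat n w hw
    · have := hnat n (w + ((-n : ℤ) : ℂ)) (by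
        have := sub_ofReal_mem_strip (n : ℝ) hw
        simpa [sub_eq_add_neg] using this)
      rw [← this]
      simp
  have hk : ∀ k : ℤ, ‖f z - f (z - a)‖ ≤ C / (r - r') * |a - k| := by
    intro k
    have h := hlip (a - k)
    have h1 : z - ((a - k : ℝ) : ℂ) = (z - a) + k := by push_cast; ring
    rwa [h1, hint k _ (sub_ofReal_mem_strip a hz')] at h
  -- A zero Lipschitz constant cannot be divided out before taking the infimum over k; then k = 0
  -- already suffices.
  rcases eq_or_lt_of_le (div_nonneg hC0 (sub_pos.2 hr).le) with h0 | h0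
  · have := hk 0
    rw [← h0] at this ⊢
    simpa using this
  · rw [← div_le_iff₀' h0]
    exact le_ciInf fun k => (div_le_iff₀' h0).2 (hk k)

/-- The reciprocal of a difference `V⁺(z) - V⁺(z - a)`, `V⁺ = V + w`, that is bounded below
extends holomorphically through the poles of `V`. -/
theorem exists_inverse_difference {R r b a : ℝ} (hr : r ≤ R) {V w : ℂ → ℂ}
    (hV : MeromorphicNFOn V (strip R)) (hVp : ∀ z ∈ strip R, V (z + 1) = V z)
    (hw : DifferentiableOn ℂ w (strip r)) (hwp : ∀ z ∈ strip r, w (z + 1) = w z) (hb : 0 < b)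
    (hsep : ∀ z ∈ strip r, ¬ IsPole V z → ¬ IsPole V (z - a) →
      b ≤ ‖(V z + w z) - (V (z - a) + w (z - a))‖) :
    ∃ g : BddFun, g ∈ BddFun.reg r ∧ ‖g‖ ≤ b⁻¹ ∧ ∀ z ∈ strip r, ¬ IsPole V z →
      ¬ IsPole V (z - a) → g z * ((V z + w z) - (V (z - a) + w (z - a))) = 1 := by
  set D : ℂ → ℂ := fun z => (V z + w z) - (V (z - a) + w (z - a)) with hD
  have hVan : ∀ z ∈ strip r, ¬ IsPole V z → AnalyticAt ℂ V z := fun z hz h =>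
    (hV (strip_mono hr hz)).meromorphicOrderAt_nonneg_iff_analyticAt.1 (not_lt.1 h)
  have hwan : ∀ z ∈ strip r, AnalyticAt ℂ w z := fun z hz =>
    hw.analyticAt ((isOpen_strip r).mem_nhds hz)
  have hshift : ∀ z : ℂ, AnalyticAt ℂ (fun z : ℂ => z - (a : ℂ)) z := fun z => by fun_prop
  have hVpan : ∀ z ∈ strip r, AnalyticAt ℂ V z → ¬ IsPole V z := fun z _ h =>
    not_lt.2 h.meromorphicOrderAt_nonneg
  have hDan : ∀ z ∈ strip r, ¬ IsPole V z → ¬ IsPole V (z - a) → AnalyticAt ℂ D z := by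
    intro z hz h1 h2
    have hz' := sub_ofReal_mem_strip a hz
    have e1 : AnalyticAt ℂ (fun z : ℂ => V (z - a)) z :=
      AnalyticAt.fun_comp (g := V) (f := fun z : ℂ => z - (a : ℂ)) (hVan _ hz' h2) (hshift z)
    have e2 : AnalyticAt ℂ (fun z : ℂ => w (z - a)) z :=
      AnalyticAt.fun_comp (g := w) (f := fun z : ℂ => z - (a : ℂ)) (hwan _ hz') (hshift z)
    exact ((hVan z hz h1).add (hwan z hz)).sub (e1.add e2)
  have hDmer : MeromorphicOn D (strip r) := by
    intro z hz
    have hz' := sub_ofReal_mem_strip a hz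
    have e1 : MeromorphicAt (fun z : ℂ => V (z - a)) z := by
      have := (hV (strip_mono hr hz')).meromorphicAt
      exact this.comp_analyticAt (g := fun z : ℂ => z - (a : ℂ)) (hshift z)
    have e2 : AnalyticAt ℂ (fun z : ℂ => w (z - a)) z :=
      AnalyticAt.fun_comp (g := w) (f := fun z : ℂ => z - (a : ℂ)) (hwan _ hz') (hshift z)
    exact ((hV (strip_mono hr hz)).meromorphicAt.add (hwan z hz).meromorphicAt).sub
      (e1.add e2.meromorphicAt)
  have hgood : ∀ z ∈ strip r, ∀ᶠ u in 𝓝[≠] z, u ∈ strip r ∧ ¬ IsPole V u ∧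
      ¬ IsPole V (u - a) := by
    intro z hz
    have hz' := sub_ofReal_mem_strip a hz
    have e0 : ∀ᶠ u in 𝓝[≠] z, u ∈ strip r :=
      eventually_nhdsWithin_of_eventually_nhds ((isOpen_strip r).mem_nhds hz)
    have e1 := (hV (strip_mono hr hz)).meromorphicAt.eventually_analyticAt
    have e2 : ∀ᶠ u in 𝓝[≠] z, AnalyticAt ℂ V (u - a) := by
      have h := (hV (strip_mono hr hz')).meromorphicAt.eventually_analyticAt
      have ht : Tendsto (fun u : ℂ => u - (a : ℂ)) (𝓝[≠] z) (𝓝[≠] (z - a)) := by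
        refine tendsto_nhdsWithin_of_tendsto_nhds_of_eventually_within _ ?_ ?_
        · exact ((continuous_sub_right (a : ℂ)).tendsto z).mono_left nhdsWithin_le_nhds
        · filter_upwards [self_mem_nhdsWithin] with u hu
          simpa using hu
      exact ht.eventually h
    filter_upwards [e0, e1, e2] with u h0 h1 h2
    exact ⟨h0, hVpan u h0 h1, hVpan _ (sub_ofReal_mem_strip a h0) h2⟩
  -- Where V or its translate has a pole, the value of D is meaningless; the normal form puts the
  -- right value of the reciprocal there.
  set h := toMeromorphicNFOn D⁻¹ (strip r) with hh
  have hhNF : MeromorphicNFOn h (strip r) := meromorphicNFOn_toMeromorphicNFOn _ _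
  have hheq : ∀ z ∈ strip r, ¬ IsPole V z → ¬ IsPole V (z - a) → h z = (D z)⁻¹ := by
    intro z hz h1 h2
    have hne : D z ≠ 0 := by
      have := hb.trans_le (hsep z hz h1 h2)
      exact norm_pos_iff.1 this
    rw [hh, toMeromorphicNFOn_eq_toMeromorphicNFAt hDmer.inv hz, toMeromorphicNFAt_eq_self.2
      ((hDan z hz h1 h2).inv hne).meromorphicNFAt]
    rfl
  have hbd : ∀ z ∈ strip r, ¬ IsPole V z → ¬ IsPole V (z - a) → ‖h z‖ ≤ b⁻¹ := by
    intro z hz h1 h2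
    rw [hheq z hz h1 h2, norm_inv]
    exact inv_anti₀ hb (hsep z hz h1 h2)
  -- A pole of h would force ‖h‖ → ∞ along a punctured neighbourhood, where the bound b⁻¹ holds.
  have hhan : ∀ z ∈ strip r, AnalyticAt ℂ h z := by
    intro z hz
    rw [← (hhNF hz).meromorphicOrderAt_nonneg_iff_analyticAt]
    by_contra hneg
    have ht := tendsto_norm_atTop_iff_cobounded.2
      (tendsto_cobounded_of_meromorphicOrderAt_neg (not_le.1 hneg))
    have h1 := ht.eventually (eventually_gt_atTop b⁻¹)
    obtain ⟨u, hu1, hu2⟩ := (h1.and (hgood z hz)).exists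
    exact absurd (hbd u hu2.1 hu2.2.1 hu2.2.2) (not_le.2 hu1)
  have hbd' : ∀ z ∈ strip r, ‖h z‖ ≤ b⁻¹ := by
    intro z hz
    have ht : Tendsto (fun u => ‖h u‖) (𝓝[≠] z) (𝓝 ‖h z‖) :=
      ((hhan z hz).continuousAt.norm.tendsto).mono_left nhdsWithin_le_nhds
    refine le_of_tendsto ht ?_
    filter_upwards [hgood z hz] with u hu using hbd u hu.1 hu.2.1 hu.2.2
  have hper : ∀ z ∈ strip r, h (z + 1) = h z := by
    intro z hz
    have hz1 := add_one_mem_strip hz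
    have ht1 : Tendsto (fun u : ℂ => u + 1) (𝓝[≠] z) (𝓝[≠] (z + 1)) := by
      refine tendsto_nhdsWithin_of_tendsto_nhds_of_eventually_within _ ?_ ?_
      · exact ((continuous_add_const (1 : ℂ)).tendsto z).mono_left nhdsWithin_le_nhds
      · filter_upwards [self_mem_nhdsWithin] with u hu
        simpa using hu
    have l1 : Tendsto (fun u => h (u + 1)) (𝓝[≠] z) (𝓝 (h (z + 1))) :=
      ((hhan _ hz1).continuousAt.tendsto.mono_left nhdsWithin_le_nhds).comp ht1
    have l2 : Tendsto h (𝓝[≠] z) (𝓝 (h z)) :=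
      (hhan z hz).continuousAt.tendsto.mono_left nhdsWithin_le_nhds
    refine tendsto_nhds_unique_of_eventuallyEq l1 l2 ?_
    filter_upwards [ht1.eventually (hgood _ hz1), hgood z hz] with u hu1 hu2
    rw [hheq _ hu1.1 hu1.2.1 hu1.2.2, hheq u hu2.1 hu2.2.1 hu2.2.2]
    congr 1
    have hu' := sub_ofReal_mem_strip a hu2.1
    have e : u + 1 - (a : ℂ) = (u - a) + 1 := by ring
    simp only [hD]
    rw [e, hVp u (strip_mono hr hu2.1), hVp _ (strip_mono hr hu'), hwp u hu2.1, hwp _ hu']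
  classical
  -- Elements of `BddFun` live on all of ℂ; extension by zero is harmless, since regularity concerns
  -- the strip only.
  refine ⟨BddFun.mk ((strip r).indicator h) b⁻¹ fun z => ?_, ⟨?_, fun z hz => ?_⟩,
    BddFun.norm_mk_le _ _ _, fun z hz h1 h2 => ?_⟩
  · by_cases hz : z ∈ strip r
    · simpa [hz] using hbd' z hz
    · simp [hz, hb.le]
  · refine DifferentiableOn.congr (f := h) (fun z hz =>
      (hhan z hz).differentiableAt.differentiableWithinAt) fun z hz => ?_
    simp [hz]
  · simp [hz, add_one_mem_strip hz, hper z hz]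
  · have hne : D z ≠ 0 := norm_pos_iff.1 (hb.trans_le (hsep z hz h1 h2))
    simp only [BddFun.mk_apply, Set.indicator_of_mem hz, hheq z hz h1 h2]
    exact inv_mul_cancel₀ hne

/-- On a smaller strip, `∑ sup` is controlled by `sup ∑`. -/
theorem exists_tsum_iSup_le {R : ℝ} (hR : 0 < R) :
    ∃ C : ℝ, 0 < C ∧ ∀ (ι : Type) [Countable ι] (f : ι → ℂ → ℂ) (W : ι → ℝ≥0∞) (S : ℝ≥0∞),
      (∀ i, MemH R (f i)) → (∀ z ∈ strip R, ∑' i, ‖f i z‖ₑ * W i ≤ S) →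
      ∑' i, (⨆ z ∈ strip (R / 2), ‖f i z‖ₑ) * W i ≤ ENNReal.ofReal C * S := by
  -- By periodicity it is enough to bound f on this compact set. Circles of radius R/4 centred in K
  -- stay in |Im z| ≤ 3R/4 < R.
  set K : Set ℂ := Set.Icc (0 : ℝ) 1 ×ℂ Set.Icc (-(R / 2)) (R / 2) with hK
  have hKc : IsCompact K := isCompact_Icc.reProdIm isCompact_Icc
  obtain ⟨t, htK, htc⟩ := hKc.elim_nhds_subcover (fun c => Metric.ball c (R / 8))
    fun c _ => Metric.ball_mem_nhds c (by positivity)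
  -- Each disc contributes (1/π)·2π = 2; the extra 1 makes the constant positive without asking
  -- whether the cover is nonempty.
  refine ⟨2 * (t.card + 1), by positivity, fun ι _ f W S hf hS => ?_⟩
  have hcirc : ∀ c ∈ t, ∀ θ : ℝ, circleMap c (R / 4) θ ∈ strip R := by
    intro c hc θ
    have h1 := (htK c hc).2
    have h2 : ‖circleMap c (R / 4) θ - c‖ = R / 4 := by
      simp [circleMap, abs_of_pos hR]
    have h3 := (Complex.abs_im_le_norm (circleMap c (R / 4) θ - c)).trans h2.le
    rw [Complex.sub_im, abs_le] at h3
    have h4 := h1.1; have h5 := h1.2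
    simp only [strip, Set.mem_ofPred_eq, abs_lt]
    constructor <;> linarith [h3.1, h3.2]
  have hball : ∀ c ∈ t, Metric.closedBall c (R / 4) ⊆ strip R := by
    intro c hc u hu
    have h1 := (htK c hc).2
    have h3 := (Complex.abs_im_le_norm (u - c)).trans (by simpa [dist_eq_norm] using hu)
    rw [Complex.sub_im, abs_le] at h3
    have h4 := h1.1; have h5 := h1.2
    simp only [strip, Set.mem_ofPred_eq, abs_lt]
    constructor <;> linarith [h3.1, h3.2]
  -- The Cauchy kernel times the speed R/4 is at most (R/4)/(R/8) = 2, whence 1/π. The supremum over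
  -- z becomes an integral, which commutes with the sum over i.
  have hcauchy : ∀ i, ∀ c ∈ t, ∀ z ∈ Metric.ball c (R / 8), ‖f i z‖ₑ ≤
      ENNReal.ofReal (1 / Real.pi) *
        ∫⁻ θ in Set.Ioc 0 (2 * Real.pi), ‖f i (circleMap c (R / 4) θ)‖ₑ := by
    intro i c hc z hz
    have hz' : z ∈ Metric.ball c (R / 4) := Metric.ball_subset_ball (by linarith) hz
    have hdc : DiffContOnCl ℂ (f i) (Metric.ball c (R / 4)) :=
      ((hf i).holomorphic.mono (hball c hc)).diffContOnCl_ball subset_rfl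
    have hform := hdc.two_pi_i_inv_smul_circleIntegral_sub_inv_smul hz'
    rw [← hform, circleIntegral, intervalIntegral.integral_of_le (by positivity), enorm_smul]
    have hsc : ‖(2 * (Real.pi : ℂ) * Complex.I)⁻¹‖ₑ = ENNReal.ofReal (1 / (2 * Real.pi)) := by
      rw [← ofReal_norm]
      congr 1
      simp [abs_of_pos Real.pi_pos]
    have hle : ∀ θ : ℝ, ‖deriv (circleMap c (R / 4)) θ • ((circleMap c (R / 4) θ - z)⁻¹ •
        f i (circleMap c (R / 4) θ))‖ₑ ≤ ENNReal.ofReal 2 * ‖f i (circleMap c (R / 4) θ)‖ₑ := by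
      intro θ
      rw [← ofReal_norm, ← ofReal_norm, ← ENNReal.ofReal_mul (by norm_num)]
      refine ENNReal.ofReal_le_ofReal ?_
      have h1 : ‖circleMap c (R / 4) θ - c‖ = R / 4 := by simp [circleMap, abs_of_pos hR]
      have h2 : R / 8 ≤ ‖circleMap c (R / 4) θ - z‖ := by
        have h3 : ‖circleMap c (R / 4) θ - c‖ ≤ ‖circleMap c (R / 4) θ - z‖ + ‖z - c‖ := by
          simpa using norm_add_le (circleMap c (R / 4) θ - z) (z - c)
        have h4 : ‖z - c‖ < R / 8 := by simpa [dist_eq_norm] using hz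
        linarith
      have h5 : ‖deriv (circleMap c (R / 4)) θ‖ = R / 4 := by
        simp [deriv_circleMap]; positivity
      rw [norm_smul, norm_smul, h5, norm_inv, ← mul_assoc]
      refine mul_le_mul_of_nonneg_right ?_ (norm_nonneg _)
      rw [← div_eq_mul_inv, div_le_iff₀ (by linarith)]
      linarith
    calc _ ≤ ENNReal.ofReal (1 / (2 * Real.pi)) * ∫⁻ θ in Set.Ioc 0 (2 * Real.pi),
          ENNReal.ofReal 2 * ‖f i (circleMap c (R / 4) θ)‖ₑ := by
          rw [hsc]
          gcongr
          exact (MeasureTheory.enorm_integral_le_lintegral_enorm _).trans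
            (MeasureTheory.lintegral_mono hle)
      _ = _ := by
          rw [MeasureTheory.lintegral_const_mul' _ _ ENNReal.ofReal_ne_top, ← mul_assoc,
            ← ENNReal.ofReal_mul (by positivity)]
          congr 2
          field_simp
  have hsup : ∀ i, (⨆ z ∈ strip (R / 2), ‖f i z‖ₑ) ≤ ∑ c ∈ t, ENNReal.ofReal (1 / Real.pi) *
      ∫⁻ θ in Set.Ioc 0 (2 * Real.pi), ‖f i (circleMap c (R / 4) θ)‖ₑ := by
    intro i
    refine iSup₂_le fun z hz => ?_
    have hper : f i (z - ⌊z.re⌋) = f i z := by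
      have h := norm_sub_shift_le_torusNorm (r := R) (r' := R / 2) (C := (hf i).bounded.choose)
        (by linarith) (hf i).holomorphic (hf i).periodic (hf i).bounded.choose_spec
        (⌊z.re⌋ : ℝ) hz
      have h0 : torusNorm (⌊z.re⌋ : ℝ) ≤ 0 :=
        (ciInf_le ⟨0, by rintro _ ⟨k, rfl⟩; exact abs_nonneg _⟩ ⌊z.re⌋).trans (by simp)
      rw [le_antisymm h0 (torusNorm_nonneg _), mul_zero] at h
      have := sub_eq_zero.1 (norm_eq_zero.1 (le_antisymm h (norm_nonneg _)))
      rw [this]; push_cast; rfl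
    have hzK : z - ⌊z.re⌋ ∈ K := by
      have hz1 := abs_lt.1 (show |z.im| < R / 2 from hz)
      refine ⟨⟨?_, ?_⟩, ⟨?_, ?_⟩⟩
      · simp
      · simpa using (Int.fract_lt_one z.re).le
      · simpa using hz1.1.le
      · simpa using hz1.2.le
    obtain ⟨c, hct, hzc⟩ := Set.mem_iUnion₂.1 (htc hzK)
    rw [← hper]
    exact (hcauchy i c hct _ hzc).trans (Finset.single_le_sum (f := fun c =>
      ENNReal.ofReal (1 / Real.pi) *
      ∫⁻ θ in Set.Ioc 0 (2 * Real.pi), ‖f i (circleMap c (R / 4) θ)‖ₑ) (fun _ _ => zero_le) hct)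
  have hmeas : ∀ i, ∀ c ∈ t, Measurable fun θ : ℝ => ‖f i (circleMap c (R / 4) θ)‖ₑ * W i := by
    intro i c hc
    have : Continuous fun θ : ℝ => f i (circleMap c (R / 4) θ) :=
      (hf i).holomorphic.continuousOn.comp_continuous (continuous_circleMap c (R / 4))
        (hcirc c hc)
    exact this.enorm.measurable.mul_const _
  calc ∑' i, (⨆ z ∈ strip (R / 2), ‖f i z‖ₑ) * W i
      ≤ ∑' i, ∑ c ∈ t, ENNReal.ofReal (1 / Real.pi) *
        ∫⁻ θ in Set.Ioc 0 (2 * Real.pi), ‖f i (circleMap c (R / 4) θ)‖ₑ * W i := by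
        refine ENNReal.tsum_le_tsum fun i => (mul_le_mul_left (hsup i) _).trans ?_
        rw [Finset.sum_mul]
        refine Finset.sum_le_sum fun c hc => ?_
        rw [mul_assoc]
        gcongr
        exact MeasureTheory.lintegral_mul_const_le _ _
    _ = ∑ c ∈ t, ENNReal.ofReal (1 / Real.pi) *
        ∫⁻ θ in Set.Ioc 0 (2 * Real.pi), ∑' i, ‖f i (circleMap c (R / 4) θ)‖ₑ * W i := by
        rw [Summable.tsum_finsetSum fun _ _ => ENNReal.summable]
        refine Finset.sum_congr rfl fun c hc => ?_
        rw [ENNReal.tsum_mul_left, MeasureTheory.lintegral_tsum fun i =>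
          (hmeas i c hc).aemeasurable]
    _ ≤ ∑ c ∈ t, ENNReal.ofReal (1 / Real.pi) * ∫⁻ _ in Set.Ioc 0 (2 * Real.pi), S := by
        refine Finset.sum_le_sum fun c hc => ?_
        gcongr with θ
        exact hS _ (hcirc c hc θ)
    _ = ENNReal.ofReal (2 * t.card) * S := by
        rw [MeasureTheory.setLIntegral_const, Real.volume_Ioc, Finset.sum_const, nsmul_eq_mul,
          mul_comm S, ← mul_assoc, ← mul_assoc, mul_assoc (t.card : ℝ≥0∞),
          ← ENNReal.ofReal_mul (by positivity), ← ENNReal.ofReal_natCast,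
          ← ENNReal.ofReal_mul (by positivity)]
        congr 2
        field_simp
        ring
    _ ≤ ENNReal.ofReal (2 * (t.card + 1)) * S := by gcongr; linarith

end QPLocalization

end

noncomputable section

namespace QPLocalization

/-! ### Weights -/

/-- The exponential weight `e^{ρ|n|}`. -/
def expWeight {d : ℕ} (ρ : ℝ) (n : Fin d → ℤ) : ℝ≥0∞ := ENNReal.ofReal (Real.exp (ρ * ‖n‖))

theorem expWeight_zero {d : ℕ} (ρ : ℝ) : expWeight ρ (0 : Fin d → ℤ) = 1 := by simp [expWeight]

theorem one_le_expWeight {d : ℕ} {ρ : ℝ} (hρ : 0 ≤ ρ) (n : Fin d → ℤ) : 1 ≤ expWeight ρ n := by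
  rw [expWeight, ENNReal.one_le_ofReal, Real.one_le_exp_iff]
  positivity

theorem expWeight_add_le {d : ℕ} {ρ : ℝ} (hρ : 0 ≤ ρ) (m n : Fin d → ℤ) :
    expWeight ρ (m + n) ≤ expWeight ρ m * expWeight ρ n := by
  rw [expWeight, expWeight, expWeight, ← ENNReal.ofReal_mul (Real.exp_nonneg _), ← Real.exp_add,
    ← mul_add]
  gcongr
  exact norm_add_le _ _

theorem expWeight_mono {d : ℕ} {ρ ρ' : ℝ} (h : ρ' ≤ ρ) (n : Fin d → ℤ) :
    expWeight ρ' n ≤ expWeight ρ n := by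
  rw [expWeight, expWeight]
  gcongr

theorem one_le_jap {d : ℕ} (n : Fin d → ℤ) : 1 ≤ jap n := le_max_left _ _

theorem jap_pos {d : ℕ} (n : Fin d → ℤ) : 0 < jap n := zero_lt_one.trans_le (one_le_jap n)

/-! ### Commutators with the potential -/

/-- No `z - n·ω` is a pole of `V`. -/
def IsRegularPoint {d : ℕ} (ω : Fin d → ℝ) (V : ℂ → ℂ) (z : ℂ) : Prop :=
  ∀ n : Fin d → ℤ, ¬ IsPole V (z - (dot n ω : ℂ))

theorem IsRegularPoint.sub_dot {d : ℕ} {ω : Fin d → ℝ} {V : ℂ → ℂ} {z : ℂ}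
    (h : IsRegularPoint ω V z) (m : Fin d → ℤ) : IsRegularPoint ω V (z - dot m ω) := fun n => by
  have := h (m + n)
  rwa [dot_add, Complex.ofReal_add, ← sub_sub] at this

theorem IsRegularPoint.not_isPole {d : ℕ} {ω : Fin d → ℝ} {V : ℂ → ℂ} {z : ℂ}
    (h : IsRegularPoint ω V z) : ¬ IsPole V z := by
  simpa [dot_zero] using h 0

/-- `[V, A] = B` on the strip `D_r`, away from the orbits of the poles of `V`. -/
def IsPotentialCommutator {d : ℕ} {ω : Fin d → ℝ} (V : ℂ → ℂ) (r : ℝ) (A B : KernelAlg ω) : Prop :=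
  ∀ z ∈ strip r, IsRegularPoint ω V z → ∀ n : Fin d → ℤ,
    (V z - V (z - dot n ω)) * A.coef n z = B.coef n z

namespace IsPotentialCommutator

variable {d : ℕ} {ω : Fin d → ℝ} {V : ℂ → ℂ} {r : ℝ} {A A' B B' : KernelAlg ω}

theorem one : IsPotentialCommutator V r (1 : KernelAlg ω) 0 := fun z _ _ n => by
  rw [KernelAlg.coef_one]
  split_ifs with h
  · simp [h, dot_zero]
  · simp

theorem add (hA : IsPotentialCommutator V r A A') (hB : IsPotentialCommutator V r B B') :
    IsPotentialCommutator V r (A + B) (A' + B') := fun z hz hg n => by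
  simp only [KernelAlg.coef_add, BddFun.add_apply]
  rw [mul_add, hA z hz hg, hB z hz hg]

theorem mono {r' : ℝ} (h : r' ≤ r) (hA : IsPotentialCommutator V r A A') :
    IsPotentialCommutator V r' A A' := fun z hz => hA z (strip_mono h hz)

/-- Leibniz rule: V(z) − V(z − n·ω) splits at z − l·ω, and the second difference is the commutator
factor of B at the shifted point where the twist evaluates it. Regular points are invariant under
these shifts. -/
theorem mul (hA : IsPotentialCommutator V r A A') (hB : IsPotentialCommutator V r B B') :
    IsPotentialCommutator V r (A * B) (A' * B + A * B') := fun z hz hg n => by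
  rw [KernelAlg.coef_add, BddFun.add_apply, KernelAlg.coef_apply_mul, KernelAlg.coef_apply_mul,
    KernelAlg.coef_apply_mul, ← tsum_mul_left,
    ← (A'.summable_coef_apply_mul B n z).tsum_add (A.summable_coef_apply_mul B' n z)]
  refine tsum_congr fun l => ?_
  rw [← hA z hz hg l, ← hB _ (sub_ofReal_mem_strip _ hz) (hg.sub_dot l) (n - l), dot_sub,
    Complex.ofReal_sub, sub_sub, add_sub_cancel]
  ring

end IsPotentialCommutator

/-! ### One step of the diagonalization -/

/-- `U` conjugates `M + V` to the diagonal `V + w` up to the error `E`. -/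
structure IsApproxDiag {d : ℕ} {ω : Fin d → ℝ} (V : ℂ → ℂ) (r ρ η β ℓ : ℝ)
    (M U U' E : KernelAlg ω) (w : BddFun) : Prop where
  mul_inv : U * U' = 1
  inv_mul : U' * U = 1
  memU : U ∈ KernelAlg.reg r
  memU' : U' ∈ KernelAlg.reg r
  memE : E ∈ KernelAlg.reg r
  memw : w ∈ BddFun.reg r
  lip : ∀ z ∈ strip r, ∀ a : ℝ, ‖w z - w (z - a)‖ ≤ ℓ * torusNorm a
  -- This encodes (M + V)U = U(V + w + E) with V entering only through its commutator.
  comm : IsPotentialCommutator V r U (U * KernelAlg.diag w + U * E - M * U)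
  normU : KernelAlg.wnorm (expWeight ρ) U ≤ ENNReal.ofReal β
  normU' : KernelAlg.wnorm (expWeight ρ) U' ≤ ENNReal.ofReal β
  normE : KernelAlg.wnorm (expWeight ρ) E ≤ ENNReal.ofReal η

/-- A multiplier that grows in n no faster than the ratio of two weights is bounded from the
stronger weighted norm to the weaker; this pays for small divisors. -/
theorem KernelAlg.exists_coef_eq_mul {d : ℕ} {ω : Fin d → ℝ} {W W' : (Fin d → ℤ) → ℝ≥0∞}
    (hW' : ∀ n, 1 ≤ W' n) (F : KernelAlg ω) (g : (Fin d → ℤ) → BddFun) {κ c : ℝ}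
    (hκ : 0 ≤ κ) (hg : ∀ n, ‖g n‖ₑ * W' n ≤ ENNReal.ofReal κ * W n)
    (hF : wnorm W F ≤ ENNReal.ofReal c) :
    ∃ X : KernelAlg ω, (∀ n, X.coef n = F.coef n * g n) ∧ wnorm W' X ≤ ENNReal.ofReal (κ * c) := by
  have hb : ∑' n, ‖F.coef n * g n‖ₑ * W' n ≤ ENNReal.ofReal (κ * c) := by
    calc ∑' n, ‖F.coef n * g n‖ₑ * W' n ≤ ∑' n, ENNReal.ofReal κ * (‖F.coef n‖ₑ * W n) := by
          refine ENNReal.tsum_le_tsum fun n => ?_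
          have h1 : ‖F.coef n * g n‖ₑ ≤ ‖F.coef n‖ₑ * ‖g n‖ₑ := by
            simp only [← ofReal_norm, ← ENNReal.ofReal_mul (norm_nonneg _)]
            exact ENNReal.ofReal_le_ofReal (norm_mul_le _ _)
          calc _ ≤ (‖F.coef n‖ₑ * ‖g n‖ₑ) * W' n := mul_le_mul_left h1 _
            _ = ‖F.coef n‖ₑ * (‖g n‖ₑ * W' n) := by ring
            _ ≤ ‖F.coef n‖ₑ * (ENNReal.ofReal κ * W n) := mul_le_mul_right (hg n) _
            _ = _ := by ring
      _ = ENNReal.ofReal κ * wnorm W F := by rw [ENNReal.tsum_mul_left]; rfl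
      _ ≤ ENNReal.ofReal (κ * c) := by
          rw [ENNReal.ofReal_mul hκ]
          gcongr
  have hs : Summable fun n => ‖F.coef n * g n‖ := by
    have h1 : ∑' n, ‖F.coef n * g n‖ₑ ≠ ⊤ := by
      refine ne_top_of_le_ne_top ENNReal.ofReal_ne_top (le_trans ?_ hb)
      exact ENNReal.tsum_le_tsum fun n => le_mul_of_one_le_right' (hW' n)
    simpa using ENNReal.summable_toReal h1
  exact ⟨mk _ hs, fun n => rfl, hb⟩

theorem enorm_le_ofReal {E : Type*} [SeminormedAddGroup E] {x : E} {c : ℝ} (h : ‖x‖ ≤ c) :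
    ‖x‖ₑ ≤ ENNReal.ofReal c := by
  rw [← ofReal_norm]
  exact ENNReal.ofReal_le_ofReal h

theorem norm_le_of_enorm_le {E : Type*} [SeminormedAddGroup E] {x : E} {c : ℝ} (hc : 0 ≤ c)
    (h : ‖x‖ₑ ≤ ENNReal.ofReal c) : ‖x‖ ≤ c := by
  rwa [← ofReal_norm, ENNReal.ofReal_le_ofReal_iff hc] at h

/-- V separates by v‖n·ω‖, w can undo at most half of it, and the rest is bounded below by the
Diophantine condition. -/
theorem SepBound.le_norm_sub {d : ℕ} {ω : Fin d → ℝ} {τ γ v R r ℓ : ℝ} {V w : ℂ → ℂ} (hr : r ≤ R)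
    (hω : IsDiophantine τ γ ω) (hsep : SepBound R V v) (hℓ : ℓ ≤ v / 2) (hv : 0 < v)
    (hlip : ∀ z ∈ strip r, ∀ a : ℝ, ‖w z - w (z - a)‖ ≤ ℓ * torusNorm a)
    {n : Fin d → ℤ} (hn : n ≠ 0) {z : ℂ} (hz : z ∈ strip r) (h1 : ¬ IsPole V z)
    (h2 : ¬ IsPole V (z - dot n ω)) :
    v / 2 * (γ / jap n ^ τ) ≤ ‖(V z + w z) - (V (z - dot n ω) + w (z - dot n ω))‖ := by
  have e1 := hsep (dot n ω) z (strip_mono hr hz) h1 h2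
  have e2 := hlip z hz (dot n ω)
  have e3 := hω.2 n hn
  have e4 : ‖V z - V (z - dot n ω)‖ ≤
      ‖(V z + w z) - (V (z - dot n ω) + w (z - dot n ω))‖ + ‖w z - w (z - dot n ω)‖ := by
    have := norm_sub_le ((V z + w z) - (V (z - dot n ω) + w (z - dot n ω)))
      (w z - w (z - dot n ω))
    convert! this using 2
    ring
  have e5 : ℓ * torusNorm (dot n ω) ≤ v / 2 * torusNorm (dot n ω) :=
    mul_le_mul_of_nonneg_right hℓ (torusNorm_nonneg _)
  have e6 : v / 2 * (γ / jap n ^ τ) ≤ v / 2 * torusNorm (dot n ω) :=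
    mul_le_mul_of_nonneg_left e3 (by linarith)
  linarith

theorem KernelAlg.norm_coef_le_of_wnorm {d : ℕ} {ω : Fin d → ℝ} {ρ c : ℝ} (hρ : 0 ≤ ρ) (hc : 0 ≤ c)
    {A : KernelAlg ω} (h : wnorm (expWeight ρ) A ≤ ENNReal.ofReal c) (n : Fin d → ℤ) :
    ‖A.coef n‖ ≤ c :=
  (A.norm_coef_le n).trans
    (norm_le_of_enorm_le hc ((enorm_le_wnorm (one_le_expWeight hρ) A).trans h))

/-- Solution of the homological equation `[V + w, X] = diag F - F`. -/
theorem exists_homological_solution {d : ℕ} {ω : Fin d → ℝ} {τ γ v R r ρ ρ' κ ℓ c : ℝ}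
    {V : ℂ → ℂ} (hγ : 0 < γ) (hω : IsDiophantine τ γ ω) (hV : MemP R V) (hv : 0 < v)
    (hsep : SepBound R V v) (hr : r ≤ R) (hρ' : 0 ≤ ρ') (hκ0 : 0 ≤ κ)
    (hκ : ∀ n : Fin d → ℤ, jap n ^ τ * Real.exp (ρ' * ‖n‖) ≤ κ * Real.exp (ρ * ‖n‖))
    (hℓ : ℓ ≤ v / 2) {w : BddFun} (hw : w ∈ BddFun.reg r)
    (hlip : ∀ z ∈ strip r, ∀ a : ℝ, ‖w z - w (z - a)‖ ≤ ℓ * torusNorm a)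
    {F : KernelAlg ω} (hF : F ∈ KernelAlg.reg r)
    (hFn : KernelAlg.wnorm (expWeight ρ) F ≤ ENNReal.ofReal c) :
    ∃ X : KernelAlg ω, X ∈ KernelAlg.reg r ∧
      KernelAlg.wnorm (expWeight ρ') X ≤ ENNReal.ofReal (2 / (v * γ) * κ * c) ∧
      IsPotentialCommutator V r X (KernelAlg.diag (F.coef 0) - F -
        (KernelAlg.diag w * X - X * KernelAlg.diag w)) := by
  have hinv : ∀ n : Fin d → ℤ, ∃ g : BddFun, g ∈ BddFun.reg r ∧
      ‖g‖ ≤ 2 / (v * γ) * jap n ^ τ ∧ (n = 0 → g = 0) ∧ (n ≠ 0 → ∀ z ∈ strip r, ¬ IsPole V z →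
        ¬ IsPole V (z - dot n ω) →
          g z * ((V z + w z) - (V (z - dot n ω) + w (z - dot n ω))) = -1) := by
    intro n
    have hj : 0 < jap n ^ τ := Real.rpow_pos_of_pos (jap_pos n) _
    rcases eq_or_ne n 0 with hn | hn
    · exact ⟨0, Subring.zero_mem _, by rw [norm_zero]; positivity, fun _ => rfl,
        fun h => absurd hn h⟩
    · obtain ⟨g, h1, h2, h3⟩ := exists_inverse_difference hr hV.meromorphic hV.periodic hw.1 hw.2
        (b := v / 2 * (γ / jap n ^ τ)) (a := dot n ω) (by positivity)
        fun z hz p1 p2 => hsep.le_norm_sub hr hω hℓ hv hlip hn hz p1 p2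
      refine ⟨-g, Subring.neg_mem _ h1, ?_, fun h => absurd h hn, fun _ z hz p1 p2 => ?_⟩
      · rw [norm_neg]
        refine h2.trans (le_of_eq ?_)
        field_simp
      · rw [BddFun.neg_apply, neg_mul, h3 z hz p1 p2]
  choose g hg1 hg2 hg3 hg4 using hinv
  obtain ⟨X, hX1, hX2⟩ := KernelAlg.exists_coef_eq_mul (W := expWeight ρ) (W' := expWeight ρ')
    (one_le_expWeight hρ') F g (κ := 2 / (v * γ) * κ) (by positivity) (fun n => by
      refine (mul_le_mul_left (enorm_le_ofReal (hg2 n)) _).trans ?_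
      have hj : 0 < jap n ^ τ := Real.rpow_pos_of_pos (jap_pos n) _
      rw [expWeight, expWeight, ← ENNReal.ofReal_mul (by positivity),
        ← ENNReal.ofReal_mul (by positivity), mul_assoc, mul_assoc]
      refine ENNReal.ofReal_le_ofReal ?_
      exact mul_le_mul_of_nonneg_left (hκ n) (by positivity)) hFn
  refine ⟨X, fun n => by rw [hX1]; exact Subring.mul_mem _ (hF n) (hg1 n), hX2,
    fun z hz hreg n => ?_⟩
  simp only [KernelAlg.coef_sub, KernelAlg.coef_diag_mul, KernelAlg.coef_mul_diag, hX1,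
    KernelAlg.coef_diag, BddFun.sub_apply, BddFun.mul_apply, BddFun.shift_apply]
  rcases eq_or_ne n 0 with hn | hn
  · simp [hn, hg3 0 rfl]
  · have h := hg4 n hn z hz hreg.not_isPole (hreg n)
    rw [if_neg hn, BddFun.zero_apply]
    linear_combination (F.coef n z) * h

/-- One step of the iteration: absorb the perturbation `P` and the previous error. -/
theorem IsApproxDiag.step {d : ℕ} {ω : Fin d → ℝ} {τ γ v R r r' ρ ρ' κ η β ℓ ξ : ℝ}
    {V : ℂ → ℂ} (hγ : 0 < γ) (hω : IsDiophantine τ γ ω) (hV : MemP R V) (hv : 0 < v)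
    (hsep : SepBound R V v) (hr : r ≤ R) (hr' : r' < r) (hρ' : 0 ≤ ρ') (hρ : ρ' ≤ ρ)
    (hκ0 : 0 ≤ κ)
    (hκ : ∀ n : Fin d → ℤ, jap n ^ τ * Real.exp (ρ' * ‖n‖) ≤ κ * Real.exp (ρ * ‖n‖))
    (hη : 0 ≤ η) (hβ0 : 0 ≤ β) (hβ : β ≤ 2) (hℓ : ℓ + 5 * η / (r - r') ≤ v / 2)
    (hξ : 2 / (v * γ) * κ * (5 * η) ≤ ξ) (hξ0 : 0 ≤ ξ) (hξ1 : ξ ≤ 1 / 2)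
    {M P U U' E : KernelAlg ω} {w : BddFun} (hP : P ∈ KernelAlg.reg r)
    (hPn : KernelAlg.wnorm (expWeight ρ) P ≤ ENNReal.ofReal η)
    (h : IsApproxDiag V r ρ η β ℓ M U U' E w) :
    ∃ (U₁ U₁' E₁ : KernelAlg ω) (w₁ : BddFun),
      IsApproxDiag V r' ρ' (20 * η * ξ) (β * (1 + 2 * ξ)) (ℓ + 5 * η / (r - r')) (M + P)
        U₁ U₁' E₁ w₁ ∧
      KernelAlg.wnorm (expWeight ρ') (U₁ - U) ≤ ENNReal.ofReal (4 * ξ) ∧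
      KernelAlg.wnorm (expWeight ρ') (U₁' - U') ≤ ENNReal.ofReal (4 * ξ) ∧
      ‖w₁ - w‖ ≤ 5 * η := by
  have hρ0 : 0 ≤ ρ := hρ'.trans hρ
  have hsub : ∀ m n : Fin d → ℤ, expWeight ρ (m + n) ≤ expWeight ρ m * expWeight ρ n :=
    expWeight_add_le hρ0
  have hsub' : ∀ m n : Fin d → ℤ, expWeight ρ' (m + n) ≤ expWeight ρ' m * expWeight ρ' n :=
    expWeight_add_le hρ'
  have hdown : ∀ A : KernelAlg ω, KernelAlg.wnorm (expWeight ρ') A ≤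
      KernelAlg.wnorm (expWeight ρ) A := KernelAlg.wnorm_mono (expWeight_mono hρ)
  -- Conjugation by U turns M + P + V into V + w + F.
  set F := E + U' * P * U with hFdef
  have hFmem : F ∈ KernelAlg.reg r :=
    Subring.add_mem _ h.memE (Subring.mul_mem _ (Subring.mul_mem _ h.memU' hP) h.memU)
  -- 5 = 1 + 2·2: one η from E, and 2·η·2 from the conjugated P.
  have hFn : KernelAlg.wnorm (expWeight ρ) F ≤ ENNReal.ofReal (5 * η) := by
    have hU2 := h.normU.trans (ENNReal.ofReal_le_ofReal hβ)
    have hU2' := h.normU'.trans (ENNReal.ofReal_le_ofReal hβ)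
    calc KernelAlg.wnorm (expWeight ρ) F
        ≤ ENNReal.ofReal η + ENNReal.ofReal 2 * ENNReal.ofReal η * ENNReal.ofReal 2 := by
          refine (KernelAlg.wnorm_add_le _ _ _).trans (add_le_add h.normE ?_)
          refine (KernelAlg.wnorm_mul_le hsub _ _).trans (mul_le_mul' ?_ hU2)
          exact (KernelAlg.wnorm_mul_le hsub _ _).trans (mul_le_mul' hU2' hPn)
      _ = ENNReal.ofReal (5 * η) := by
          rw [← ENNReal.ofReal_mul (by norm_num), ← ENNReal.ofReal_mul (by positivity),
            ← ENNReal.ofReal_add hη (by positivity)]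
          congr 1
          ring
  have hF0 : ‖F.coef 0‖ ≤ 5 * η :=
    KernelAlg.norm_coef_le_of_wnorm hρ0 (by positivity) hFn 0
  -- The diagonal of F is not a commutator and must join w. Solving the homological equation with
  -- w₁, not w, keeps it out of the new error.
  set w₁ := w + F.coef 0 with hw₁
  have hw₁mem : w₁ ∈ BddFun.reg r' :=
    BddFun.reg_anti hr'.le (Subring.add_mem _ h.memw (hFmem 0))
  have hlip₁ : ∀ z ∈ strip r', ∀ a : ℝ,
      ‖w₁ z - w₁ (z - a)‖ ≤ (ℓ + 5 * η / (r - r')) * torusNorm a := by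
    intro z hz a
    have e1 := h.lip z (strip_mono hr'.le hz) a
    have e2 := norm_sub_shift_le_torusNorm hr' (hFmem 0).1 (hFmem 0).2
      (fun u _ => (BddFun.norm_apply_le _ u).trans hF0) a hz
    have e3 : w₁ z - w₁ (z - a) =
        (w z - w (z - a)) + (F.coef 0 z - F.coef 0 (z - a)) := by
      simp only [hw₁, BddFun.add_apply]; ring
    rw [e3, add_mul]
    exact (norm_add_le _ _).trans (add_le_add e1 e2)
  obtain ⟨X, hXmem, hXn, hXc⟩ := exists_homological_solution hγ hω hV hv hsep
    (hr'.le.trans hr) hρ' hκ0 hκ hℓ hw₁mem hlip₁ (KernelAlg.reg_anti hr'.le hFmem) hFn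
  replace hXn := hXn.trans (ENNReal.ofReal_le_ofReal hξ)
  obtain ⟨Y, hY1, hY2, hYs, hYn⟩ := KernelAlg.exists_inverse_one_add hsub' (expWeight_zero ρ')
    (one_le_expWeight hρ') hξ1 hξ0 hXn
  have hYmem := KernelAlg.mem_reg_of_hasSum_pow hXmem hYs
  have hYn2 : KernelAlg.wnorm (expWeight ρ') Y ≤ ENNReal.ofReal 2 :=
    hYn.trans (ENNReal.ofReal_le_ofReal (by linarith))
  have h1Xmem : 1 + X ∈ KernelAlg.reg r' := Subring.add_mem _ (Subring.one_mem _) hXmem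
  have hUmem := KernelAlg.reg_anti hr'.le h.memU
  have hUmem' := KernelAlg.reg_anti hr'.le h.memU'
  have hone : KernelAlg.wnorm (expWeight ρ') (1 : KernelAlg ω) ≤ ENNReal.ofReal 1 := by
    have h1 := KernelAlg.wnorm_pow_le hsub' (expWeight_zero ρ') (1 : KernelAlg ω) 0
    simpa using h1
  have h1Xn : KernelAlg.wnorm (expWeight ρ') (1 + X) ≤ ENNReal.ofReal (1 + 2 * ξ) := by
    refine (KernelAlg.wnorm_add_le _ _ _).trans ((add_le_add hone hXn).trans ?_)
    rw [← ENNReal.ofReal_add zero_le_one hξ0]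
    exact ENNReal.ofReal_le_ofReal (by linarith)
  set F₀ := F - KernelAlg.diag (F.coef 0) with hF₀
  have hF₀mem : F₀ ∈ KernelAlg.reg r' :=
    KernelAlg.reg_anti hr'.le (Subring.sub_mem _ hFmem (KernelAlg.diag_mem_reg (hFmem 0)))
  have hF₀n : KernelAlg.wnorm (expWeight ρ') F₀ ≤ ENNReal.ofReal (5 * η) := by
    refine le_trans ?_ ((hdown F).trans hFn)
    refine ENNReal.tsum_le_tsum fun n => ?_
    rw [hF₀, KernelAlg.coef_sub, KernelAlg.coef_diag]
    split_ifs with hn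
    · simp [hn]
    · simp
  have hdiff : ∀ {A B : KernelAlg ω} {c : ℝ}, KernelAlg.wnorm (expWeight ρ') A ≤
      ENNReal.ofReal c → KernelAlg.wnorm (expWeight ρ') B ≤ ENNReal.ofReal ξ → 0 ≤ c → c ≤ 4 →
      KernelAlg.wnorm (expWeight ρ') (A * B) ≤ ENNReal.ofReal (4 * ξ) := by
    intro A B c hA hB hc hc4
    refine (KernelAlg.wnorm_mul_le hsub' _ _).trans ((mul_le_mul' hA hB).trans ?_)
    rw [← ENNReal.ofReal_mul hc]
    exact ENNReal.ofReal_le_ofReal (mul_le_mul_of_nonneg_right hc4 hξ0)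
  -- Since [V + w₁, X] = −F₀, the first-order terms cancel: (V + w₁ + F₀)(1 + X) = (1 + X)(V + w₁) +
  -- F₀X. With Y = (1 + X)⁻¹ the error is Y F₀ X.
  refine ⟨U * (1 + X), Y * U', Y * F₀ * X, w₁, ⟨?_, ?_, ?_, ?_, ?_, hw₁mem, hlip₁, ?_, ?_, ?_, ?_⟩,
    ?_, ?_, ?_⟩
  · rw [mul_assoc, ← mul_assoc (1 + X), hY1, one_mul, h.mul_inv]
  · rw [mul_assoc, ← mul_assoc U', h.inv_mul, one_mul, hY2]
  · exact Subring.mul_mem _ hUmem h1Xmem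
  · exact Subring.mul_mem _ hYmem hUmem'
  · exact Subring.mul_mem _ (Subring.mul_mem _ hYmem hF₀mem) hXmem
  · have hcomm := (h.comm.mono hr'.le).mul (IsPotentialCommutator.one.add hXc)
    convert! hcomm using 1
    have hPU : P * U = U * (F₀ + KernelAlg.diag (F.coef 0) - E) := by
      rw [hF₀, sub_add_cancel, hFdef, add_sub_cancel_left, ← mul_assoc, ← mul_assoc, h.mul_inv,
        one_mul]
    have hE₁ : U * (1 + X) * (Y * F₀ * X) = U * F₀ * X := by
      rw [mul_assoc Y, mul_assoc U, ← mul_assoc (1 + X), hY1, one_mul, mul_assoc]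
    have hdiag : (KernelAlg.diag w₁ : KernelAlg ω) =
        KernelAlg.diag w + KernelAlg.diag (F.coef 0) := by
      ext1 n
      simp only [KernelAlg.coef_add, KernelAlg.coef_diag, hw₁]
      split_ifs <;> simp
    have hFF : KernelAlg.diag (F.coef 0) - F = -F₀ := by rw [hF₀]; abel
    rw [hE₁, add_mul, ← mul_assoc P, hPU, hFF, hdiag]
    noncomm_ring
  · refine (KernelAlg.wnorm_mul_le hsub' _ _).trans
      ((mul_le_mul' ((hdown U).trans h.normU) h1Xn).trans ?_)
    rw [← ENNReal.ofReal_mul hβ0]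
  · refine (KernelAlg.wnorm_mul_le hsub' _ _).trans
      ((mul_le_mul' hYn ((hdown U').trans h.normU')).trans ?_)
    rw [← ENNReal.ofReal_mul (by positivity), mul_comm]
  · refine (KernelAlg.wnorm_mul_le hsub' _ _).trans ((mul_le_mul'
      ((KernelAlg.wnorm_mul_le hsub' _ _).trans (mul_le_mul' hYn2 hF₀n)) hXn).trans ?_)
    rw [← ENNReal.ofReal_mul (by norm_num), ← ENNReal.ofReal_mul (by positivity)]
    refine ENNReal.ofReal_le_ofReal ?_
    nlinarith [mul_nonneg hη hξ0]
  · have e : U * (1 + X) - U = U * X := by noncomm_ring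
    rw [e]
    exact hdiff ((hdown U).trans h.normU) hXn hβ0 (by linarith)
  · have e : Y * U' - U' = -((Y * X) * U') := by
      have : Y + Y * X = 1 := by rw [← hY2]; noncomm_ring
      calc Y * U' - U' = Y * U' - (Y + Y * X) * U' := by rw [this, one_mul]
        _ = -((Y * X) * U') := by noncomm_ring
    rw [e, KernelAlg.wnorm_neg]
    refine (KernelAlg.wnorm_mul_le hsub' _ _).trans ((mul_le_mul'
      ((KernelAlg.wnorm_mul_le hsub' _ _).trans (mul_le_mul' hYn2 hXn))
      (((hdown U').trans h.normU').trans (ENNReal.ofReal_le_ofReal hβ))).trans ?_)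
    rw [← ENNReal.ofReal_mul (by norm_num), ← ENNReal.ofReal_mul (by positivity)]
    exact ENNReal.ofReal_le_ofReal (by linarith)
  · rw [hw₁, add_sub_cancel_left]
    exact hF0

end QPLocalization

end

noncomputable section

namespace QPLocalization

open Filter Topology

/-! ### The iteration -/

/-- Dependent choice that also records a relation between consecutive states, here the increment
bounds needed for convergence. -/
theorem exists_seq_of_step {S : Type*} (p : ℕ → S → Prop) (rel : ℕ → S → S → Prop) (s₀ : S)
    (h₀ : p 0 s₀) (hstep : ∀ k s, p k s → ∃ s', p (k + 1) s' ∧ rel k s s') :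
    ∃ f : ℕ → S, f 0 = s₀ ∧ ∀ k, p k (f k) ∧ rel k (f k) (f (k + 1)) := by
  choose! g hg using hstep
  let f : ℕ → S := fun k => Nat.rec s₀ (fun k s => g k s) k
  have hf : ∀ k, p k (f k) := fun k => by
    induction k with
    | zero => exact h₀
    | succ k ih => exact (hg k _ ih).1
  exact ⟨f, rfl, fun k => ⟨hf k, (hg k _ (hf k)).2⟩⟩

/-- Apply (u/p)^p ≤ e^u with u = 2^{−(k+1)}⟨n⟩. A power p of ⟨n⟩ thus costs 2^{pk} when the
exponential rate drops from 2^{−k} to 2^{−(k+1)}. -/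
theorem jap_rpow_le {d : ℕ} {p : ℝ} (hp : 0 < p) (k : ℕ) (n : Fin d → ℤ) :
    jap n ^ p ≤ (2 * p) ^ p * Real.exp (1 / 2) * ((2 : ℝ) ^ p) ^ k *
      Real.exp ((1 / 2) ^ (k + 1) * ‖n‖) := by
  set u : ℝ := (1 / 2) ^ (k + 1) * jap n with hu
  have hk : (0 : ℝ) < (1 / 2) ^ (k + 1) := by positivity
  have hu0 : 0 < u := mul_pos hk (jap_pos n)
  have h1 : u ≤ 1 / 2 + (1 / 2) ^ (k + 1) * ‖n‖ := by
    have h2 : jap n ≤ 1 + ‖n‖ := max_le (by linarith [norm_nonneg n]) (by linarith)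
    have h3 : ((1 : ℝ) / 2) ^ (k + 1) ≤ 1 / 2 := by
      have := pow_le_pow_of_le_one (a := (1 / 2 : ℝ)) (by norm_num) (by norm_num)
        (show 1 ≤ k + 1 by omega)
      simpa using this
    nlinarith
  have h2 : (u / p) ^ p ≤ Real.exp u := by
    have h3 : u / p ≤ Real.exp (u / p) := by linarith [Real.add_one_le_exp (u / p)]
    calc (u / p) ^ p ≤ Real.exp (u / p) ^ p := Real.rpow_le_rpow (by positivity) h3 hp.le
      _ = Real.exp u := by rw [← Real.exp_mul]; congr 1; field_simp
  have h4 : jap n = 2 * p * 2 ^ k * (u / p) := by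
    rw [hu, pow_succ, one_div, inv_pow]; field_simp
  have h5 : ((2 : ℝ) ^ k) ^ p = ((2 : ℝ) ^ p) ^ k := by
    rw [← Real.rpow_natCast, ← Real.rpow_mul (by norm_num), ← Real.rpow_natCast,
      ← Real.rpow_mul (by norm_num), mul_comm]
  calc jap n ^ p = (2 * p) ^ p * ((2 : ℝ) ^ p) ^ k * (u / p) ^ p := by
        rw [h4, Real.mul_rpow (by positivity) (by positivity),
          Real.mul_rpow (by positivity) (by positivity), h5]
    _ ≤ (2 * p) ^ p * ((2 : ℝ) ^ p) ^ k *
        (Real.exp (1 / 2) * Real.exp ((1 / 2) ^ (k + 1) * ‖n‖)) := by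
        rw [← Real.exp_add]
        gcongr
        exact h2.trans (Real.exp_le_exp.2 h1)
    _ = _ := by ring

/-- The polynomial weight `(1 + |n|)^q`. -/
def polyWeight {d : ℕ} (q : ℝ) (n : Fin d → ℤ) : ℝ≥0∞ := ENNReal.ofReal ((1 + ‖n‖) ^ q)

theorem exists_polyWeight_le {d : ℕ} {q : ℝ} (hq : 0 ≤ q) :
    ∃ K : ℝ, 0 < K ∧ ∀ (k : ℕ) (n : Fin d → ℤ),
      polyWeight q n ≤ ENNReal.ofReal (K * ((2 : ℝ) ^ q) ^ k) * expWeight ((1 / 2) ^ (k + 1)) n := by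
  rcases hq.eq_or_lt with rfl | hq
  · refine ⟨1, one_pos, fun k n => ?_⟩
    simpa [polyWeight] using one_le_expWeight (ρ := (1 / 2) ^ (k + 1)) (by positivity) n
  · refine ⟨2 ^ q * ((2 * q) ^ q * Real.exp (1 / 2)), by positivity, fun k n => ?_⟩
    rw [polyWeight, expWeight, ← ENNReal.ofReal_mul (by positivity)]
    refine ENNReal.ofReal_le_ofReal ?_
    have h1 : 1 + ‖n‖ ≤ 2 * jap n := by
      have h2 := le_max_left 1 ‖n‖
      have h3 := le_max_right 1 ‖n‖
      rw [jap]; linarith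
    calc (1 + ‖n‖) ^ q ≤ (2 * jap n) ^ q := Real.rpow_le_rpow (by positivity) h1 hq.le
      _ = 2 ^ q * jap n ^ q := Real.mul_rpow (by norm_num) (jap_pos n).le
      _ ≤ 2 ^ q * ((2 * q) ^ q * Real.exp (1 / 2) * ((2 : ℝ) ^ q) ^ k *
          Real.exp ((1 / 2) ^ (k + 1) * ‖n‖)) := by
          gcongr
          exact jap_rpow_le hq k n
      _ = _ := by ring

/-! ### Convergence on shrinking scales -/

namespace KernelAlg

variable {d : ℕ} {ω : Fin d → ℝ}

theorem wnorm_le_of_weight_le {W W' : (Fin d → ℤ) → ℝ≥0∞} {c : ℝ≥0∞} (h : ∀ n, W n ≤ c * W' n)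
    (A : KernelAlg ω) : wnorm W A ≤ c * wnorm W' A := by
  rw [wnorm, wnorm, ← ENNReal.tsum_mul_left]
  refine ENNReal.tsum_le_tsum fun n => ?_
  calc ‖A.coef n‖ₑ * W n ≤ ‖A.coef n‖ₑ * (c * W' n) := mul_le_mul_right (h n) _
    _ = _ := by ring

/-- A sequence with geometrically small increments on shrinking exponential scales converges, with
a polynomially weighted limit. -/
theorem exists_tendsto_of_increments {q b c : ℝ} (hq : 0 ≤ q) (hb : 0 ≤ b)
    (hbq : b * 2 ^ q < 1) (hc : 0 ≤ c) {f : ℕ → KernelAlg ω} (h0 : f 0 = 1)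
    (h : ∀ k, wnorm (expWeight ((1 / 2) ^ (k + 1))) (f (k + 1) - f k) ≤
      ENNReal.ofReal (c * b ^ k)) :
    ∃ U, Tendsto f atTop (𝓝 U) ∧ wnorm (polyWeight q) U < ⊤ := by
  have h2q : (1 : ℝ) ≤ 2 ^ q := Real.one_le_rpow (by norm_num) hq
  have hb1 : b < 1 := lt_of_le_of_lt (le_mul_of_one_le_right hb h2q) hbq
  obtain ⟨K, hK, hKw⟩ := exists_polyWeight_le (d := d) hq
  have hnorm : ∀ k, ‖f (k + 1) - f k‖ ≤ c * b ^ k := fun k =>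
    norm_le_of_enorm_le (by positivity)
      ((enorm_le_wnorm (one_le_expWeight (by positivity)) _).trans (h k))
  have hs : Summable fun k => f (k + 1) - f k :=
    Summable.of_norm_bounded ((summable_geometric_of_lt_one hb hb1).mul_left c) hnorm
  have htel : ∀ k, ∑ i ∈ Finset.range k, (f (i + 1) - f i) = f k - 1 := fun k => by
    rw [Finset.sum_range_sub, h0]
  refine ⟨(∑' k, (f (k + 1) - f k)) + 1, ?_, ?_⟩
  · have := hs.hasSum.tendsto_sum_nat.add_const (1 : KernelAlg ω)
    simpa only [htel, sub_add_cancel] using this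
  · refine (wnorm_add_le _ _ _).trans_lt (ENNReal.add_lt_top.2 ⟨?_, ?_⟩)
    -- At scale k the polynomial weight costs (2^q)^k, so increments of size b^k contribute
    -- (b·2^q)^k.
    · calc wnorm (polyWeight q) (∑' k, (f (k + 1) - f k))
          ≤ ∑' k, wnorm (polyWeight q) (f (k + 1) - f k) := wnorm_tsum_le _ hs
        _ ≤ ∑' k, ENNReal.ofReal (K * c * (b * 2 ^ q) ^ k) := by
            refine ENNReal.tsum_le_tsum fun k => (wnorm_le_of_weight_le (hKw k) _).trans ?_
            refine (mul_le_mul_right (h k) _).trans ?_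
            rw [← ENNReal.ofReal_mul (by positivity)]
            refine ENNReal.ofReal_le_ofReal (le_of_eq ?_)
            rw [mul_pow]; ring
        _ = ENNReal.ofReal (∑' k, K * c * (b * 2 ^ q) ^ k) :=
            (ENNReal.ofReal_tsum_of_nonneg (fun k => by positivity)
              ((summable_geometric_of_lt_one (by positivity) hbq).mul_left _)).symm
        _ < ⊤ := ENNReal.ofReal_lt_top
    · rw [one_def, wnorm_diag]
      exact ENNReal.mul_lt_top (enorm_lt_top) ENNReal.ofReal_lt_top

end KernelAlg

theorem IsApproxDiag.weaken {d : ℕ} {ω : Fin d → ℝ} {V : ℂ → ℂ} {r ρ η β ℓ η' β' ℓ' : ℝ}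
    {M U U' E : KernelAlg ω} {w : BddFun} (h : IsApproxDiag V r ρ η β ℓ M U U' E w)
    (hη : η ≤ η') (hβ : β ≤ β') (hℓ : ℓ ≤ ℓ') : IsApproxDiag V r ρ η' β' ℓ' M U U' E w :=
  { h with
    lip := fun z hz a => (h.lip z hz a).trans
      (mul_le_mul_of_nonneg_right hℓ (torusNorm_nonneg a))
    normU := h.normU.trans (ENNReal.ofReal_le_ofReal hβ)
    normU' := h.normU'.trans (ENNReal.ofReal_le_ofReal hβ)
    normE := h.normE.trans (ENNReal.ofReal_le_ofReal hη) }

theorem IsApproxDiag.mono {d : ℕ} {ω : Fin d → ℝ} {V : ℂ → ℂ} {r r' ρ η β ℓ : ℝ}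
    {M U U' E : KernelAlg ω} {w : BddFun} (h : IsApproxDiag V r ρ η β ℓ M U U' E w) (hr : r' ≤ r) :
    IsApproxDiag V r' ρ η β ℓ M U U' E w :=
  { h with
    memU := KernelAlg.reg_anti hr h.memU
    memU' := KernelAlg.reg_anti hr h.memU'
    memE := KernelAlg.reg_anti hr h.memE
    memw := BddFun.reg_anti hr h.memw
    lip := fun z hz a => h.lip z (strip_mono hr hz) a
    comm := h.comm.mono hr }

theorem KernelAlg.continuous_diag {d : ℕ} {ω : Fin d → ℝ} :
    Continuous fun f : BddFun => (diag f : KernelAlg ω) := by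
  let φ : BddFun →+ KernelAlg ω := AddMonoidHom.mk' diag fun f g => by
    ext1 n
    simp only [coef_add, coef_diag]
    split_ifs <;> simp
  exact AddMonoidHomClass.continuous_of_bound φ 1 fun f => by simp [φ, norm_diag]

theorem IsApproxDiag.init {d : ℕ} {ω : Fin d → ℝ} (V : ℂ → ℂ) (r : ℝ) {ρ : ℝ} (hρ : 0 ≤ ρ) :
    IsApproxDiag V r ρ 0 1 0 (0 : KernelAlg ω) 1 1 0 0 where
  mul_inv := one_mul 1
  inv_mul := one_mul 1
  memU := Subring.one_mem _
  memU' := Subring.one_mem _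
  memE := Subring.zero_mem _
  memw := Subring.zero_mem _
  lip := fun z _ a => by simp
  comm := by
    have h : (KernelAlg.diag (0 : BddFun) : KernelAlg ω) = 0 := by
      ext1 n; simp [KernelAlg.coef_diag]
    simpa [h] using IsPotentialCommutator.one (V := V) (r := r) (ω := ω)
  normU := by
    simpa using KernelAlg.wnorm_pow_le (expWeight_add_le hρ) (expWeight_zero ρ)
      (1 : KernelAlg ω) 0
  normU' := by
    simpa using KernelAlg.wnorm_pow_le (expWeight_add_le hρ) (expWeight_zero ρ)
      (1 : KernelAlg ω) 0
  normE := by rw [KernelAlg.wnorm_zero]; exact zero_le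

/-- The approximate diagonalizations on the scales `2^k`. -/
theorem exists_approxDiag_seq {d : ℕ} {ω : Fin d → ℝ} {R τ γ v ε a b c B : ℝ} {V : ℂ → ℂ}
    (hR : 0 < R) (hγ : 0 < γ) (hτ : 0 < τ) (hv : 0 < v) (hε : 0 < ε)
    (ha0 : 0 < a) (hb0 : 0 < b) (hb1 : b < 1) (hc0 : 0 < c)
    (hba : b = 2 ^ τ * a) (hca : c = 2 * a)
    (hB : B = 10 * ((2 * τ) ^ τ * Real.exp (1 / 2)) / (v * γ))
    (hε1 : 20 * (ε * B) ≤ a) (ha1 : a < 1) (hε2 : 4 * (ε * B) ≤ 1 - b)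
    (hε3 : 80 * ε ≤ v * R * (1 - c)) (hω : IsDiophantine τ γ ω) (hV : MemP R V)
    (hsep : SepBound R V v) {P : ℕ → KernelAlg ω} (hP : ∀ k, P k ∈ KernelAlg.reg (R / 2))
    (hPn : ∀ k, KernelAlg.wnorm (expWeight ((1 / 2) ^ k)) (P k) ≤ ENNReal.ofReal (ε * a ^ k)) :
    ∃ (U U' E : ℕ → KernelAlg ω) (w : ℕ → BddFun), U 0 = 1 ∧ U' 0 = 1 ∧ ∀ k,
      IsApproxDiag V (R / 4) ((1 / 2) ^ k) (ε * a ^ k) 2 (v / 2)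
        (∑ j ∈ Finset.range k, P j) (U k) (U' k) (E k) (w k) ∧
      KernelAlg.wnorm (expWeight ((1 / 2) ^ (k + 1))) (U (k + 1) - U k) ≤
        ENNReal.ofReal (4 * (ε * B) * b ^ k) ∧
      KernelAlg.wnorm (expWeight ((1 / 2) ^ (k + 1))) (U' (k + 1) - U' k) ≤
        ENNReal.ofReal (4 * (ε * B) * b ^ k) ∧
      ‖w (k + 1) - w k‖ ≤ 5 * ε * a ^ k := by
  set K : ℝ := (2 * τ) ^ τ * Real.exp (1 / 2) with hK
  have hK0 : 0 < K := by positivity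
  have hB0 : 0 < B := by rw [hB]; positivity
  -- The strips shrink from R/2 to R/4, with loss R/8 · 2^{−k} at step k.
  let r : ℕ → ℝ := fun k => R / 4 + R / 4 * (1 / 2) ^ k
  have hrdiff : ∀ k, r k - r (k + 1) = R / 8 * (1 / 2) ^ k := fun k => by
    simp only [r, pow_succ]; ring
  have hrle : ∀ k, r k ≤ R / 2 := fun k => by
    have : ((1 : ℝ) / 2) ^ k ≤ 1 := pow_le_one₀ (by norm_num) (by norm_num)
    simp only [r]; nlinarith
  have hrge : ∀ k, R / 4 ≤ r k := fun k => by
    simp only [r]; linarith [show 0 < R / 4 * (1 / 2) ^ k by positivity]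
  let S := KernelAlg ω × KernelAlg ω × KernelAlg ω × BddFun
  -- The budgets 2 − b^k and (v/2)(1 − c^k) start at 1 and 0, the values for U = 1 and w = 0, and
  -- never exceed 2 and v/2.
  let p : ℕ → S → Prop := fun k σ =>
    IsApproxDiag V (r k) ((1 / 2) ^ k) (ε * a ^ k) (2 - b ^ k) (v / 2 * (1 - c ^ k))
      (∑ j ∈ Finset.range k, P j) σ.1 σ.2.1 σ.2.2.1 σ.2.2.2
  let rel : ℕ → S → S → Prop := fun k σ σ' =>
    KernelAlg.wnorm (expWeight ((1 / 2) ^ (k + 1))) (σ'.1 - σ.1) ≤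
      ENNReal.ofReal (4 * (ε * B) * b ^ k) ∧
    KernelAlg.wnorm (expWeight ((1 / 2) ^ (k + 1))) (σ'.2.1 - σ.2.1) ≤
      ENNReal.ofReal (4 * (ε * B) * b ^ k) ∧
    ‖σ'.2.2.2 - σ.2.2.2‖ ≤ 5 * ε * a ^ k
  have hstart : p 0 (1, 1, 0, 0) := by
    have h := (IsApproxDiag.init (ω := ω) V (r 0) (ρ := (1 / 2) ^ 0) (by positivity)).weaken
      (η' := ε * a ^ 0) (β' := 2 - b ^ 0) (ℓ' := v / 2 * (1 - c ^ 0)) (by positivity)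
      (by norm_num) (by norm_num)
    simpa only [p, Finset.range_zero, Finset.sum_empty] using h
  have hκ : ∀ (k : ℕ) (n : Fin d → ℤ), jap n ^ τ * Real.exp ((1 / 2) ^ (k + 1) * ‖n‖) ≤
      K * ((2 : ℝ) ^ τ) ^ k * Real.exp ((1 / 2) ^ k * ‖n‖) := fun k n => by
    have h := mul_le_mul_of_nonneg_right (jap_rpow_le hτ k n)
      (Real.exp_nonneg ((1 / 2) ^ (k + 1) * ‖n‖))
    rw [mul_assoc _ (Real.exp _) (Real.exp _), ← Real.exp_add, ← add_mul, ← hK] at h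
    convert! h using 4
    rw [pow_succ]; ring
  have hstep : ∀ k σ, p k σ → ∃ σ', p (k + 1) σ' ∧ rel k σ σ' := by
    rintro k ⟨U, U', E, w⟩ hσ
    have hbk : b ^ k ≤ 1 := pow_le_one₀ hb0.le hb1.le
    have hbk0 : 0 < b ^ k := pow_pos hb0 k
    have hak0 : 0 < a ^ k := pow_pos ha0 k
    have hck0 : 0 < c ^ k := pow_pos hc0 k
    have hck1 : 0 < c ^ (k + 1) := pow_pos hc0 (k + 1)
    -- Dividing by the strip loss in Cauchy's estimate turns a^k into (2a)^k = c^k.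
    have hfrac : 5 * (ε * a ^ k) / (r k - r (k + 1)) = 40 * ε / R * c ^ k := by
      rw [hrdiff, hca, mul_pow, one_div, inv_pow]
      field_simp
      ring
    have hℓ : v / 2 * (1 - c ^ k) + 5 * (ε * a ^ k) / (r k - r (k + 1)) ≤
        v / 2 * (1 - c ^ (k + 1)) := by
      have h1 : 40 * ε / R ≤ v / 2 * (1 - c) := by
        rw [div_le_iff₀ hR]; linarith
      have h2 := mul_le_mul_of_nonneg_right h1 hck0.le
      rw [hfrac, pow_succ]
      linarith
    have hξ0 : 0 ≤ ε * B * b ^ k := by positivity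
    -- The small divisors turn a^k into (2^τ a)^k = b^k; B gathers the constants so that equality
    -- holds.
    have hξ : 2 / (v * γ) * (K * ((2 : ℝ) ^ τ) ^ k) * (5 * (ε * a ^ k)) ≤ ε * B * b ^ k := by
      refine le_of_eq ?_
      rw [hB, hba, mul_pow]
      field_simp
      ring
    have hξB : ε * B * b ^ k ≤ ε * B := mul_le_of_le_one_right (by positivity) hbk
    obtain ⟨U₁, U₁', E₁, w₁, h1, h2, h3, h4⟩ := IsApproxDiag.step (r' := r (k + 1))
      (ρ' := (1 / 2) ^ (k + 1)) (κ := K * ((2 : ℝ) ^ τ) ^ k) (ξ := ε * B * b ^ k) hγ hω hV hv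
      hsep ((hrle k).trans (by linarith))
      (by
        have : 0 < r k - r (k + 1) := by rw [hrdiff]; positivity
        linarith)
      (by positivity)
      (pow_le_pow_of_le_one (by norm_num) (by norm_num) (Nat.le_succ k)) (by positivity)
      (hκ k) (by positivity) (by linarith) (by linarith)
      (hℓ.trans (by linarith [mul_pos hv hck1])) hξ hξ0 (by linarith)
      (KernelAlg.reg_anti (hrle k) (hP k)) (hPn k) hσ
    refine ⟨(U₁, U₁', E₁, w₁), ?_, ?_, ?_, ?_⟩
    · have h5 := h1.weaken (η' := ε * a ^ (k + 1)) (β' := 2 - b ^ (k + 1))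
        (ℓ' := v / 2 * (1 - c ^ (k + 1))) ?_ ?_ hℓ
      · simpa only [p, Finset.sum_range_succ] using h5
      -- Geometric decay of the error at ratio a is enough, so 20εB ≤ a suffices and no
      -- superexponential convergence is needed.
      · calc 20 * (ε * a ^ k) * (ε * B * b ^ k) = ε * a ^ k * (20 * (ε * B * b ^ k)) := by ring
          _ ≤ ε * a ^ k * a := mul_le_mul_of_nonneg_left (by linarith) (by positivity)
          _ = ε * a ^ (k + 1) := by ring
      -- (2 − b^k)(1 + 2εBb^k) ≤ 2 − b^k + 4εBb^k ≤ 2 − b^{k+1}, because 4εB ≤ 1 − b.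
      · rw [pow_succ]
        have e1 := mul_le_mul_of_nonneg_right hε2 hbk0.le
        have e2 : 0 ≤ b ^ k * (ε * B * b ^ k) := by positivity
        linarith
    · exact h2.trans (ENNReal.ofReal_le_ofReal (by linarith))
    · exact h3.trans (ENNReal.ofReal_le_ofReal (by linarith))
    · exact h4.trans (by linarith)
  obtain ⟨f, hf0, hf⟩ := exists_seq_of_step p rel (1, 1, 0, 0) hstart hstep
  refine ⟨fun k => (f k).1, fun k => (f k).2.1, fun k => (f k).2.2.1, fun k => (f k).2.2.2,
    congrArg (fun σ : S => σ.1) hf0, congrArg (fun σ : S => σ.2.1) hf0, fun k => ⟨?_, (hf k).2.1, (hf k).2.2.1, (hf k).2.2.2⟩⟩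
  exact ((hf k).1.weaken le_rfl (by linarith [pow_pos hb0 k])
    (by linarith [mul_pos hv (pow_pos hc0 k)])).mono (hrge k)

/-- Diagonalization of `M + V` for a small kernel `M`, decomposed into pieces `P k` that live on
the scales `|n| ∼ 2^k`. -/
theorem exists_diagonalization (d : ℕ) {R τ γ v s q : ℝ} (hR : 0 < R) (hγ : 0 < γ) (hτ : 0 < τ)
    (hv : 0 < v) (hq : 0 ≤ q) (hs1 : 1 < s) (hs : q + τ < s) :
    ∃ ε : ℝ, 0 < ε ∧ ∀ ω : Fin d → ℝ, IsDiophantine τ γ ω → ∀ V : ℂ → ℂ, MemP R V →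
      SepBound R V v → ∀ (P : ℕ → KernelAlg ω) (M : KernelAlg ω),
      (∀ k, P k ∈ KernelAlg.reg (R / 2)) →
      (∀ k, KernelAlg.wnorm (expWeight ((1 / 2) ^ k)) (P k) ≤
        ENNReal.ofReal (ε * ((2 : ℝ) ^ (-s)) ^ k)) →
      HasSum P M →
      ∃ (U U' : KernelAlg ω) (w : BddFun), U * U' = 1 ∧ U' * U = 1 ∧
        KernelAlg.wnorm (polyWeight q) U < ⊤ ∧ KernelAlg.wnorm (polyWeight q) U' < ⊤ ∧
        (∀ x a : ℝ, ‖w x - w (x - a)‖ ≤ v / 2 * torusNorm a) ∧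
        ∀ x : ℝ, IsRegularPoint ω V x → ∀ n : Fin d → ℤ, (V x - V (x - dot n ω)) * U.coef n x =
          (U * KernelAlg.diag w - M * U).coef n x := by
  obtain ⟨B, hB⟩ : ∃ B : ℝ, B = 10 * ((2 * τ) ^ τ * Real.exp (1 / 2)) / (v * γ) := ⟨_, rfl⟩
  have hB0 : 0 < B := by rw [hB]; positivity
  obtain ⟨a, ha⟩ : ∃ a : ℝ, a = 2 ^ (-s) := ⟨_, rfl⟩
  obtain ⟨b, hb⟩ : ∃ b : ℝ, b = 2 ^ (τ - s) := ⟨_, rfl⟩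
  obtain ⟨c, hc⟩ : ∃ c : ℝ, c = 2 ^ (1 - s) := ⟨_, rfl⟩
  have ha0 : 0 < a := by rw [ha]; positivity
  have hb0 : 0 < b := by rw [hb]; positivity
  have hc0 : 0 < c := by rw [hc]; positivity
  have ha1 : a < 1 := by
    rw [ha]; exact Real.rpow_lt_one_of_one_lt_of_neg (by norm_num) (by linarith)
  have hb1 : b < 1 := by
    rw [hb]; exact Real.rpow_lt_one_of_one_lt_of_neg (by norm_num) (by linarith)
  have hc1 : c < 1 := by
    rw [hc]; exact Real.rpow_lt_one_of_one_lt_of_neg (by norm_num) (by linarith)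
  have hbq : b * 2 ^ q < 1 := by
    rw [hb, ← Real.rpow_add (by norm_num)]
    exact Real.rpow_lt_one_of_one_lt_of_neg (by norm_num) (by linarith)
  have hba : b = 2 ^ τ * a := by rw [hb, ha, ← Real.rpow_add (by norm_num)]; ring_nf
  have hca : c = 2 * a := by
    rw [hc, ha, sub_eq_add_neg, Real.rpow_add (by norm_num), Real.rpow_one]
  -- The three bounds respectively make the error contract by a, keep the norms of U and U⁻¹ below
  -- 2, and keep the Lipschitz constant of w below v/2.
  obtain ⟨ε, hε0, hε1, hε2, hε3⟩ : ∃ ε : ℝ, 0 < ε ∧ ε ≤ a / (20 * B) ∧ ε ≤ (1 - b) / (4 * B) ∧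
      ε ≤ v * R * (1 - c) / 80 := by
    have h1 : 0 < a / (20 * B) := by positivity
    have h2 : 0 < (1 - b) / (4 * B) := div_pos (by linarith) (by positivity)
    have h3 : 0 < v * R * (1 - c) / 80 :=
      div_pos (mul_pos (by positivity) (by linarith)) (by norm_num)
    exact ⟨min (a / (20 * B)) (min ((1 - b) / (4 * B)) (v * R * (1 - c) / 80)),
      lt_min h1 (lt_min h2 h3), min_le_left _ _, (min_le_right _ _).trans (min_le_left _ _),
      (min_le_right _ _).trans (min_le_right _ _)⟩
  rw [le_div_iff₀ (by positivity)] at hε1 hε2 hε3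
  refine ⟨ε, hε0, fun ω hω V hV hsep P M hP hPn hPM => ?_⟩
  rw [← ha] at hPn
  obtain ⟨fU, fU', fE, fw, hU0, hU0', hf⟩ := exists_approxDiag_seq hR hγ hτ hv hε0 ha0 hb0 hb1 hc0
    hba hca hB (by linarith) ha1 (by linarith) (by linarith) hω hV hsep hP hPn
  obtain ⟨U, hU, hUq⟩ := KernelAlg.exists_tendsto_of_increments hq hb0.le hbq
    (c := 4 * (ε * B)) (by positivity) hU0 fun k => (hf k).2.1
  obtain ⟨U', hU', hUq'⟩ := KernelAlg.exists_tendsto_of_increments hq hb0.le hbq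
    (c := 4 * (ε * B)) (by positivity) hU0' fun k => (hf k).2.2.1
  obtain ⟨w, hw⟩ : ∃ w, Tendsto fw atTop (𝓝 w) := by
    refine cauchySeq_tendsto_of_complete (cauchySeq_of_summable_dist ?_)
    refine Summable.of_nonneg_of_le (fun _ => dist_nonneg) (fun k => ?_)
      ((summable_geometric_of_lt_one ha0.le ha1).mul_left (5 * ε))
    rw [dist_comm, dist_eq_norm]
    exact (hf k).2.2.2
  have hE : Tendsto fE atTop (𝓝 0) := by
    refine squeeze_zero_norm (a := fun k => ε * a ^ k) (fun k => ?_) ?_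
    · exact norm_le_of_enorm_le (by positivity)
        ((KernelAlg.enorm_le_wnorm (one_le_expWeight (by positivity)) _).trans (hf k).1.normE)
    · simpa using (tendsto_pow_atTop_nhds_zero_of_lt_one ha0.le ha1).const_mul ε
  have hdiag : Tendsto (fun k => (KernelAlg.diag (fw k) : KernelAlg ω)) atTop
      (𝓝 (KernelAlg.diag w)) := (KernelAlg.continuous_diag.tendsto w).comp hw
  have hr : 0 < R / 4 := by positivity
  refine ⟨U, U', w, ?_, ?_, hUq, hUq', fun x t => ?_, fun x hx n => ?_⟩
  · refine tendsto_nhds_unique (hU.mul hU') ?_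
    simp only [fun k => (hf k).1.mul_inv]
    exact tendsto_const_nhds
  · refine tendsto_nhds_unique (hU'.mul hU) ?_
    simp only [fun k => (hf k).1.inv_mul]
    exact tendsto_const_nhds
  · have hev : ∀ z, Tendsto (fun k => fw k z) atTop (𝓝 (w z)) := fun z =>
      ((BddFun.eval z).continuous.tendsto w).comp hw
    exact le_of_tendsto ((hev x).sub (hev (x - t))).norm (Eventually.of_forall fun k =>
      (hf k).1.lip x (ofReal_mem_strip hr x) t)
  · have hev : ∀ {A : ℕ → KernelAlg ω} {A₀ : KernelAlg ω}, Tendsto A atTop (𝓝 A₀) →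
        Tendsto (fun k => (A k).coef n x) atTop (𝓝 (A₀.coef n x)) := fun {A A₀} h =>
      ((BddFun.eval x).continuous.tendsto _).comp
        (((KernelAlg.continuous_coef n).tendsto A₀).comp h)
    -- The commutator identity passes to the limit at fixed x and n, where the factor V(x) − V(x −
    -- n·ω) is a constant.
    have hlim := ((hU.mul hdiag).add (hU.mul hE)).sub (hPM.tendsto_sum_nat.mul hU)
    rw [mul_zero, add_zero] at hlim
    refine tendsto_nhds_unique ((hev hU).const_mul (V x - V (x - dot n ω))) ?_
    refine (hev hlim).congr fun k => ?_
    exact ((hf k).1.comm x (ofReal_mem_strip hr x) hx n).symm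

end QPLocalization

end

noncomputable section

namespace QPLocalization

/-! ### Kernels of class `𝒰_{R,s}` in the algebra -/

/-- The upper bound on ⟨n⟩ keeps exp(2^{−k}|n|) bounded; the lower one turns the weight ⟨n⟩^s into
the gain 2^{−sk}. -/
theorem exists_dyadic_scale {d : ℕ} (n : Fin d → ℤ) :
    ∃ k : ℕ, jap n ≤ 2 ^ k ∧ (2 : ℝ) ^ k ≤ 2 * jap n := by
  obtain ⟨k, h1, h2⟩ := exists_nat_pow_near (one_le_jap n) (one_lt_two)
  exact ⟨k + 1, h2.le, by rw [pow_succ]; linarith⟩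

/-- A kernel in `𝒰_{R,s}` gives an element of the algebra that decomposes into dyadic pieces. -/
theorem exists_kernelAlg_of_memU (d : ℕ) {R s : ℝ} (hR : 0 < R) (hs : 0 < s) :
    ∃ C : ℝ, 0 < C ∧ ∀ (ω : Fin d → ℝ) (M : Kernel d) (ε : ℝ), 0 < ε → MemU R s M →
      kernelNorm R s M ≤ ENNReal.ofReal ε →
      ∃ (P : ℕ → KernelAlg ω) (A : KernelAlg ω), (∀ k, P k ∈ KernelAlg.reg (R / 2)) ∧
        (∀ k, KernelAlg.wnorm (expWeight ((1 / 2) ^ k)) (P k) ≤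
          ENNReal.ofReal (C * ε * ((2 : ℝ) ^ (-s)) ^ k)) ∧ HasSum P A ∧
        ∀ (x : ℝ) (n : Fin d → ℤ), A.coef n x = M x n := by
  obtain ⟨C, hC, hCs⟩ := exists_tsum_iSup_le hR
  -- e bounds exp(2^{−k}|n|) on the k-th piece, 2^s comes from 2^k ≤ 2⟨n⟩, and C from the exchange
  -- of sup and sum.
  refine ⟨Real.exp 1 * 2 ^ s * C, by positivity, fun ω M ε hε hM hMε => ?_⟩
  classical
  have hbound : ∀ n, ∃ c : ℝ, ∀ z, ‖(strip (R / 2)).indicator (fun z => M z n) z‖ ≤ c := by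
    intro n
    obtain ⟨c, hc⟩ := (hM.memH n).bounded
    refine ⟨max c 0, fun z => ?_⟩
    by_cases hz : z ∈ strip (R / 2)
    · simpa [hz] using Or.inl (hc z (strip_mono (by linarith) hz))
    · simp [hz]
  choose c hc using hbound
  let m : (Fin d → ℤ) → BddFun := fun n => BddFun.mk _ (c n) (hc n)
  have hmreg : ∀ n, m n ∈ BddFun.reg (R / 2) := by
    intro n
    have hsub : strip (R / 2) ⊆ strip R := strip_mono (by linarith)
    refine ⟨((hM.memH n).holomorphic.mono hsub).congr fun z hz => by simp [m, hz], fun z hz => ?_⟩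
    have hz1 := add_one_mem_strip hz
    simpa [m, hz, hz1] using (hM.memH n).periodic z (hsub hz)
  have hmnorm : ∀ n, ‖m n‖ₑ ≤ ⨆ z ∈ strip (R / 2), ‖M z n‖ₑ := by
    intro n
    have h1 : ∀ z, ‖m n z‖ₑ ≤ ⨆ z ∈ strip (R / 2), ‖M z n‖ₑ := by
      intro z
      by_cases hz : z ∈ strip (R / 2)
      · have : m n z = M z n := by simp [m, hz]
        rw [this]
        exact le_iSup₂ (f := fun z (_ : z ∈ strip (R / 2)) => ‖M z n‖ₑ) z hz
      · simp [m, hz]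
    rcases eq_or_ne (⨆ z ∈ strip (R / 2), ‖M z n‖ₑ) ⊤ with htop | htop
    · rw [htop]; exact le_top
    · rw [← ENNReal.ofReal_toReal htop, ← ofReal_norm]
      refine ENNReal.ofReal_le_ofReal (lp.norm_le_of_forall_le ENNReal.toReal_nonneg fun z => ?_)
      have h2 := ENNReal.toReal_mono htop (h1 z)
      simpa using h2
  have hsum : ∑' n, ‖m n‖ₑ * ENNReal.ofReal (jap n ^ s) ≤ ENNReal.ofReal (C * ε) := by
    calc ∑' n, ‖m n‖ₑ * ENNReal.ofReal (jap n ^ s)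
        ≤ ∑' n, (⨆ z ∈ strip (R / 2), ‖M z n‖ₑ) * ENNReal.ofReal (jap n ^ s) :=
          ENNReal.tsum_le_tsum fun n => mul_le_mul_left (hmnorm n) _
      _ ≤ ENNReal.ofReal C * ENNReal.ofReal ε := by
          refine hCs (Fin d → ℤ) (fun n z => M z n) _ _ (fun n => hM.memH n) fun z hz => ?_
          exact le_trans (le_iSup₂ (f := fun z (_ : z ∈ strip R) =>
            ∑' n : Fin d → ℤ, ‖M z n‖ₑ * ENNReal.ofReal (jap n ^ s)) z hz) hMε
      _ = ENNReal.ofReal (C * ε) := (ENNReal.ofReal_mul hC.le).symm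
  have hsm : Summable fun n => ‖m n‖ := by
    have h1 : ∑' n, ‖m n‖ₑ ≠ ⊤ := by
      refine ne_top_of_le_ne_top ENNReal.ofReal_ne_top (le_trans ?_ hsum)
      refine ENNReal.tsum_le_tsum fun n => le_mul_of_one_le_right' ?_
      rw [ENNReal.one_le_ofReal]
      exact Real.one_le_rpow (one_le_jap n) hs.le
    simpa using ENNReal.summable_toReal h1
  -- Each n is assigned one scale, so the pieces have disjoint supports and add up to m.
  choose σ hσ1 hσ2 using exists_dyadic_scale (d := d)
  have hsmk : ∀ k, Summable fun n => ‖if σ n = k then m n else 0‖ := fun k =>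
    Summable.of_nonneg_of_le (fun _ => norm_nonneg _) (fun n => by
      split_ifs
      · exact le_rfl
      · simp) hsm
  let P : ℕ → KernelAlg ω := fun k => KernelAlg.mk (fun n => if σ n = k then m n else 0) (hsmk k)
  have hPw : ∀ k, KernelAlg.wnorm (expWeight ((1 / 2) ^ k)) (P k) ≤
      ENNReal.ofReal (Real.exp 1 * 2 ^ s * C * ε * ((2 : ℝ) ^ (-s)) ^ k) := by
    intro k
    calc KernelAlg.wnorm (expWeight ((1 / 2) ^ k)) (P k)
        ≤ ∑' n, ENNReal.ofReal (Real.exp 1 * 2 ^ s * ((2 : ℝ) ^ (-s)) ^ k) *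
          (‖m n‖ₑ * ENNReal.ofReal (jap n ^ s)) := by
          refine ENNReal.tsum_le_tsum fun n => ?_
          change ‖if σ n = k then m n else 0‖ₑ * _ ≤ _
          split_ifs with hk
          · rw [mul_left_comm, ← ENNReal.ofReal_mul (by positivity), expWeight]
            refine mul_le_mul_right (ENNReal.ofReal_le_ofReal ?_) _
            subst hk
            have h1 : (1 / 2) ^ σ n * ‖n‖ ≤ 1 := by
              have h2 : ‖n‖ ≤ 2 ^ σ n := (le_max_right _ _).trans (hσ1 n)
              rw [one_div, inv_pow, inv_mul_le_iff₀ (by positivity)]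
              simpa using h2
            have h3 : (1 : ℝ) ≤ 2 ^ s * ((2 : ℝ) ^ (-s)) ^ σ n * jap n ^ s := by
              have h4 : ((2 : ℝ) ^ σ n) ^ s ≤ (2 * jap n) ^ s :=
                Real.rpow_le_rpow (by positivity) (hσ2 n) hs.le
              rw [Real.mul_rpow (by norm_num) (jap_pos n).le] at h4
              have h5 : ((2 : ℝ) ^ (-s)) ^ σ n = (((2 : ℝ) ^ σ n) ^ s)⁻¹ := by
                rw [Real.rpow_neg (by norm_num), inv_pow, ← Real.rpow_natCast,
                  ← Real.rpow_natCast, ← Real.rpow_mul (by norm_num),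
                  ← Real.rpow_mul (by norm_num), mul_comm]
              have h6 : (0 : ℝ) < ((2 : ℝ) ^ σ n) ^ s := by positivity
              rw [h5, mul_right_comm, ← div_eq_mul_inv, one_le_div h6]
              exact h4
            calc Real.exp ((1 / 2) ^ σ n * ‖n‖) ≤ Real.exp 1 * 1 := by
                  rw [mul_one]; exact Real.exp_le_exp.2 h1
              _ ≤ Real.exp 1 * (2 ^ s * ((2 : ℝ) ^ (-s)) ^ σ n * jap n ^ s) := by gcongr
              _ = _ := by ring
          · simp
      _ ≤ ENNReal.ofReal (Real.exp 1 * 2 ^ s * ((2 : ℝ) ^ (-s)) ^ k) *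
          ENNReal.ofReal (C * ε) := by
          rw [ENNReal.tsum_mul_left]
          exact mul_le_mul_right hsum _
      _ = _ := by
          rw [← ENNReal.ofReal_mul (by positivity)]
          congr 1
          ring
  have ha1 : (2 : ℝ) ^ (-s) < 1 :=
    Real.rpow_lt_one_of_one_lt_of_neg (by norm_num) (by linarith)
  have hPs : Summable P := by
    refine Summable.of_norm_bounded ((summable_geometric_of_lt_one (by positivity) ha1).mul_left
      (Real.exp 1 * 2 ^ s * C * ε)) fun k => ?_
    exact norm_le_of_enorm_le (by positivity)
      ((KernelAlg.enorm_le_wnorm (one_le_expWeight (by positivity)) _).trans (hPw k))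
  refine ⟨P, ∑' k, P k, fun k n => ?_, hPw, hPs.hasSum, fun x n => ?_⟩
  · change (if σ n = k then m n else 0) ∈ _
    split_ifs
    exacts [hmreg n, Subring.zero_mem _]
  · have h1 : (∑' k, P k).coef n = m n := by
      rw [KernelAlg.coef_tsum hPs, tsum_eq_single (σ n)]
      · simp [P]
      · intro k hk; simp [P, hk.symm]
    have h2 : (x : ℂ) ∈ strip (R / 2) := ofReal_mem_strip (by positivity) x
    rw [h1]
    simp [m, h2]

end QPLocalization

end

noncomputable section

namespace QPLocalization

open Filter Topology

/-! ### The action on `ℓ²(ℤ^d)` -/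

/-- `∑_n |ψ(n)|² ⟨n⟩^{2q}`. -/
def weightedSq {d : ℕ} (q : ℝ) (ψ : (Fin d → ℤ) → ℂ) : ℝ≥0∞ :=
  ∑' n, ‖ψ n‖ₑ ^ 2 * ENNReal.ofReal (jap n ^ (2 * q))

theorem weightedNorm_eq {d : ℕ} (q : ℝ) (ψ : (Fin d → ℤ) → ℂ) :
    weightedNorm q ψ = weightedSq q ψ ^ (1 / 2 : ℝ) := rfl

theorem weightedSq_eq_tsum_sq {d : ℕ} (q : ℝ) (ψ : (Fin d → ℤ) → ℂ) :
    weightedSq q ψ = ∑' n, (‖ψ n‖ₑ * ENNReal.ofReal (jap n ^ q)) ^ 2 := by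
  refine tsum_congr fun n => ?_
  rw [mul_pow, ← ENNReal.ofReal_pow (Real.rpow_nonneg (jap_pos n).le q), mul_comm 2 q,
    Real.rpow_mul (jap_pos n).le, Real.rpow_two]

/-- Cauchy–Schwarz for the weights c, by symmetrising the double sum and using 2ab ≤ a² + b². This
works in [0,∞] with no finiteness assumption. -/
theorem sum_sq_le_of_tsum {ι : Type*} (c g : ι → ℝ≥0∞) :
    (∑' m, c m * g m) ^ 2 ≤ (∑' m, c m) * ∑' m, c m * g m ^ 2 := by
  have key : 2 * (∑' m, c m * g m) ^ 2 ≤ 2 * ((∑' m, c m) * ∑' m, c m * g m ^ 2) := by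
    have e1 : 2 * (∑' m, c m * g m) ^ 2 =
        ∑' m, ∑' k, c m * c k * (2 * g m * g k) := by
      rw [sq, ← ENNReal.tsum_mul_right, ← ENNReal.tsum_mul_left]
      refine tsum_congr fun m => ?_
      rw [← ENNReal.tsum_mul_left, ← ENNReal.tsum_mul_left]
      refine tsum_congr fun k => ?_
      ring
    have e2 : ∑' m, ∑' k, c m * c k * (g m ^ 2 + g k ^ 2) =
        2 * ((∑' m, c m) * ∑' m, c m * g m ^ 2) := by
      have e3 : ∑' m, ∑' k, c m * c k * g k ^ 2 = (∑' m, c m) * ∑' m, c m * g m ^ 2 := by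
        rw [← ENNReal.tsum_mul_right]
        refine tsum_congr fun m => ?_
        rw [← ENNReal.tsum_mul_left]
        exact tsum_congr fun k => mul_assoc _ _ _
      have e4 : ∑' m, ∑' k, c m * c k * g m ^ 2 = (∑' m, c m) * ∑' m, c m * g m ^ 2 := by
        rw [ENNReal.tsum_comm, ← e3]
        exact tsum_congr fun m => tsum_congr fun k => by ring
      simp only [mul_add, ENNReal.tsum_add]
      rw [e3, e4, two_mul]
    rw [e1, ← e2]
    gcongr with m k
    -- To avoid subtraction, the larger number is written as the smaller one plus e; the defect is
    -- then e².
    rcases le_total (g m) (g k) with h | h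
    · obtain ⟨e, he⟩ := exists_add_of_le h
      rw [he]
      calc 2 * g m * (g m + e) ≤ 2 * g m * (g m + e) + e ^ 2 := le_self_add
        _ = g m ^ 2 + (g m + e) ^ 2 := by ring
    · obtain ⟨e, he⟩ := exists_add_of_le h
      rw [he]
      calc 2 * (g k + e) * g k ≤ 2 * (g k + e) * g k + e ^ 2 := le_self_add
        _ = (g k + e) ^ 2 + g k ^ 2 := by ring
  exact (ENNReal.mul_le_mul_iff_right two_ne_zero (by simp)).1 key

/-- Peetre's inequality ⟨n⟩ ≤ (1+|m|)⟨n+m⟩. With ⟨m⟩ in place of 1+|m| it would need a constant: in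
dimension one take n = 2, m = −1. -/
theorem jap_rpow_le_mul {d : ℕ} {q : ℝ} (hq : 0 ≤ q) (n m : Fin d → ℤ) :
    ENNReal.ofReal (jap n ^ q) ≤ polyWeight q m * ENNReal.ofReal (jap (n + m) ^ q) := by
  rw [polyWeight, ← ENNReal.ofReal_mul (by positivity),
    ← Real.mul_rpow (by positivity) (jap_pos _).le]
  refine ENNReal.ofReal_le_ofReal (Real.rpow_le_rpow (jap_pos _).le ?_ hq)
  have h1 := one_le_jap (n + m)
  have h2 : ‖n + m‖ ≤ jap (n + m) := le_max_right _ _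
  have h3 : ‖n‖ ≤ ‖n + m‖ + ‖m‖ := by simpa using norm_sub_le (n + m) m
  have h4 := mul_nonneg (norm_nonneg m) (sub_nonneg.2 h1)
  exact max_le (by nlinarith [norm_nonneg m]) (by nlinarith)

theorem enorm_sq_eq_weightedSq {d : ℕ} (ψ : L2Z d) : ‖ψ‖ₑ ^ 2 = weightedSq 0 ψ := by
  have h := lp.norm_rpow_eq_tsum (p := 2) (by simp) ψ
  have hs := (lp.memℓp ψ).summable (by simp)
  simp only [ENNReal.toReal_ofNat, Real.rpow_two] at h hs
  rw [← ofReal_norm, ← ENNReal.ofReal_pow (norm_nonneg _), h,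
    ENNReal.ofReal_tsum_of_nonneg (fun _ => by positivity) hs]
  refine tsum_congr fun n => ?_
  rw [ENNReal.ofReal_pow (norm_nonneg _), ofReal_norm]
  simp

theorem memℓp_of_weightedSq_ne_top {d : ℕ} {ψ : (Fin d → ℤ) → ℂ} (h : weightedSq 0 ψ ≠ ⊤) :
    Memℓp ψ 2 := by
  refine memℓp_gen ?_
  have := ENNReal.summable_toReal h
  simpa using this

theorem L2Z.ext_single {d : ℕ} {F : Type*} [NormedAddCommGroup F] [NormedSpace ℂ F]
    {S T : L2Z d →L[ℂ] F} (h : ∀ n, S (lp.single 2 n 1) = T (lp.single 2 n 1)) : S = T := by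
  refine lp.ext_continuousLinearMap (by simp) fun n => ?_
  ext
  exact h n

theorem L2Z.inner_single_left {d : ℕ} (n : Fin d → ℤ) (ψ : L2Z d) :
    ⟪(lp.single 2 n 1 : L2Z d), ψ⟫_ℂ = ψ n := by
  rw [lp.inner_single_left]
  simp

namespace KernelAlg

variable {d : ℕ} {ω : Fin d → ℝ}

/-- `(Aψ)(n) = ∑_l A(x - n·ω, l - n) ψ(l)`. -/
def act (x : ℝ) (A : KernelAlg ω) (ψ : (Fin d → ℤ) → ℂ) (n : Fin d → ℤ) : ℂ :=
  ∑' l, A.coef (l - n) (x - dot n ω) * ψ l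

theorem enorm_coef_apply_le (A : KernelAlg ω) (n : Fin d → ℤ) (z : ℂ) :
    ‖A.coef n z‖ₑ ≤ ‖A.coef n‖ₑ := by
  rw [← ofReal_norm, ← ofReal_norm]
  exact ENNReal.ofReal_le_ofReal (BddFun.norm_apply_le _ _)

theorem summable_act (x : ℝ) (A : KernelAlg ω) (ψ : L2Z d) (n : Fin d → ℤ) :
    Summable fun l => A.coef (l - n) (x - dot n ω) * ψ l := by
  have h : Summable fun l => ‖A.coef (l - n)‖ * ‖ψ‖ :=
    ((Equiv.subRight n).summable_iff.2 A.summable_norm).mul_right ‖ψ‖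
  refine Summable.of_norm_bounded h fun l => ?_
  rw [norm_mul]
  exact mul_le_mul (BddFun.norm_apply_le _ _) (lp.norm_apply_le_norm two_ne_zero ψ l)
    (norm_nonneg _) (norm_nonneg _)

/-- Young's inequality ℓ¹ * ℓ² ⊆ ℓ²: bounding coefficients by their sup norms leaves a genuine
convolution, so the constant does not depend on x. -/
theorem weightedSq_act_le (x : ℝ) (A : KernelAlg ω) {q : ℝ} (hq : 0 ≤ q)
    (ψ : (Fin d → ℤ) → ℂ) :
    weightedSq q (A.act x ψ) ≤ wnorm (polyWeight q) A ^ 2 * weightedSq q ψ := by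
  set g : (Fin d → ℤ) → ℝ≥0∞ := fun n => ‖ψ n‖ₑ * ENNReal.ofReal (jap n ^ q) with hg
  set c : (Fin d → ℤ) → ℝ≥0∞ := fun m => ‖A.coef m‖ₑ * polyWeight q m with hc
  have h1 : ∀ n, ‖A.act x ψ n‖ₑ * ENNReal.ofReal (jap n ^ q) ≤ ∑' m, c m * g (n + m) := by
    intro n
    have h2 : ‖A.act x ψ n‖ₑ ≤ ∑' m, ‖A.coef m‖ₑ * ‖ψ (n + m)‖ₑ := by
      refine enorm_tsum_le_tsum_enorm.trans ?_
      rw [← (Equiv.addLeft n).tsum_eq]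
      refine ENNReal.tsum_le_tsum fun m => ?_
      rw [enorm_mul]
      refine mul_le_mul' ?_ le_rfl
      simpa using enorm_coef_apply_le A m _
    refine (mul_le_mul_left h2 _).trans ?_
    rw [← ENNReal.tsum_mul_right]
    refine ENNReal.tsum_le_tsum fun m => ?_
    calc ‖A.coef m‖ₑ * ‖ψ (n + m)‖ₑ * ENNReal.ofReal (jap n ^ q)
        ≤ ‖A.coef m‖ₑ * ‖ψ (n + m)‖ₑ *
          (polyWeight q m * ENNReal.ofReal (jap (n + m) ^ q)) :=
          mul_le_mul_right (jap_rpow_le_mul hq n m) _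
      _ = c m * g (n + m) := by simp only [hc, hg]; ring
  rw [weightedSq_eq_tsum_sq, weightedSq_eq_tsum_sq]
  calc ∑' n, (‖A.act x ψ n‖ₑ * ENNReal.ofReal (jap n ^ q)) ^ 2
      ≤ ∑' n, (∑' m, c m) * ∑' m, c m * g (n + m) ^ 2 := by
        refine ENNReal.tsum_le_tsum fun n => ?_
        exact (pow_le_pow_left' (h1 n) 2).trans (sum_sq_le_of_tsum c fun m => g (n + m))
    _ = (∑' m, c m) * ∑' m, c m * ∑' n, g n ^ 2 := by
        rw [ENNReal.tsum_mul_left, ENNReal.tsum_comm]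
        congr 1
        refine tsum_congr fun m => ?_
        rw [ENNReal.tsum_mul_left]
        congr 1
        exact (Equiv.addRight m).tsum_eq fun n => g n ^ 2
    _ = wnorm (polyWeight q) A ^ 2 * ∑' n, g n ^ 2 := by
        rw [ENNReal.tsum_mul_right, ← mul_assoc, ← sq]
        rfl

theorem weightedNorm_act_le (x : ℝ) (A : KernelAlg ω) {q : ℝ} (hq : 0 ≤ q)
    (ψ : (Fin d → ℤ) → ℂ) :
    weightedNorm q (A.act x ψ) ≤ wnorm (polyWeight q) A * weightedNorm q ψ := by
  rw [weightedNorm_eq, weightedNorm_eq]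
  refine (ENNReal.rpow_le_rpow (weightedSq_act_le x A hq ψ) (by norm_num)).trans ?_
  rw [ENNReal.mul_rpow_of_nonneg _ _ (by norm_num), ← ENNReal.rpow_natCast, ← ENNReal.rpow_mul]
  norm_num

theorem wnorm_polyWeight_zero (A : KernelAlg ω) : wnorm (polyWeight 0) A = ‖A‖ₑ := by
  rw [← wnorm_one_weight]
  simp [polyWeight, wnorm]

theorem weightedSq_zero_act_le (x : ℝ) (A : KernelAlg ω) (ψ : L2Z d) :
    weightedSq 0 (A.act x ψ) ≤ ‖A‖ₑ ^ 2 * ‖ψ‖ₑ ^ 2 := by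
  rw [enorm_sq_eq_weightedSq, ← wnorm_polyWeight_zero]
  exact weightedSq_act_le x A le_rfl ψ

theorem memℓp_act (x : ℝ) (A : KernelAlg ω) (ψ : L2Z d) : Memℓp (A.act x ψ) 2 :=
  memℓp_of_weightedSq_ne_top (ne_top_of_le_ne_top
    (ENNReal.mul_ne_top (by simp) (by simp)) (weightedSq_zero_act_le x A ψ))

/-- The bounded operator on `ℓ²(ℤ^d)` that a kernel defines at the phase `x`. -/
def rep (x : ℝ) (A : KernelAlg ω) : L2Z d →L[ℂ] L2Z d :=
  LinearMap.mkContinuous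
    { toFun := fun ψ => ⟨A.act x ψ, memℓp_act x A ψ⟩
      map_add' := fun ψ φ => by
        ext n
        refine Eq.trans ?_ ((summable_act x A ψ n).tsum_add (summable_act x A φ n))
        exact tsum_congr fun l => mul_add _ _ _
      map_smul' := fun c ψ => by
        ext n
        refine Eq.trans ?_ (tsum_mul_left (a := c))
        exact tsum_congr fun l => mul_left_comm _ _ _ }
    ‖A‖ fun ψ => by
      have h : ‖(⟨A.act x ψ, memℓp_act x A ψ⟩ : L2Z d)‖ₑ ^ 2 ≤ (‖A‖ₑ * ‖ψ‖ₑ) ^ 2 := by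
        rw [enorm_sq_eq_weightedSq, mul_pow]
        exact weightedSq_zero_act_le x A ψ
      have h2 := (ENNReal.pow_le_pow_left_iff two_ne_zero).1 h
      rw [← ofReal_norm, ← ofReal_norm, ← ofReal_norm, ← ENNReal.ofReal_mul (norm_nonneg _)] at h2
      exact (ENNReal.ofReal_le_ofReal_iff (by positivity)).1 h2

theorem rep_apply (x : ℝ) (A : KernelAlg ω) (ψ : L2Z d) (n : Fin d → ℤ) :
    rep x A ψ n = ∑' l, A.coef (l - n) (x - dot n ω) * ψ l := rfl

theorem rep_single (x : ℝ) (A : KernelAlg ω) (l n : Fin d → ℤ) :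
    rep x A (lp.single 2 l 1) n = A.coef (l - n) (x - dot n ω) := by
  rw [rep_apply, tsum_eq_single l]
  · simp
  · intro m hm; simp [hm]

/-- Row n evaluates coefficients at x − n·ω; passing to row n + j moves the phase by j·ω, which is
exactly the twist in the convolution. -/
theorem rep_mul (x : ℝ) (A B : KernelAlg ω) : rep x (A * B) = rep x A * rep x B := by
  refine L2Z.ext_single fun l => ?_
  ext n
  change _ = rep x A (rep x B (lp.single 2 l 1)) n
  rw [rep_single, rep_apply, coef_apply_mul]
  conv_rhs => rw [← (Equiv.addLeft n).tsum_eq]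
  refine tsum_congr fun j => ?_
  simp only [Equiv.coe_addLeft, rep_single, add_sub_cancel_left, dot_add, Complex.ofReal_add,
    sub_sub]

theorem rep_one (x : ℝ) : rep x (1 : KernelAlg ω) = 1 := by
  refine L2Z.ext_single fun l => ?_
  ext n
  rw [rep_single, coef_one]
  change _ = (lp.single 2 l 1 : L2Z d) n
  rcases eq_or_ne n l with h | h
  · simp [h]
  · simp [sub_eq_zero, h, h.symm]

end KernelAlg

/-! ### Multiplication groups -/

/-- Dominated convergence for the series of squares; it upgrades coordinatewise limits to limits in
ℓ². -/
theorem L2Z.tendsto_of_dominated {d : ℕ} {ι : Type*} {l : Filter ι} [l.IsCountablyGenerated]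
    {F : ι → L2Z d} {G : L2Z d} (χ : L2Z d) (C : ℝ)
    (h : ∀ n, Tendsto (fun i => F i n) l (𝓝 (G n)))
    (hb : ∀ᶠ i in l, ∀ n, ‖F i n - G n‖ ≤ C * ‖χ n‖) : Tendsto F l (𝓝 G) := by
  have hχ := (lp.memℓp χ).summable (by simp)
  simp only [ENNReal.toReal_ofNat, Real.rpow_two] at hχ
  have h1 : Tendsto (fun i => ∑' n, ‖F i n - G n‖ ^ 2) l (𝓝 (∑' _ : Fin d → ℤ, (0 : ℝ))) := by
    refine tendsto_tsum_of_dominated_convergence (bound := fun n => C ^ 2 * ‖χ n‖ ^ 2)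
      (hχ.mul_left _) (fun n => ?_) ?_
    · have := ((h n).sub_const (G n)).norm.pow 2
      simpa using this
    · filter_upwards [hb] with i hi n
      rw [Real.norm_of_nonneg (by positivity), ← mul_pow]
      exact pow_le_pow_left₀ (norm_nonneg _) (hi n) 2
  rw [tsum_zero] at h1
  rw [tendsto_iff_norm_sub_tendsto_zero]
  have h2 : ∀ i, ‖F i - G‖ ^ 2 = ∑' n, ‖F i n - G n‖ ^ 2 := fun i => by
    have := lp.norm_rpow_eq_tsum (p := 2) (by simp) (F i - G)
    simpa only [ENNReal.toReal_ofNat, Real.rpow_two, lp.coeFn_sub, Pi.sub_apply] using this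
  have h3 := (h1.congr fun i => (h2 i).symm).sqrt
  simpa using h3

/-- Multiplication by `e^{-itW}`. -/
def phaseGroup {d : ℕ} (W : (Fin d → ℤ) → ℝ) (t : ℝ) : L2Z d →L[ℂ] L2Z d :=
  have hn : ∀ (ψ : L2Z d) n, ‖Complex.exp (Complex.I * (-(t * W n) : ℝ)) * ψ n‖ = ‖ψ n‖ :=
    fun ψ n => by rw [norm_mul, mul_comm Complex.I, Complex.norm_exp_ofReal_mul_I, one_mul]
  LinearMap.mkContinuous
    { toFun := fun ψ => ⟨fun n => Complex.exp (Complex.I * (-(t * W n) : ℝ)) * ψ n,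
        (lp.memℓp ψ).mono' fun n => (hn ψ n).le⟩
      map_add' := fun ψ φ => by ext n; exact mul_add _ _ _
      map_smul' := fun c ψ => by ext n; exact mul_left_comm _ _ _ }
    1 fun ψ => by
      rw [one_mul]
      exact lp.norm_mono (by simp) fun n => (hn ψ n).le

section phaseGroup

variable {d : ℕ} {W : (Fin d → ℤ) → ℝ}

theorem phaseGroup_apply (t : ℝ) (ψ : L2Z d) (n : Fin d → ℤ) :
    phaseGroup W t ψ n = Complex.exp (Complex.I * (-(t * W n) : ℝ)) * ψ n := rfl

theorem norm_phaseGroup_apply (t : ℝ) (ψ : L2Z d) (n : Fin d → ℤ) :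
    ‖phaseGroup W t ψ n‖ = ‖ψ n‖ := by
  rw [phaseGroup_apply, norm_mul, mul_comm Complex.I, Complex.norm_exp_ofReal_mul_I, one_mul]

theorem weightedNorm_phaseGroup (q t : ℝ) (ψ : L2Z d) :
    weightedNorm q (phaseGroup W t ψ) = weightedNorm q ψ := by
  have h : ∀ n, ‖phaseGroup W t ψ n‖ₑ = ‖ψ n‖ₑ := fun n => by
    rw [← ofReal_norm, norm_phaseGroup_apply, ofReal_norm]
  simp only [weightedNorm, h]

theorem phaseGroup_zero : phaseGroup W 0 = 1 := by
  ext ψ n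
  rw [phaseGroup_apply]
  simp

theorem phaseGroup_add (s t : ℝ) : phaseGroup W (s + t) = phaseGroup W s * phaseGroup W t := by
  ext ψ n
  change _ = phaseGroup W s (phaseGroup W t ψ) n
  rw [phaseGroup_apply, phaseGroup_apply, phaseGroup_apply, ← mul_assoc, ← Complex.exp_add,
    ← mul_add, ← Complex.ofReal_add, add_mul, neg_add]

theorem continuous_phaseGroup (ψ : L2Z d) : Continuous fun t => phaseGroup W t ψ := by
  refine continuous_iff_continuousAt.2 fun t₀ => ?_
  refine L2Z.tendsto_of_dominated ψ 2 (fun n => ?_) (Eventually.of_forall fun t n => ?_)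
  · have : Continuous fun t : ℝ => Complex.exp (Complex.I * (-(t * W n) : ℝ)) * ψ n := by
      fun_prop
    exact this.tendsto t₀
  · refine (norm_sub_le _ _).trans ?_
    rw [norm_phaseGroup_apply, norm_phaseGroup_apply]
    linarith

theorem hasDerivAt_phaseGroup_coord (ψ : L2Z d) (n : Fin d → ℤ) :
    HasDerivAt (fun t => phaseGroup W t ψ n) (-(Complex.I * (W n * ψ n))) 0 := by
  have h1 : HasDerivAt (fun t : ℝ => Complex.I * ((-(t * W n) : ℝ) : ℂ))
      (Complex.I * ((-(1 * W n) : ℝ) : ℂ)) 0 :=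
    ((((hasDerivAt_id (0 : ℝ)).mul_const (W n)).neg).ofReal_comp).const_mul Complex.I
  have h2 := (h1.cexp).mul_const (ψ n)
  convert! h2 using 1
  simp
  ring

/-- Since |e^{iθ} − 1| ≤ |θ|, the difference quotients are dominated by |W n ψ n| = |φ n|, which is
in ℓ². Hence the generator has the full maximal domain of multiplication by W. -/
theorem hasDerivAt_phaseGroup_iff (ψ φ : L2Z d) :
    HasDerivAt (fun t => phaseGroup W t ψ) (-(Complex.I • φ)) 0 ↔ ∀ n, φ n = W n * ψ n := by
  constructor
  · intro h n
    have h1 := ((lp.evalCLM ℂ (fun _ : Fin d → ℤ => ℂ) 2 n).restrictScalars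
      ℝ).hasFDerivAt.comp_hasDerivAt (0 : ℝ) h
    have h2 := h1.unique (hasDerivAt_phaseGroup_coord ψ n)
    have h3 : -(Complex.I * φ n) = -(Complex.I * (W n * ψ n)) := h2
    exact mul_left_cancel₀ Complex.I_ne_zero (neg_injective h3)
  · intro h
    rw [hasDerivAt_iff_tendsto_slope]
    refine L2Z.tendsto_of_dominated φ 2 (fun n => ?_) ?_
    · have h1 := hasDerivAt_iff_tendsto_slope.1 (hasDerivAt_phaseGroup_coord (W := W) ψ n)
      rw [← h n] at h1
      exact h1
    · filter_upwards [self_mem_nhdsWithin] with t ht n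
      have ht' : t ≠ 0 := ht
      refine (norm_sub_le _ _).trans ?_
      have e1 : slope (fun t => phaseGroup W t ψ) 0 t n =
          (t : ℂ)⁻¹ * ((Complex.exp (Complex.I * (-(t * W n) : ℝ)) - 1) * ψ n) := by
        have : slope (fun t => phaseGroup W t ψ) 0 t n =
            (t - 0 : ℝ)⁻¹ • (phaseGroup W t ψ n - phaseGroup W 0 ψ n) := rfl
        rw [this, phaseGroup_apply, phaseGroup_zero]
        simp [sub_mul]
      have e2 := Real.norm_exp_I_mul_ofReal_sub_one_le (x := -(t * W n))
      have e3 : ‖slope (fun t => phaseGroup W t ψ) 0 t n‖ ≤ ‖φ n‖ := by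
        rw [e1, norm_mul, norm_mul, h n, norm_mul, norm_inv, Complex.norm_real,
          inv_mul_le_iff₀ (norm_pos_iff.2 ht'), ← mul_assoc, Complex.norm_real]
        refine mul_le_mul_of_nonneg_right ?_ (norm_nonneg (ψ n))
        rwa [norm_neg, norm_mul] at e2
      have e4 : ‖(-(Complex.I • φ) : L2Z d) n‖ = ‖φ n‖ := by
        have : (-(Complex.I • φ) : L2Z d) n = -(Complex.I * φ n) := rfl
        rw [this, norm_neg, norm_mul, Complex.norm_I, one_mul]
      linarith

end phaseGroup

end QPLocalization

end

noncomputable section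

namespace QPLocalization

open Filter Topology

/-! ### From a diagonalization to the unitary group -/

section Diagonalized

variable {d : ℕ} {H : L2Z d →ₗ.[ℂ] L2Z d} {T T' : L2Z d →L[ℂ] L2Z d}

theorem single_mem_graph {W : (Fin d → ℤ) → ℂ}
    (hH : ∀ ψ φ : L2Z d, (∀ n, φ n = W n * ψ n) → (T ψ, T φ) ∈ H.graph) (n : Fin d → ℤ) :
    (T (lp.single 2 n 1), W n • T (lp.single 2 n 1)) ∈ H.graph := by
  rw [← map_smul]
  refine hH _ _ fun m => ?_
  rcases eq_or_ne m n with rfl | h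
  · rfl
  · have h1 : (lp.single 2 n (1 : ℂ) : L2Z d) m = 0 := by simp [h]
    rw [h1, mul_zero]
    exact (congrArg (W n * ·) h1).trans (mul_zero _)

/-- The eigenvalues of a symmetric operator are real. -/
theorem conj_eigenvalue_eq {W : (Fin d → ℤ) → ℂ} (hT : T' * T = 1)
    (hsymm : ∀ ψ φ ψ' φ', (ψ, φ) ∈ H.graph → (ψ', φ') ∈ H.graph → ⟪φ, ψ'⟫_ℂ = ⟪ψ, φ'⟫_ℂ)
    (hH : ∀ ψ φ : L2Z d, (∀ n, φ n = W n * ψ n) → (T ψ, T φ) ∈ H.graph) (n : Fin d → ℤ) :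
    conj (W n) = W n := by
  have h := hsymm _ _ _ _ (single_mem_graph hH n) (single_mem_graph hH n)
  rw [inner_smul_left, inner_smul_right] at h
  refine mul_right_cancel₀ ?_ h
  rw [inner_self_ne_zero]
  intro h0
  have h1 : T' (T (lp.single 2 n 1)) = lp.single 2 n 1 := by
    rw [← mul_apply_eq_comp, hT, one_apply_eq_self]
  rw [h0, map_zero] at h1
  have h2 : (0 : ℂ) = (lp.single 2 n (1 : ℂ) : L2Z d) n := congrArg (fun ψ : L2Z d => ψ n) h1
  simp at h2

variable {W : (Fin d → ℤ) → ℝ}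

/-- Eigenvectors of a symmetric operator with distinct real eigenvalues are orthogonal, so T*T is
diagonal. By continuity in χ, basis vectors suffice. -/
theorem inner_single_map (hW : Function.Injective W)
    (hsymm : ∀ ψ φ ψ' φ', (ψ, φ) ∈ H.graph → (ψ', φ') ∈ H.graph → ⟪φ, ψ'⟫_ℂ = ⟪ψ, φ'⟫_ℂ)
    (hH : ∀ ψ φ : L2Z d, (∀ n, φ n = W n * ψ n) → (T ψ, T φ) ∈ H.graph) (n : Fin d → ℤ)
    (χ : L2Z d) : ⟪T (lp.single 2 n 1), T χ⟫_ℂ =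
      ⟪T (lp.single 2 n 1), T (lp.single 2 n 1)⟫_ℂ * χ n := by
  have key : (innerSL ℂ (T (lp.single 2 n 1))).comp T =
      ⟪T (lp.single 2 n 1), T (lp.single 2 n 1)⟫_ℂ • lp.evalCLM ℂ (fun _ : Fin d → ℤ => ℂ) 2 n := by
    refine L2Z.ext_single fun m => ?_
    change ⟪T (lp.single 2 n 1), T (lp.single 2 m 1)⟫_ℂ =
      ⟪T (lp.single 2 n 1), T (lp.single 2 n 1)⟫_ℂ * (lp.single 2 m (1 : ℂ) : L2Z d) n
    rcases eq_or_ne n m with rfl | h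
    · simp
    · have h1 := hsymm _ _ _ _ (single_mem_graph (W := fun n => (W n : ℂ)) hH n)
        (single_mem_graph (W := fun n => (W n : ℂ)) hH m)
      rw [inner_smul_left, inner_smul_right, Complex.conj_ofReal] at h1
      have h2 : ((W n : ℂ) - W m) * ⟪T (lp.single 2 n 1), T (lp.single 2 m 1)⟫_ℂ = 0 := by
        rw [sub_mul, h1, sub_self]
      have h3 : (W n : ℂ) - W m ≠ 0 := by
        rw [sub_ne_zero]
        exact fun h4 => h (hW (Complex.ofReal_injective h4))
      rw [(mul_eq_zero.1 h2).resolve_left h3]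
      simp [h]
  exact congrArg (fun S : L2Z d →L[ℂ] ℂ => S χ) key

/-- A symmetric operator that is diagonalized, with simple spectrum, by a bounded invertible
operator generates the conjugated multiplication group. -/
theorem isUnitaryGroupOf_conj (hTT' : T * T' = 1) (hT'T : T' * T = 1)
    (hW : Function.Injective W)
    (hsymm : ∀ ψ φ ψ' φ', (ψ, φ) ∈ H.graph → (ψ', φ') ∈ H.graph → ⟪φ, ψ'⟫_ℂ = ⟪ψ, φ'⟫_ℂ)
    (hH : ∀ ψ φ : L2Z d, (∀ n, φ n = W n * ψ n) → (T ψ, T φ) ∈ H.graph) :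
    IsUnitaryGroupOf H fun t => T * phaseGroup W t * T' := by
  have hadd : ∀ s t, T * phaseGroup W (s + t) * T' =
      T * phaseGroup W s * T' * (T * phaseGroup W t * T') := fun s t => by
    calc T * phaseGroup W (s + t) * T' = T * phaseGroup W s * 1 * phaseGroup W t * T' := by
          rw [phaseGroup_add]; noncomm_ring
      _ = _ := by rw [← hT'T]; noncomm_ring
  have hzero : T * phaseGroup W 0 * T' = 1 := by rw [phaseGroup_zero, mul_one, hTT']
  have hTT'a : ∀ ψ, T (T' ψ) = ψ := fun ψ => by
    rw [← mul_apply_eq_comp, hTT', one_apply_eq_self]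
  have hT'Ta : ∀ ψ, T' (T ψ) = ψ := fun ψ => by
    rw [← mul_apply_eq_comp, hT'T, one_apply_eq_self]
  have hgram := inner_single_map hW hsymm hH
  have hsingle : ∀ t n, phaseGroup W t (lp.single 2 n 1) =
      Complex.exp (Complex.I * (-(t * W n) : ℝ)) • (lp.single 2 n 1 : L2Z d) := fun t n => by
    ext m
    rw [phaseGroup_apply]
    rcases eq_or_ne m n with rfl | h
    · rfl
    · have h1 : (lp.single 2 n (1 : ℂ) : L2Z d) m = 0 := by simp [h]
      rw [h1, mul_zero]
      exact ((congrArg (Complex.exp (Complex.I * (-(t * W n) : ℝ)) * ·) h1).trans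
        (mul_zero _)).symm
  -- The diagonal T*T commutes with the diagonal unitary e^{−itW}, whose phases cancel.
  have hstar : ∀ t, star (T * phaseGroup W t) * (T * phaseGroup W t) = star T * T := fun t => by
    ext ψ n
    rw [← L2Z.inner_single_left, ← L2Z.inner_single_left]
    change ⟪_, ContinuousLinearMap.adjoint (T * phaseGroup W t) ((T * phaseGroup W t) ψ)⟫_ℂ =
      ⟪_, ContinuousLinearMap.adjoint T (T ψ)⟫_ℂ
    rw [ContinuousLinearMap.adjoint_inner_right, ContinuousLinearMap.adjoint_inner_right,
      mul_apply_eq_comp, mul_apply_eq_comp, hsingle, map_smul, inner_smul_left, hgram n ψ,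
      hgram n (phaseGroup W t ψ), phaseGroup_apply]
    have h1 : conj (Complex.exp (Complex.I * (-(t * W n) : ℝ))) *
        Complex.exp (Complex.I * (-(t * W n) : ℝ)) = 1 := by
      rw [Complex.conj_mul', mul_comm Complex.I, Complex.norm_exp_ofReal_mul_I]
      simp
    linear_combination (⟪T (lp.single 2 n 1), T (lp.single 2 n 1)⟫_ℂ * ψ n) * h1
  have hunit : ∀ t, star (T * phaseGroup W t * T') * (T * phaseGroup W t * T') = 1 := fun t => by
    calc star (T * phaseGroup W t * T') * (T * phaseGroup W t * T')
        = star T' * (star (T * phaseGroup W t) * (T * phaseGroup W t)) * T' := by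
          rw [star_mul (T * phaseGroup W t) T']; noncomm_ring
      _ = star (T * T') * (T * T') := by rw [hstar, star_mul]; noncomm_ring
      _ = 1 := by rw [hTT', star_one, one_mul]
  refine ⟨fun t => ?_, hzero, hadd, fun ψ => ?_, fun ψ φ => ?_⟩
  · refine Unitary.mem_iff.2 ⟨hunit t, ?_⟩
    have h1 : T * phaseGroup W t * T' * (T * phaseGroup W (-t) * T') = 1 := by
      rw [← hadd, add_neg_cancel, hzero]
    -- The isometry has its adjoint as left inverse and time −t as right inverse; these coincide, so
    -- it is unitary.
    have h2 : star (T * phaseGroup W t * T') = T * phaseGroup W (-t) * T' :=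
      left_inv_eq_right_inv (hunit t) h1
    rw [h2, h1]
  · exact T.continuous.comp (continuous_phaseGroup (T' ψ))
  · have hiff : HasDerivAt (fun t => (T * phaseGroup W t * T') ψ) (-(Complex.I • φ)) 0 ↔
        HasDerivAt (fun t => phaseGroup W t (T' ψ)) (-(Complex.I • T' φ)) 0 := by
      constructor
      · intro h
        have h1 := ((T').restrictScalars ℝ).hasFDerivAt.comp_hasDerivAt (0 : ℝ) h
        have h2 : ⇑((T').restrictScalars ℝ) ∘ (fun t => (T * phaseGroup W t * T') ψ) =
            fun t => phaseGroup W t (T' ψ) := funext fun t => hT'Ta _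
        rw [h2] at h1
        simpa using h1
      · intro h
        have h1 := (T.restrictScalars ℝ).hasFDerivAt.comp_hasDerivAt (0 : ℝ) h
        have h2 : ⇑(T.restrictScalars ℝ) ∘ (fun t => phaseGroup W t (T' ψ)) =
            fun t => (T * phaseGroup W t * T') ψ := rfl
        rw [h2] at h1
        simpa [hTT'a] using h1
    refine Iff.trans ?_ (hiff.trans (hasDerivAt_phaseGroup_iff _ _)).symm
    constructor
    -- Pairing an arbitrary graph element with the eigenvector T δ_n gives (T'φ)(n) = W n (T'ψ)(n),
    -- so H is no larger than the conjugated multiplication operator.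
    · intro h n
      have h1 := hsymm _ _ _ _ (single_mem_graph (W := fun n => (W n : ℂ)) hH n) h
      rw [inner_smul_left, Complex.conj_ofReal] at h1
      have h2 := hgram n (T' ψ)
      have h3 := hgram n (T' φ)
      rw [hTT'a] at h2 h3
      rw [h2, h3] at h1
      have h4 : ⟪T (lp.single 2 n 1), T (lp.single 2 n 1)⟫_ℂ ≠ 0 := by
        rw [inner_self_ne_zero]
        intro h0
        have h5 := hT'Ta (lp.single 2 n 1)
        rw [h0, map_zero] at h5
        have h6 : (0 : ℂ) = (lp.single 2 n (1 : ℂ) : L2Z d) n :=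
          congrArg (fun ψ : L2Z d => ψ n) h5
        simp at h6
      refine mul_left_cancel₀ h4 ?_
      rw [← h1]; ring
    · intro h
      have h1 := hH _ _ h
      rwa [hTT'a, hTT'a] at h1

end Diagonalized

theorem isUnitaryGroupOf_expNegI {E : Type*} [NormedAddCommGroup E] [InnerProductSpace ℂ E]
    [CompleteSpace E] {H : E →ₗ.[ℂ] E} {U : ℝ → E →L[ℂ] E} (hH : Dense (H.domain : Set E))
    (hU : IsUnitaryGroupOf H U) : IsUnitaryGroupOf H (expNegI H) ∧ expNegI H = U := by
  have hex : ∃ U, IsUnitaryGroupOf H U := ⟨U, hU⟩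
  have h : expNegI H = hex.choose := funext fun t => dif_pos hex
  have h1 : IsUnitaryGroupOf H (expNegI H) := by rw [h]; exact hex.choose_spec
  exact ⟨h1, h1.unique hH hU⟩

/-! ### The Hamiltonian -/

section Hamiltonian

variable {d : ℕ} {ω : Fin d → ℝ} {V : ℂ → ℂ} {M : Kernel d} {A : KernelAlg ω} {x : ℝ}

/-- The kernel part is bounded and everywhere defined, so both domain conditions are automatic: Vψ =
φ − Aψ lies in ℓ² once φ and ψ do. -/
theorem mem_graph_hamiltonian_iff (hA : ∀ (y : ℝ) n, A.coef n y = M y n) (ψ φ : L2Z d) :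
    (ψ, φ) ∈ (hamiltonian ω V M x).graph ↔
      ∀ n, φ n = A.rep x ψ n + V (x - dot n ω) * ψ n := by
  have hAx : ∀ n l, M ((x : ℂ) - dot n ω) (l - n) = A.coef (l - n) ((x : ℂ) - dot n ω) :=
    fun n l => by rw [← Complex.ofReal_sub, hA]
  have hact : ∀ ψ : L2Z d, (fun n => ∑' l, M ((x : ℂ) - dot n ω) (l - n) * ψ l) =
      A.act x ψ := fun ψ => by
    funext n
    simp only [hAx]
    rfl
  have hdom : ∀ ψ : L2Z d, ψ ∈ (kernelOp ω M x).domain := fun ψ => by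
    refine ⟨fun n => ?_, ?_⟩
    · simp only [hAx]
      exact KernelAlg.summable_act x A ψ n
    · have := hact ψ
      change Memℓp (fun n => ∑' l, M ((x : ℂ) - dot n ω) (l - n) * ψ l) 2
      rw [this]
      exact KernelAlg.memℓp_act x A ψ
  rw [LinearPMap.mem_graph_iff]
  constructor
  · rintro ⟨⟨y, hy⟩, rfl, h2⟩ n
    have h3 := congrArg (fun ψ : L2Z d => ψ n) h2
    refine h3.symm.trans ?_
    exact congrArg (· + V (x - dot n ω) * y n) (congrFun (hact y) n)
  · intro h
    have hV : Memℓp (fun n => V ((x : ℂ) - dot n ω) * ψ n) 2 := by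
      have h1 : (fun n => V ((x : ℂ) - dot n ω) * ψ n) = ⇑(φ - A.rep x ψ) := by
        funext n
        rw [lp.coeFn_sub, Pi.sub_apply, h n]
        ring
      rw [h1]
      exact lp.memℓp _
    refine ⟨⟨ψ, hdom ψ, hV⟩, rfl, ?_⟩
    ext n
    refine Eq.trans ?_ (h n).symm
    exact congrArg (· + V (x - dot n ω) * ψ n) (congrFun (hact ψ) n)

theorem adjoint_rep_eq {R : ℝ} (hR : 0 < R) (hA : ∀ (y : ℝ) n, A.coef n y = M y n)
    (hM : IsSelfAdjointKernel R ω M) (ψ φ : L2Z d) : ⟪A.rep x ψ, φ⟫_ℂ = ⟪ψ, A.rep x φ⟫_ℂ := by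
  have h : ContinuousLinearMap.adjoint (A.rep x) = A.rep x := by
    refine L2Z.ext_single fun l => ?_
    ext n
    rw [← L2Z.inner_single_left, ContinuousLinearMap.adjoint_inner_right,
      ← inner_conj_symm, L2Z.inner_single_left, KernelAlg.rep_single, KernelAlg.rep_single,
      ← Complex.ofReal_sub, ← Complex.ofReal_sub, hA, hA]
    have h1 := hM ((x - dot n ω : ℝ) : ℂ) (ofReal_mem_strip hR _) (l - n)
    rw [← h1, Complex.conj_ofReal, neg_sub, dot_sub]
    congr 2
    push_cast
    ring
  rw [← ContinuousLinearMap.adjoint_inner_right, h]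

theorem hamiltonian_symmetric {R : ℝ} (hR : 0 < R) (hA : ∀ (y : ℝ) n, A.coef n y = M y n)
    (hM : IsSelfAdjointKernel R ω M) (hV : IsSelfAdjointPotential R V) {ψ φ ψ' φ' : L2Z d}
    (h : (ψ, φ) ∈ (hamiltonian ω V M x).graph) (h' : (ψ', φ') ∈ (hamiltonian ω V M x).graph) :
    ⟪φ, ψ'⟫_ℂ = ⟪ψ, φ'⟫_ℂ := by
  rw [mem_graph_hamiltonian_iff hA] at h h'
  have e : ⟪φ - A.rep x ψ, ψ'⟫_ℂ = ⟪ψ, φ' - A.rep x ψ'⟫_ℂ := by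
    rw [lp.inner_eq_tsum, lp.inner_eq_tsum]
    refine tsum_congr fun n => ?_
    have h1 : (φ - A.rep x ψ) n = V (x - dot n ω) * ψ n := by
      rw [lp.coeFn_sub, Pi.sub_apply, h n]; ring
    have h2 : (φ' - A.rep x ψ') n = V (x - dot n ω) * ψ' n := by
      rw [lp.coeFn_sub, Pi.sub_apply, h' n]; ring
    have h3 : conj (V ((x : ℂ) - dot n ω)) = V ((x : ℂ) - dot n ω) := by
      have := hV ((x - dot n ω : ℝ) : ℂ) (ofReal_mem_strip hR _)
      rwa [Complex.conj_ofReal, Complex.ofReal_sub] at this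
    rw [h1, h2]
    simp only [RCLike.inner_apply, map_mul, h3]
    ring
  rw [inner_sub_left, inner_sub_right, adjoint_rep_eq hR hA hM] at e
  exact sub_left_injective e

theorem single_mem_graph_hamiltonian (hA : ∀ (y : ℝ) n, A.coef n y = M y n) (n : Fin d → ℤ) :
    ((lp.single 2 n 1 : L2Z d), A.rep x (lp.single 2 n 1) +
      V (x - dot n ω) • (lp.single 2 n 1 : L2Z d)) ∈ (hamiltonian ω V M x).graph := by
  rw [mem_graph_hamiltonian_iff hA]
  intro m
  rw [lp.coeFn_add, Pi.add_apply]
  congr 1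
  rcases eq_or_ne m n with rfl | h
  · rfl
  · have h1 : (lp.single 2 n (1 : ℂ) : L2Z d) m = 0 := by simp [h]
    rw [h1, mul_zero]
    exact (congrArg (V (x - dot n ω) * ·) h1).trans (mul_zero _)

theorem dense_hamiltonian_domain (hA : ∀ (y : ℝ) n, A.coef n y = M y n) :
    Dense ((hamiltonian ω V M x).domain : Set (L2Z d)) := by
  intro ψ
  refine mem_closure_of_tendsto (lp.hasSum_single (by simp) ψ) (Eventually.of_forall fun s => ?_)
  refine Submodule.sum_mem _ fun n _ => ?_
  have h1 : (lp.single 2 n (ψ n) : L2Z d) = ψ n • lp.single 2 n 1 := by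
    rw [← lp.single_smul, smul_eq_mul, mul_one]
  rw [h1]
  exact Submodule.smul_mem _ _
    (LinearPMap.mem_domain_of_mem_graph (single_mem_graph_hamiltonian hA n))

/-- Pairing an element of the adjoint graph with δ_n recovers the coordinate formula that
characterises the graph of H; symmetry gives the other inclusion. The diagonalization plays no part.
-/
theorem isSelfAdjoint_hamiltonian {R : ℝ} (hR : 0 < R) (hA : ∀ (y : ℝ) n, A.coef n y = M y n)
    (hM : IsSelfAdjointKernel R ω M) (hV : IsSelfAdjointPotential R V) :
    IsSelfAdjoint (hamiltonian ω V M x) := by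
  have hd := dense_hamiltonian_domain (V := V) (x := x) hA
  rw [LinearPMap.isSelfAdjoint_def]
  refine le_antisymm (LinearPMap.le_of_le_graph ?_) (LinearPMap.IsFormalAdjoint.le_adjoint hd ?_)
  · rintro ⟨y, z⟩ hyz
    rw [LinearPMap.mem_graph_iff] at hyz
    obtain ⟨⟨y, hy⟩, rfl, rfl⟩ := hyz
    rw [mem_graph_hamiltonian_iff hA]
    intro n
    have hf := LinearPMap.adjoint_isFormalAdjoint hd
    have hg := single_mem_graph_hamiltonian (V := V) (x := x) hA n
    have hdom := LinearPMap.mem_domain_of_mem_graph hg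
    have h1 := hf ⟨y, hy⟩ ⟨_, hdom⟩
    have h2 : (hamiltonian ω V M x) ⟨_, hdom⟩ = _ :=
      ((LinearPMap.image_iff hdom).2 hg).symm
    rw [h2] at h1
    change ⟪_, (lp.single 2 n 1 : L2Z d)⟫_ℂ = ⟪y, _⟫_ℂ at h1
    rw [inner_add_right, inner_smul_right, ← adjoint_rep_eq hR hA hM] at h1
    have h3 := congrArg conj h1
    rw [map_add, map_mul, inner_conj_symm, inner_conj_symm, inner_conj_symm,
      L2Z.inner_single_left, L2Z.inner_single_left, L2Z.inner_single_left] at h3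
    have h4 : conj (V ((x : ℂ) - dot n ω)) = V ((x : ℂ) - dot n ω) := by
      have := hV ((x - dot n ω : ℝ) : ℂ) (ofReal_mem_strip hR _)
      rwa [Complex.conj_ofReal, Complex.ofReal_sub] at this
    rw [h4] at h3
    exact h3
  · intro ψ φ
    exact hamiltonian_symmetric hR hA hM hV ((hamiltonian ω V M x).mem_graph ψ)
      ((hamiltonian ω V M x).mem_graph φ)

/-- The diagonalization intertwines `H_x` with a multiplication operator. -/
theorem rep_mem_graph_hamiltonian (hA : ∀ (y : ℝ) n, A.coef n y = M y n) {U : KernelAlg ω}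
    {w : BddFun} (hx : IsRegularPoint ω V x)
    (hU : ∀ y : ℝ, IsRegularPoint ω V y → ∀ n : Fin d → ℤ, (V y - V (y - dot n ω)) * U.coef n y =
      (U * KernelAlg.diag w - A * U).coef n y) (ψ φ : L2Z d)
    (h : ∀ n, φ n = (V (x - dot n ω) + w (x - dot n ω)) * ψ n) :
    (U.rep x ψ, U.rep x φ) ∈ (hamiltonian ω V M x).graph := by
  rw [mem_graph_hamiltonian_iff hA]
  intro n
  have h1 : A.rep x (U.rep x ψ) = (A * U).rep x ψ := by
    rw [KernelAlg.rep_mul]; rfl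
  rw [h1, KernelAlg.rep_apply, KernelAlg.rep_apply, KernelAlg.rep_apply, ← tsum_mul_left,
    ← (KernelAlg.summable_act x (A * U) ψ n).tsum_add
      ((KernelAlg.summable_act x U ψ n).mul_left _)]
  refine tsum_congr fun l => ?_
  have hy : IsRegularPoint ω V ((x - dot n ω : ℝ) : ℂ) := by
    rw [Complex.ofReal_sub]; exact hx.sub_dot n
  have h2 := hU (x - dot n ω) hy (l - n)
  -- The twist moves V and w from the row phase x − n·ω to the column phase x − l·ω, so column l
  -- carries a single eigenvalue.
  have h3 : (x : ℂ) - dot n ω - ((dot l ω : ℂ) - dot n ω) = x - dot l ω := by ring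
  rw [KernelAlg.coef_sub, BddFun.sub_apply, KernelAlg.coef_mul_diag, BddFun.mul_apply,
    BddFun.shift_apply, dot_sub, Complex.ofReal_sub, Complex.ofReal_sub, h3] at h2
  rw [h l]
  linear_combination (-ψ l) * h2

end Hamiltonian

end QPLocalization

end

/-! ### Uniform dynamical localization -/

open QPLocalization

theorem theorem1p3 (d : ℕ) (hd : 1 ≤ d) (R α₀ γ τ δ s q v : ℝ)
    (hR : 0 < R) (hα₀ : 0 < α₀) (hγ : 0 < γ) (hτ : (d : ℝ) < τ) (hδ : 0 < δ) (hq : 0 ≤ q)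
    (hs : α₀ + τ + q + (d : ℝ) / 2 + 7 * δ < s) :
    ∃ ε₀ : ℝ, 0 < ε₀ ∧
      ∀ ω : Fin d → ℝ, IsDiophantine τ γ ω →
      ∀ V : ℂ → ℂ, MemP R V → sepConst R V = v → IsSelfAdjointPotential R V →
      ∀ M : Kernel d, MemU R s M → IsSelfAdjointKernel R ω M →
        kernelNorm R s M < ENNReal.ofReal ε₀ →
        (∀ x ∈ regularPhases ω V, IsSelfAdjoint (hamiltonian ω V M x) ∧
          IsUnitaryGroupOf (hamiltonian ω V M x) (expNegI (hamiltonian ω V M x))) ∧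
        ∀ ψ : L2Z d, weightedNorm q ψ < ⊤ →
          (⨆ x ∈ regularPhases ω V, ⨆ t : ℝ,
            weightedNorm q (expNegI (hamiltonian ω V M x) t ψ)) < ⊤ := by
  -- For v ≤ 0 no potential qualifies, since |V|_R is positive, and any ε₀ will do.
  rcases le_or_gt v 0 with hv | hv
  · refine ⟨1, one_pos, fun ω _ V hV hVv => ?_⟩
    exact absurd (hV.isGreatest hR).2 (by rw [hVv]; exact not_lt.2 hv)
  have hd1 : (1 : ℝ) ≤ d := by exact_mod_cast hd
  have hτ0 : 0 < τ := by linarith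
  obtain ⟨ε, hε, hdiag⟩ := exists_diagonalization d (R := R) (τ := τ) (γ := γ) (v := v) (s := s)
    (q := q) hR hγ hτ0 hv hq (by linarith) (by linarith)
  obtain ⟨C, hC, hker⟩ := exists_kernelAlg_of_memU d (R := R) (s := s) hR (by linarith)
  refine ⟨ε / C, by positivity, fun ω hω V hV hVv hVs M hM hMs hMn => ?_⟩
  have hsep : SepBound R V v := by
    have := (hV.isGreatest hR).1.1
    rwa [hVv] at this
  obtain ⟨P, A, hP, hPn, hPA, hA⟩ := hker ω M (ε / C) (by positivity) hM hMn.le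
  rw [mul_div_cancel₀ _ hC.ne'] at hPn
  obtain ⟨U, U', w, hUU', hU'U, hUq, hUq', hlip, hcomm⟩ := hdiag ω hω V hV hsep P A hP hPn hPA
  have main : ∀ x ∈ regularPhases ω V, IsSelfAdjoint (hamiltonian ω V M x) ∧
      IsUnitaryGroupOf (hamiltonian ω V M x) (expNegI (hamiltonian ω V M x)) ∧
      ∃ W : (Fin d → ℤ) → ℝ, expNegI (hamiltonian ω V M x) =
        fun t => U.rep x * phaseGroup W t * U'.rep x := by
    intro x hx
    have hTT' : U.rep x * U'.rep x = 1 := by rw [← KernelAlg.rep_mul, hUU', KernelAlg.rep_one]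
    have hT'T : U'.rep x * U.rep x = 1 := by rw [← KernelAlg.rep_mul, hU'U, KernelAlg.rep_one]
    have hsymm : ∀ ψ φ ψ' φ', (ψ, φ) ∈ (hamiltonian ω V M x).graph →
        (ψ', φ') ∈ (hamiltonian ω V M x).graph → ⟪φ, ψ'⟫_ℂ = ⟪ψ, φ'⟫_ℂ :=
      fun ψ φ ψ' φ' h h' => hamiltonian_symmetric hR hA hMs hVs h h'
    have hgraph := rep_mem_graph_hamiltonian (M := M) hA (x := x) hx hcomm
    have hreal := conj_eigenvalue_eq hT'T hsymm hgraph
    choose W hW using fun n => Complex.conj_eq_iff_real.1 (hreal n)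
    simp only [hW] at hgraph
    -- If two eigenvalues agreed, V and w would have opposite differences at the two phases, one at
    -- least v‖(m−n)·ω‖ > 0 in modulus and the other at most half of that.
    have hinj : Function.Injective W := by
      intro n m hnm
      by_contra hne
      have hz : ((x - dot n ω : ℝ) : ℂ) ∈ strip R := ofReal_mem_strip hR _
      have h1 : (((x - dot n ω : ℝ) : ℂ) - (dot (m - n) ω : ℂ)) = x - dot m ω := by
        rw [dot_sub]; push_cast; ring
      have h2 : 0 < torusNorm (dot (m - n) ω) :=
        (div_pos hγ (Real.rpow_pos_of_pos (jap_pos _) _)).trans_le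
          (hω.2 (m - n) (sub_ne_zero.2 (Ne.symm hne)))
      have h3 := hsep (dot (m - n) ω) _ hz (by rw [Complex.ofReal_sub]; exact hx n)
        (by rw [h1]; exact hx m)
      have h4 := hlip (x - dot n ω) (dot (m - n) ω)
      rw [h1] at h3 h4
      have h5 := hW n
      have h6 := hW m
      rw [hnm, ← h6, ← Complex.ofReal_sub] at h5
      have h7 : V ((x - dot n ω : ℝ) : ℂ) - V ((x : ℂ) - dot m ω) =
          -(w ((x - dot n ω : ℝ) : ℂ) - w ((x : ℂ) - dot m ω)) := by
        linear_combination h5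
      rw [h7, norm_neg] at h3
      have h8 := h3.trans h4
      have h9 := mul_pos hv h2
      linarith
    have hgroup := isUnitaryGroupOf_conj hTT' hT'T hinj hsymm hgraph
    have hexp := isUnitaryGroupOf_expNegI (dense_hamiltonian_domain (V := V) (x := x) hA) hgroup
    exact ⟨isSelfAdjoint_hamiltonian hR hA hMs hVs, hexp.1, W, hexp.2⟩
  refine ⟨fun x hx => ⟨(main x hx).1, (main x hx).2.1⟩, fun ψ hψ => ?_⟩
  -- The bound is the product of the weighted norms of U, U⁻¹ and ψ, none of which involves x or t.
  refine lt_of_le_of_lt (iSup₂_le fun x hx => iSup_le fun t => ?_)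
    (ENNReal.mul_lt_top hUq (ENNReal.mul_lt_top hUq' hψ))
  obtain ⟨W, hW⟩ := (main x hx).2.2
  rw [hW]
  calc weightedNorm q (U.rep x (phaseGroup W t (U'.rep x ψ)))
      ≤ KernelAlg.wnorm (polyWeight q) U * weightedNorm q (phaseGroup W t (U'.rep x ψ)) :=
        KernelAlg.weightedNorm_act_le x U hq _
    _ = KernelAlg.wnorm (polyWeight q) U * weightedNorm q (U'.rep x ψ) := by
        rw [weightedNorm_phaseGroup]
    _ ≤ KernelAlg.wnorm (polyWeight q) U *
        (KernelAlg.wnorm (polyWeight q) U' * weightedNorm q ψ) :=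
        mul_le_mul_right (KernelAlg.weightedNorm_act_le x U' hq _) _
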